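/- \textbf{Conventions.} An $\omega$-category is a set $A$ with maps $s_n=d_n^-,\ t_n=d_n^+:A\to A$ and partial operations $*_n$ ($n\ge 0$), $x*_n y$ being defined exactly when $t_nx=s_ny$, such that: $d_m^\beta d_n^\alpha x$ equals $d_m^\beta x$ if $m<n$ and $d_n^\alpha x$ if $m\ge n$; $s_nx*_nx=x=x*_nt_nx$; $s_n(x*_ny)=s_nx$, $t_n(x*_ny)=t_ny$, and $d_m^\alpha(x*_ny)=d_m^\alpha x*_nd_m^\alpha y$ for $m\ne n$; each $*_n$ is associative; the exchange law $(x*_ny)*_m(z*_nw)=(x*_mz)*_n(y*_mw)$ holds for $m\ne n$ whenever both sides make sense; and for each $x$ there is $n$ with $s_nx=t_nx=x$, the least such $n$ being $\dim x$. An $\omega$-functor is a map commuting with all $s_n,t_n,*_n$; this gives the category $\omega Cat$. For an $\omega$-category $\mathcal D$, $tr^n\mathcal D$ is the set of elements of dimension at most $n$, and $\mathcal D_n$ the set of those of dimension exactly $n$. An $\omega$-category $\mathcal C$ is non-contracting if $\dim s_1x=\dim t_1x=1$ whenever $\dim x\ge1$; an $\omega$-functor $f$ is non-contracting if $\dim x=1$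 implies $\dim f(x)=1$. Non-contracting $\omega$-categories and non-contracting $\omega$-functors form the category $\omega Cat_1$. For $\mathcal C$ in $\omega Cat_1$, the path $\omega$-category $\mathbb P\mathcal C$ consists of the elements of $\mathcal C$ of dimension at least $1$, with $n$-th source, target and composition those of $\mathcal C$ of index $n+1$. This is a functor $\mathbb P:\omega Cat_1\to\omega Cat$. \textbf{The functor $\mathbb P^-$.} Let $\mathbb U$ be the forgetful functor from $\omega Cat$ to globular sets (the $n$-cells of $\mathbb U\mathcal D$ are the elements of $tr^n\mathcal D$), and $\mathbb F$ its left adjoint. Let $\mathcal R^-$ be the equivalence relation on $\mathbb P\mathcal C$ generated by the pairs $(x,x*_0y)$ with $x$, $y$ and $x*_0y$ (composite in $\mathcal C$) in $\mathbb P\mathcal C$. Let $\phi:\mathbb U\mathbb P\mathcal C\to\mathbb U\mathbb P\mathcal C/\mathcal R^-$ be the quotient morphism of globular sets. Define $\mathbb P^-\mathcal C$ and $h^-_{\mathcal C}:\mathbb P\mathcal C\to\mathbb P^-\mathcal C$ by the pushout in $\omega Cat$ of $\mathbb F(\phi):\mathbb F\mathbb U\mathbb P\mathcal C\to\mathbb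 F(\mathbb U\mathbb P\mathcal C/\mathcal R^-)$ and the counit $\mathbb F\mathbb U\mathbb P\mathcal C\to\mathbb P\mathcal C$. This gives a functor $\mathbb P^-:\omega Cat_1\to\omega Cat$ and a natural transformation $h^-:\mathbb P\to\mathbb P^-$. The map $s_0:\mathbb P\mathcal C\to\mathcal C_0$ is compatible with $\mathcal R^-$ and induces $s_0:\mathbb P^-\mathcal C\to\mathcal C_0$. \textbf{Cubes and simplexes.} $I^n$ and $\Delta^n$ denote the $\omega$-categories of the $n$-cube and of the $n$-simplex, freely generated by their faces. Faces of $I^n$ are words of length $n$ in $\{-,0,+\}$; the source (resp. target) of a face contains the faces obtained by replacing the $i$-th zero by $(-)^i$ (resp. $(-)^{i+1}$). Faces of $\Delta^n$ are non-empty strictly increasing sequences in $\{0,\dots,n\}$; the source (resp. target) of a face contains the faces obtained by removing an element in odd (resp. even) position, positions being counted from $1$. Write $R(w)$ for the element of $I^n$ generated by a face $w$, $0_n=0\cdots0$ and $-_n=-\cdots-$. \textbf{Cuts.} A cut is a triple $(\mathcal F,P,ev)$ where $\mathcal F$ is a functor from $\omega Cat_1$ to augmented simplicial sets, $P:\omega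 Cat_1\to\omega Cat$ is a functor, and $ev=(ev_n)_{n\ge0}$ is a family of natural transformations $ev_n:\mathcal F_n\to tr^nP$. A morphism of cuts $(\mathcal F,P,ev)\to(\mathcal G,Q,ev)$ is a pair $(\varphi,\psi)$ of natural transformations $\varphi:\mathcal F\to\mathcal G$ (of functors to augmented simplicial sets) and $\psi:P\to Q$ such that $ev_n\circ\varphi_n=tr^n(\psi)\circ ev_n$ for all $n\ge0$. The branching semi-cubical cut $(\mathcal N^-,\mathbb P,ev)$ is given as follows. For $n\ge0$, $\mathcal N^-_n(\mathcal C)=\omega Cat(I^{n+1},\mathcal C)^-$ is the set of $\omega$-functors $x:I^{n+1}\to\mathcal C$ such that $\dim x(u)=1$ for each $u\in I^{n+1}$ with $\dim u=1$ and $s_0u=R(-_{n+1})$. The faces $\partial_i$ ($0\le i\le n$) are given by $(\partial_ix)(k_1\dots k_n)=x(k_1\dots k_i\,{-}\,k_{i+1}\dots k_n)$ and the degeneracies by $(\epsilon_ix)(k_1\dots k_{n+2})=x(k_1\dots\max(k_{i+1},k_{i+2})\dots k_{n+2})$, where $-<0<+$. Moreover $\mathcal N^-_{-1}(\mathcal C)=\mathcal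 C_0$, the augmentation is $x\mapsto s_0(x(R(0_1)))$, and $ev_n(x)=x(R(0_{n+1}))$. The branching semi-globular cut $(\mathcal N^{gl^-},\mathbb P^-,ev)$ is given as follows. For $n\ge0$, $\mathcal N^{gl^-}_n(\mathcal C)=\omega Cat(\Delta^n,\mathbb P^-\mathcal C)$, with the simplicial structure induced by the cosimplicial $\omega$-category $\Delta^*$. Moreover $\mathcal N^{gl^-}_{-1}(\mathcal C)=\mathcal C_0$, the augmentation is $x\mapsto s_0(x(0))$, and $ev_n(x)=x(0<1<\dots<n)$. \textbf{Theorem.} There exists one and only one morphism of cuts $(\varphi,\psi)$ from the branching semi-cubical cut $(\mathcal N^-,\mathbb P,ev)$ to the branching semi-globular cut $(\mathcal N^{gl^-},\mathbb P^-,ev)$ such that $\psi=h^-$. -/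

import Mathlib

open CategoryTheory CategoryTheory.Limits

universe u v w

namespace Omega

/-! ### Strict globular `ω`-categories (single-sorted) -/

/-- A strict globular `ω`-category, presented by its set `A` of morphisms of all dimensions.
`d false n` is the `n`-source map `s_n = d_n^-` and `d true n` is the `n`-target map
`t_n = d_n^+`; the composite `x *_n y` is defined exactly when `t_n x = s_n y`. -/
class OmegaCategory (A : Type u) where
  d : Bool → ℕ → A → A
  comp : (n : ℕ) → (x y : A) → d true n x = d false n y → A
  d_d_of_lt : ∀ {m n : ℕ} (α β : Bool) (x : A), m < n → d β m (d α n x) = d β m x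
  d_d_of_ge : ∀ {m n : ℕ} (α β : Bool) (x : A), n ≤ m → d β m (d α n x) = d α n x
  source_comp : ∀ (n : ℕ) (x : A) (h : d true n (d false n x) = d false n x),
    comp n (d false n x) x h = x
  comp_target : ∀ (n : ℕ) (x : A) (h : d true n x = d false n (d true n x)),
    comp n x (d true n x) h = x
  d_false_comp : ∀ (n : ℕ) (x y : A) (h : d true n x = d false n y),
    d false n (comp n x y h) = d false n x
  d_true_comp : ∀ (n : ℕ) (x y : A) (h : d true n x = d false n y),
    d true n (comp n x y h) = d true n y
  d_comp : ∀ {m n : ℕ} (α : Bool) (x y : A) (_ : m ≠ n) (h : d true n x = d false n y)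
    (h' : d true n (d α m x) = d false n (d α m y)),
    d α m (comp n x y h) = comp n (d α m x) (d α m y) h'
  assoc : ∀ (n : ℕ) (x y z : A) (hxy : d true n x = d false n y) (hyz : d true n y = d false n z)
    (h : d true n (comp n x y hxy) = d false n z) (h' : d true n x = d false n (comp n y z hyz)),
    comp n (comp n x y hxy) z h = comp n x (comp n y z hyz) h'
  exchange : ∀ {m n : ℕ} (x y z w : A) (_ : m ≠ n)
    (hxy : d true n x = d false n y) (hzw : d true n z = d false n w)
    (hxz : d true m x = d false m z) (hyw : d true m y = d false m w)
    (h : d true m (comp n x y hxy) = d false m (comp n z w hzw))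
    (h' : d true n (comp m x z hxz) = d false n (comp m y w hyw)),
    comp m (comp n x y hxy) (comp n z w hzw) h = comp n (comp m x z hxz) (comp m y w hyw) h'
  exists_dim : ∀ x : A, ∃ n : ℕ, d false n x = x ∧ d true n x = x

open OmegaCategory

section Basic

variable {A : Type u} [OmegaCategory A]

/-- The dimension of `x`: the least `n` with `s_n x = t_n x = x`. -/
noncomputable def dim (x : A) : ℕ := sInf {n : ℕ | d false n x = x ∧ d true n x = x}

theorem comp_congr {n : ℕ} {x x' y y' : A} (hx : x = x') (hy : y = y')
    (h : d true n x = d false n y) :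
    comp n x y h = comp n x' y' (by rw [← hx, ← hy]; exact h) := by
  subst hx hy; rfl

theorem dim_spec (x : A) : d false (dim x) x = x ∧ d true (dim x) x = x :=
  Nat.sInf_mem (s := {n : ℕ | d false n x = x ∧ d true n x = x}) (exists_dim x)

theorem dim_le_iff (x : A) (n : ℕ) (α : Bool) : dim x ≤ n ↔ d α n x = x := by
  constructor
  · intro h
    have h1 := dim_spec x
    rw [← h1.1]
    exact d_d_of_ge _ _ _ h
  · intro h
    apply Nat.sInf_le
    constructor <;> (rw [← h]; exact d_d_of_ge _ _ _ le_rfl)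

theorem d_of_dim_le {x : A} {n : ℕ} (α : Bool) (h : dim x ≤ n) : d α n x = x :=
  (dim_le_iff x n α).1 h

theorem dim_d_le (α : Bool) (n : ℕ) (x : A) : dim (d α n x) ≤ n :=
  (dim_le_iff _ n α).2 (d_d_of_ge _ _ _ le_rfl)

end Basic

/-- `ω`-functors: maps commuting with all sources, targets and composites. -/
@[ext]
structure OmegaFunctor (A : Type u) (B : Type v) [OmegaCategory A] [OmegaCategory B] where
  toFun : A → B
  map_d : ∀ (α : Bool) (n : ℕ) (x : A), toFun (d α n x) = d α n (toFun x)
  map_comp : ∀ (n : ℕ) (x y : A) (h : d true n x = d false n y)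
    (h' : d true n (toFun x) = d false n (toFun y)),
    toFun (comp n x y h) = comp n (toFun x) (toFun y) h'

namespace OmegaFunctor

variable {A : Type u} {B : Type v} {C : Type w}
  [OmegaCategory A] [OmegaCategory B] [OmegaCategory C]

instance : CoeFun (OmegaFunctor A B) (fun _ => A → B) := ⟨OmegaFunctor.toFun⟩

theorem map_composable (f : OmegaFunctor A B) {n : ℕ} {x y : A} (h : d true n x = d false n y) :
    d true n (f x) = d false n (f y) := by
  rw [← f.map_d, ← f.map_d, h]

/-- The identity `ω`-functor. -/
def id (A : Type u) [OmegaCategory A] : OmegaFunctor A A := ⟨fun x => x, fun _ _ _ => rfl,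
  fun _ _ _ _ _ => rfl⟩

/-- Composition of `ω`-functors, in diagrammatic order. -/
def comp (f : OmegaFunctor A B) (g : OmegaFunctor B C) : OmegaFunctor A C where
  toFun x := g (f x)
  map_d α n x := by rw [f.map_d, g.map_d]
  map_comp n x y h h' := by
    rw [f.map_comp n x y h (f.map_composable h), g.map_comp]

theorem dim_le (f : OmegaFunctor A B) (x : A) : dim (f x) ≤ dim x :=
  (dim_le_iff _ _ false).2 (by rw [← f.map_d, d_of_dim_le false le_rfl])

end OmegaFunctor

/-- The category `ωCat` of `ω`-categories and `ω`-functors: objects. -/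
structure OmegaCat where
  carrier : Type u
  [str : OmegaCategory carrier]

instance : CoeSort OmegaCat.{u} (Type u) := ⟨OmegaCat.carrier⟩

instance (C : OmegaCat.{u}) : OmegaCategory C := C.str

instance : Category OmegaCat.{u} where
  Hom C D := OmegaFunctor C D
  id C := OmegaFunctor.id C
  comp f g := OmegaFunctor.comp f g

/-- The set `tr^n C` of morphisms of dimension at most `n`, as a functor of `C`. -/
noncomputable def tr (n : ℕ) : OmegaCat.{u} ⥤ Type u where
  obj C := {x : C // dim x ≤ n}
  map {_ _} f := TypeCat.ofHom fun x => ⟨f.toFun x.1, (f.dim_le x.1).trans x.2⟩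

/-! ### Non-contracting `ω`-categories and the path `ω`-category -/

/-- `C` is non-contracting if the `1`-source and the `1`-target of each morphism of dimension at
least `1` are `1`-dimensional. -/
def NonContracting (A : Type u) [OmegaCategory A] : Prop :=
  ∀ x : A, 1 ≤ dim x → dim (d false 1 x) = 1 ∧ dim (d true 1 x) = 1

/-- An `ω`-functor is non-contracting if it preserves `1`-dimensional morphisms. -/
def OmegaFunctor.NonContracting {A : Type u} {B : Type v} [OmegaCategory A] [OmegaCategory B]
    (f : OmegaFunctor A B) : Prop :=
  ∀ x : A, dim x = 1 → dim (f x) = 1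

/-- The category `ωCat₁` of non-contracting `ω`-categories and non-contracting `ω`-functors:
objects. -/
structure NCOmegaCat where
  carrier : Type u
  [str : OmegaCategory carrier]
  nonContracting : NonContracting carrier

instance : CoeSort NCOmegaCat.{u} (Type u) := ⟨NCOmegaCat.carrier⟩

instance (C : NCOmegaCat.{u}) : OmegaCategory C := C.str

/-- Morphisms of `ωCat₁`. -/
@[ext]
structure NCOmegaCat.Hom (C D : NCOmegaCat.{u}) where
  functor : OmegaFunctor C D
  nonContracting : functor.NonContracting

instance : Category NCOmegaCat.{u} where
  Hom C D := NCOmegaCat.Hom C D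
  id C := ⟨OmegaFunctor.id C, fun _ h => h⟩
  comp f g := ⟨f.functor.comp g.functor, fun x h => g.nonContracting _ (f.nonContracting x h)⟩

namespace NCOmegaCat

variable (C : NCOmegaCat.{u})

theorem dim_d_one {x : C} (h : 1 ≤ dim x) (α : Bool) : dim (d α 1 x) = 1 := by
  cases α
  · exact (C.nonContracting x h).1
  · exact (C.nonContracting x h).2

variable {C}

theorem one_le_dim_of_d_one {x : C} {α : Bool} (h : dim (d α 1 x) = 1) : 1 ≤ dim x := by
  by_contra h0
  have h1 : dim x ≤ 1 := by omega
  rw [d_of_dim_le α h1] at h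
  omega

theorem one_le_dim_d {x : C} (h : 1 ≤ dim x) (α : Bool) (n : ℕ) : 1 ≤ dim (d α (n + 1) x) := by
  rcases Nat.eq_zero_or_pos n with rfl | hn
  · exact (C.dim_d_one h α).ge
  · apply one_le_dim_of_d_one (α := α)
    rw [d_d_of_lt _ _ _ (by omega)]
    exact C.dim_d_one h α

theorem one_le_dim_comp {x y : C} (hx : 1 ≤ dim x) (n : ℕ)
    (h : d true (n + 1) x = d false (n + 1) y) : 1 ≤ dim (comp (n + 1) x y h) := by
  apply one_le_dim_of_d_one (α := false)
  have : d false 1 (comp (n + 1) x y h) = d false 1 x := by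
    rcases Nat.eq_zero_or_pos n with rfl | hn
    · exact d_false_comp _ _ _ _
    · rw [← d_d_of_lt false false (comp (n + 1) x y h) (show 1 < n + 1 by omega), d_false_comp,
        d_d_of_lt _ _ _ (by omega)]
  rw [this]
  exact C.dim_d_one hx false

theorem Hom.one_le_dim {C D : NCOmegaCat.{u}} (f : NCOmegaCat.Hom C D) {x : C} (h : 1 ≤ dim x) :
    1 ≤ dim (f.functor x) := by
  apply one_le_dim_of_d_one (α := false)
  rw [← f.functor.map_d]
  exact f.nonContracting _ (C.dim_d_one h false)

/-- The underlying set of the path `ω`-category `ℙC`: the morphisms of dimension at least `1`. -/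
def Path (C : NCOmegaCat.{u}) : Type u := {x : C // 1 ≤ dim x}

/-- The path `ω`-category: `(ℙC)_i = C_{i+1}`, with the operations of `C` shifted by one. -/
instance (C : NCOmegaCat.{u}) : OmegaCategory C.Path where
  d α n x := ⟨d α (n + 1) x.1, one_le_dim_d x.2 α n⟩
  comp n x y h := ⟨comp (n + 1) x.1 y.1 (congrArg Subtype.val h), one_le_dim_comp x.2 n _⟩
  d_d_of_lt α β x h := Subtype.ext (d_d_of_lt α β x.1 (by omega))
  d_d_of_ge α β x h := Subtype.ext (d_d_of_ge α β x.1 (by omega))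
  source_comp n x h := Subtype.ext (source_comp _ _ _)
  comp_target n x h := Subtype.ext (comp_target _ _ _)
  d_false_comp n x y h := Subtype.ext (d_false_comp _ _ _ _)
  d_true_comp n x y h := Subtype.ext (d_true_comp _ _ _ _)
  d_comp α x y hmn h h' := Subtype.ext (d_comp α x.1 y.1 (by omega) _ _)
  assoc n x y z _ _ _ _ := Subtype.ext (assoc (n + 1) x.1 y.1 z.1 _ _ _ _)
  exchange {m n} x y z w hmn _ _ _ _ _ _ :=
    Subtype.ext (exchange (m := m + 1) (n := n + 1) x.1 y.1 z.1 w.1 (by omega) _ _ _ _ _ _)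
  exists_dim x := by
    obtain ⟨n, -⟩ := exists_dim x.1
    exact ⟨dim x.1, Subtype.ext (d_of_dim_le _ (Nat.le_succ _)),
      Subtype.ext (d_of_dim_le _ (Nat.le_succ _))⟩

theorem dim_path_le_iff {C : NCOmegaCat.{u}} (x : C.Path) (n : ℕ) :
    dim x ≤ n ↔ dim x.1 ≤ n + 1 := by
  rw [dim_le_iff _ _ false, dim_le_iff _ _ false]
  exact Subtype.ext_iff

end NCOmegaCat

/-- The path functor `ℙ : ωCat₁ ⥤ ωCat`. -/
def pathFunctor : NCOmegaCat.{u} ⥤ OmegaCat.{u} where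
  obj C := ⟨C.Path⟩
  map {_ _} f :=
    { toFun := fun x => ⟨f.functor x.1, f.one_le_dim x.2⟩
      map_d := fun α n x => Subtype.ext (f.functor.map_d _ _ _)
      map_comp := fun n x y h h' => Subtype.ext (f.functor.map_comp _ _ _ _ _) }

/-- The functor `C ↦ C₀` of `0`-dimensional morphisms. -/
noncomputable def zeroCells : NCOmegaCat.{u} ⥤ Type u where
  obj C := {x : C // dim x = 0}
  map {_ _} f := TypeCat.ofHom fun x =>
    ⟨f.functor x.1, Nat.le_zero.1 ((f.functor.dim_le x.1).trans x.2.le)⟩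

/-! ### `ω`-categories presented by generators and relations -/

/-- Generators together with relations of the forms `d_n^α x = y`, `x *_n y = z` and `x = y`
between generators, so that each generator has a finite dimension. -/
structure Presentation where
  X : Type u
  relD : X → Bool → ℕ → X → Prop
  relC : ℕ → X → X → X → Prop
  relE : X → X → Prop
  fin : ∀ x, ∃ n, relD x false n x ∧ relD x true n x

namespace Presentation

/-- Formal expressions in the generators. -/
inductive Term (X : Type u) : Type u
  | gen (x : X) : Term X
  | d (α : Bool) (n : ℕ) (t : Term X) : Term X
  | comp (n : ℕ) (a b : Term X) : Term X

/-- The partial congruence on expressions generated by the relations and by the axioms of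
`ω`-categories; an expression `t` is meaningful when `Rel P t t`. -/
inductive Rel (P : Presentation.{u}) : Term P.X → Term P.X → Prop
  | gen (x : P.X) : Rel P (.gen x) (.gen x)
  | relD {x y : P.X} {α : Bool} {n : ℕ} : P.relD x α n y → Rel P (.d α n (.gen x)) (.gen y)
  | relC {x y z : P.X} {n : ℕ} : P.relC n x y z →
      Rel P (.d true n (.gen x)) (.d false n (.gen y)) → Rel P (.comp n (.gen x) (.gen y)) (.gen z)
  | relE {x y : P.X} : P.relE x y → Rel P (.gen x) (.gen y)
  | symm {a b : Term P.X} : Rel P a b → Rel P b a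
  | trans {a b c : Term P.X} : Rel P a b → Rel P b c → Rel P a c
  | d_congr {a b : Term P.X} (α : Bool) (n : ℕ) : Rel P a b → Rel P (.d α n a) (.d α n b)
  | comp_congr {a a' b b' : Term P.X} {n : ℕ} : Rel P a a' → Rel P b b' →
      Rel P (.d true n a) (.d false n b) → Rel P (.comp n a b) (.comp n a' b')
  | d_d_of_lt {a : Term P.X} {m n : ℕ} (α β : Bool) : Rel P a a → m < n →
      Rel P (.d β m (.d α n a)) (.d β m a)
  | d_d_of_ge {a : Term P.X} {m n : ℕ} (α β : Bool) : Rel P a a → n ≤ m →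
      Rel P (.d β m (.d α n a)) (.d α n a)
  | source_comp {a : Term P.X} (n : ℕ) : Rel P a a → Rel P (.comp n (.d false n a) a) a
  | comp_target {a : Term P.X} (n : ℕ) : Rel P a a → Rel P (.comp n a (.d true n a)) a
  | d_false_comp {a b : Term P.X} {n : ℕ} : Rel P a a → Rel P b b →
      Rel P (.d true n a) (.d false n b) → Rel P (.d false n (.comp n a b)) (.d false n a)
  | d_true_comp {a b : Term P.X} {n : ℕ} : Rel P a a → Rel P b b →
      Rel P (.d true n a) (.d false n b) → Rel P (.d true n (.comp n a b)) (.d true n b)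
  | d_comp {a b : Term P.X} {m n : ℕ} (α : Bool) : m ≠ n → Rel P a a → Rel P b b →
      Rel P (.d true n a) (.d false n b) →
      Rel P (.d α m (.comp n a b)) (.comp n (.d α m a) (.d α m b))
  | assoc {a b c : Term P.X} {n : ℕ} : Rel P a a → Rel P b b → Rel P c c →
      Rel P (.d true n a) (.d false n b) → Rel P (.d true n b) (.d false n c) →
      Rel P (.comp n (.comp n a b) c) (.comp n a (.comp n b c))
  | exchange {x y z w : Term P.X} {m n : ℕ} : m ≠ n →
      Rel P x x → Rel P y y → Rel P z z → Rel P w w →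
      Rel P (.d true n x) (.d false n y) → Rel P (.d true n z) (.d false n w) →
      Rel P (.d true m x) (.d false m z) → Rel P (.d true m y) (.d false m w) →
      Rel P (.d true m (.comp n x y)) (.d false m (.comp n z w)) →
      Rel P (.d true n (.comp m x z)) (.d false n (.comp m y w)) →
      Rel P (.comp m (.comp n x y) (.comp n z w)) (.comp n (.comp m x z) (.comp m y w))

/-- Meaningful expressions. -/
def Valid (P : Presentation.{u}) : Type u := {t : Term P.X // Rel P t t}

instance (P : Presentation.{u}) : Setoid P.Valid where
  r a b := Rel P a.1 b.1
  iseqv := ⟨fun a => a.2, Rel.symm, Rel.trans⟩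

/-- The presented `ω`-category. -/
def Carrier (P : Presentation.{u}) : Type u := Quotient (inferInstance : Setoid P.Valid)

variable {P : Presentation.{u}}

/-- The class of a meaningful expression. -/
def cls (t : Term P.X) (h : Rel P t t) : P.Carrier := Quotient.mk _ ⟨t, h⟩

theorem cls_eq {a b : Term P.X} {ha : Rel P a a} {hb : Rel P b b} :
    cls a ha = cls b hb ↔ Rel P a b :=
  ⟨fun h => Quotient.exact h, fun h => Quotient.sound h⟩

theorem exists_rep (q : P.Carrier) : ∃ (t : Term P.X) (h : Rel P t t), cls t h = q := by
  induction q using Quotient.inductionOn with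
  | h t => exact ⟨t.1, t.2, rfl⟩

/-- Sources and targets of classes. -/
def cd (α : Bool) (n : ℕ) (q : P.Carrier) : P.Carrier :=
  Quotient.map (fun t => ⟨.d α n t.1, t.2.d_congr α n⟩) (fun _ _ h => Rel.d_congr α n h) q

theorem cd_mk (α : Bool) (n : ℕ) (t : Term P.X) (h : Rel P t t) :
    cd α n (cls t h) = cls (.d α n t) (h.d_congr α n) := rfl

/-- A representative. -/
noncomputable def rep (q : P.Carrier) : Term P.X := (exists_rep q).choose

theorem rep_rel (q : P.Carrier) : Rel P (rep q) (rep q) := (exists_rep q).choose_spec.choose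

theorem mk_rep (q : P.Carrier) : cls (rep q) (rep_rel q) = q :=
  (exists_rep q).choose_spec.choose_spec

theorem rep_composable {n : ℕ} {p q : P.Carrier} (h : cd true n p = cd false n q) :
    Rel P (.d true n (rep p)) (.d false n (rep q)) := by
  rw [← mk_rep p, ← mk_rep q, cd_mk, cd_mk, cls_eq] at h
  exact h

/-- Composition of classes. -/
noncomputable def ccomp (n : ℕ) (p q : P.Carrier) (h : cd true n p = cd false n q) : P.Carrier :=
  cls (.comp n (rep p) (rep q)) (.comp_congr (rep_rel p) (rep_rel q) (rep_composable h))

theorem ccomp_mk {n : ℕ} {a b : Term P.X} {ha : Rel P a a} {hb : Rel P b b}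
    (h : cd true n (cls a ha) = cd false n (cls b hb)) :
    ccomp n (cls a ha) (cls b hb) h =
      cls (.comp n a b) (.comp_congr ha hb (cls_eq.1 h)) :=
  cls_eq.2 (.comp_congr (cls_eq.1 (mk_rep _)) (cls_eq.1 (mk_rep _)) (rep_composable h))

theorem exists_dim_aux (a : Term P.X) : Rel P a a →
    ∃ N, ∀ n, N ≤ n → ∀ α, Rel P (.d α n a) a := by
  have key : ∀ {a : Term P.X} {n : ℕ}, Rel P a a → Rel P (.d false n a) a →
      Rel P (.d true n a) a → ∀ m, n ≤ m → ∀ α, Rel P (.d α m a) a := by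
    intro a n ha h1 _ m hm α
    exact ((Rel.d_congr α m h1.symm).trans (.d_d_of_ge _ _ ha hm)).trans h1
  suffices H : ∀ {a b : Term P.X}, Rel P a b →
      (∃ N, ∀ n, N ≤ n → ∀ α, Rel P (.d α n a) a) ∧
      (∃ N, ∀ n, N ≤ n → ∀ α, Rel P (.d α n b) b) from fun h => (H h).1
  have transfer : ∀ {a b : Term P.X}, Rel P a b →
      (∃ N, ∀ n, N ≤ n → ∀ α, Rel P (.d α n a) a) →
      (∃ N, ∀ n, N ≤ n → ∀ α, Rel P (.d α n b) b) := by
    rintro a b h ⟨N, hN⟩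
    exact ⟨N, fun n hn α => ((Rel.d_congr α n h.symm).trans (hN n hn α)).trans h⟩
  have hd : ∀ {a : Term P.X} (α : Bool) (m : ℕ), Rel P a a →
      (∃ N, ∀ n, N ≤ n → ∀ β, Rel P (.d β n (.d α m a)) (.d α m a)) :=
    fun α m ha => ⟨m, fun n hn β => .d_d_of_ge _ _ ha hn⟩
  have hc : ∀ {a b : Term P.X} {m : ℕ}, Rel P a a → Rel P b b →
      Rel P (.d true m a) (.d false m b) →
      (∃ N, ∀ n, N ≤ n → ∀ α, Rel P (.d α n a) a) →
      (∃ N, ∀ n, N ≤ n → ∀ α, Rel P (.d α n b) b) →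
      (∃ N, ∀ n, N ≤ n → ∀ β, Rel P (.d β n (.comp m a b)) (.comp m a b)) := by
    rintro a b m ha hb h ⟨N, hN⟩ ⟨M, hM⟩
    refine ⟨N + M + m + 1, fun n hn β => (Rel.d_comp β (by omega) ha hb h).trans ?_⟩
    have h1 := hN n (by omega) β
    have h2 := hM n (by omega) β
    exact (Rel.comp_congr h1.symm h2.symm h).symm
  have hg : ∀ x : P.X, ∃ N, ∀ n, N ≤ n → ∀ α, Rel P (.d α n (.gen x)) (.gen x) := by
    intro x
    obtain ⟨n, h1, h2⟩ := P.fin x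
    exact ⟨n, key (.gen x) (.relD h1) (.relD h2)⟩
  intro a b h
  induction h with
  | gen x => exact ⟨hg x, hg x⟩
  | relD h => exact ⟨hd _ _ (.gen _), hg _⟩
  | relC _ h ih => exact ⟨hc (.gen _) (.gen _) h (hg _) (hg _), hg _⟩
  | relE h => exact ⟨hg _, hg _⟩
  | symm _ ih => exact ih.symm
  | trans _ _ ih1 ih2 => exact ⟨ih1.1, ih2.2⟩
  | d_congr α n h ih => exact ⟨hd _ _ (h.trans h.symm), hd _ _ (h.symm.trans h)⟩
  | comp_congr h1 h2 h ih1 ih2 ih =>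
    have h3 := hc (h1.trans h1.symm) (h2.trans h2.symm) h ih1.1 ih2.1
    exact ⟨h3, transfer (.comp_congr h1 h2 h) h3⟩
  | d_d_of_lt α β h _ ih => exact ⟨hd _ _ (h.d_congr _ _), hd _ _ h⟩
  | d_d_of_ge α β h _ ih => exact ⟨hd _ _ (h.d_congr _ _), hd _ _ h⟩
  | source_comp n h ih => exact ⟨transfer (Rel.source_comp n h).symm ih.1, ih.1⟩
  | comp_target n h ih => exact ⟨transfer (Rel.comp_target n h).symm ih.1, ih.1⟩
  | d_false_comp h1 h2 h ih1 ih2 ih => exact ⟨hd _ _ (.comp_congr h1 h2 h), hd _ _ h1⟩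
  | d_true_comp h1 h2 h ih1 ih2 ih => exact ⟨hd _ _ (.comp_congr h1 h2 h), hd _ _ h2⟩
  | @d_comp a b m n α hmn h1 h2 h ih1 ih2 ih =>
    have h3 := hd α m (Rel.comp_congr h1 h2 h)
    exact ⟨h3, transfer (.d_comp α hmn h1 h2 h) h3⟩
  | assoc h1 h2 h3 h4 h5 ih1 ih2 ih3 =>
    have h6 := hc (Rel.comp_congr h1 h2 h4) h3 ((Rel.d_true_comp h1 h2 h4).trans h5)
      (hc h1 h2 h4 ih1.1 ih2.1) ih3.1
    exact ⟨h6, transfer (.assoc h1 h2 h3 h4 h5) h6⟩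
  | exchange hmn hx hy hz hw hxy hzw hxz hyw h h' ihx ihy ihz ihw =>
    have h6 := hc (Rel.comp_congr hx hy hxy) (Rel.comp_congr hz hw hzw) h
      (hc hx hy hxy ihx.1 ihy.1) (hc hz hw hzw ihz.1 ihw.1)
    exact ⟨h6, transfer (.exchange hmn hx hy hz hw hxy hzw hxz hyw h h') h6⟩

noncomputable instance : OmegaCategory P.Carrier where
  d := cd
  comp := ccomp
  d_d_of_lt α β q h := by
    obtain ⟨t, ht, rfl⟩ := exists_rep q
    exact cls_eq.2 (.d_d_of_lt _ _ ht h)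
  d_d_of_ge α β q h := by
    obtain ⟨t, ht, rfl⟩ := exists_rep q
    exact cls_eq.2 (.d_d_of_ge _ _ ht h)
  source_comp n q h := by
    obtain ⟨t, ht, rfl⟩ := exists_rep q
    exact (ccomp_mk (ha := ht.d_congr false n) h).trans (cls_eq.2 (.source_comp n ht))
  comp_target n q h := by
    obtain ⟨t, ht, rfl⟩ := exists_rep q
    exact (ccomp_mk (hb := ht.d_congr true n) h).trans (cls_eq.2 (.comp_target n ht))
  d_false_comp n p q h := by
    obtain ⟨a, ha, rfl⟩ := exists_rep p
    obtain ⟨b, hb, rfl⟩ := exists_rep q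
    rw [ccomp_mk]
    exact cls_eq.2 (.d_false_comp ha hb (cls_eq.1 h))
  d_true_comp n p q h := by
    obtain ⟨a, ha, rfl⟩ := exists_rep p
    obtain ⟨b, hb, rfl⟩ := exists_rep q
    rw [ccomp_mk]
    exact cls_eq.2 (.d_true_comp ha hb (cls_eq.1 h))
  d_comp {m n} α p q hmn h h' := by
    obtain ⟨a, ha, rfl⟩ := exists_rep p
    obtain ⟨b, hb, rfl⟩ := exists_rep q
    rw [ccomp_mk]
    exact (cls_eq.2 (.d_comp α hmn ha hb (cls_eq.1 h))).trans
      (ccomp_mk (ha := ha.d_congr α m) (hb := hb.d_congr α m) h').symm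
  assoc n p q r hpq hqr h h' := by
    obtain ⟨a, ha, rfl⟩ := exists_rep p
    obtain ⟨b, hb, rfl⟩ := exists_rep q
    obtain ⟨c, hc, rfl⟩ := exists_rep r
    simp only [ccomp_mk]
    exact cls_eq.2 (.assoc ha hb hc (cls_eq.1 hpq) (cls_eq.1 hqr))
  exchange {m n} x y z w hmn hxy hzw hxz hyw h h' := by
    obtain ⟨x, hx, rfl⟩ := exists_rep x
    obtain ⟨y, hy, rfl⟩ := exists_rep y
    obtain ⟨z, hz, rfl⟩ := exists_rep z
    obtain ⟨w, hw, rfl⟩ := exists_rep w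
    simp only [ccomp_mk] at h h' ⊢
    exact cls_eq.2 (.exchange hmn hx hy hz hw (cls_eq.1 hxy) (cls_eq.1 hzw) (cls_eq.1 hxz)
      (cls_eq.1 hyw) (cls_eq.1 h) (cls_eq.1 h'))
  exists_dim q := by
    obtain ⟨a, ha, rfl⟩ := exists_rep q
    obtain ⟨N, hN⟩ := exists_dim_aux a ha
    exact ⟨N, cls_eq.2 (hN N le_rfl false), cls_eq.2 (hN N le_rfl true)⟩

/-- The presented `ω`-category as an object of `ωCat`. -/
noncomputable def toOmegaCat (P : Presentation.{u}) : OmegaCat.{u} := ⟨P.Carrier⟩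

/-- The generators, as morphisms of the presented `ω`-category. -/
def ofGen (x : P.X) : P.Carrier := cls (.gen x) (.gen x)

section Lift

variable {D : Type v} [OmegaCategory D] (g : P.X → D)

/-- Evaluation of expressions in an `ω`-category (a partial function). -/
inductive Eval (g : P.X → D) : Term P.X → D → Prop
  | gen (x : P.X) : Eval g (.gen x) (g x)
  | d (α : Bool) (n : ℕ) {t : Term P.X} {y : D} : Eval g t y →
      Eval g (.d α n t) (OmegaCategory.d α n y)
  | comp (n : ℕ) {a b : Term P.X} {y z : D}
      (h : OmegaCategory.d true n y = OmegaCategory.d false n z) :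
      Eval g a y → Eval g b z → Eval g (.comp n a b) (OmegaCategory.comp n y z h)

variable {g}

theorem Eval.unique {t : Term P.X} {y : D} (h : Eval g t y) : ∀ {z}, Eval g t z → y = z := by
  induction h with
  | gen x => rintro _ ⟨⟩; rfl
  | d α n _ ih => rintro _ (_ | ⟨_, _, h⟩); rw [ih h]
  | comp n h _ _ ih1 ih2 =>
    rintro _ (_ | _ | ⟨_, _, h1, h2⟩)
    exact comp_congr (ih1 h1) (ih2 h2) _

/-- The generators' images satisfy the defining relations. -/
structure Respects (P : Presentation.{u}) {D : Type v} [OmegaCategory D] (g : P.X → D) :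
    Prop where
  relD : ∀ {x α n y}, P.relD x α n y → OmegaCategory.d α n (g x) = g y
  relC : ∀ {n x y z}, P.relC n x y z → ∀ h, OmegaCategory.comp n (g x) (g y) h = g z
  relE : ∀ {x y}, P.relE x y → g x = g y

theorem Eval.composable {g : P.X → D} {a b : Term P.X} {n : ℕ}
    (h : ∃ y, Eval g (.d true n a) y ∧ Eval g (.d false n b) y) :
    ∃ y z, Eval g a y ∧ Eval g b z ∧ OmegaCategory.d true n y = OmegaCategory.d false n z := by
  have key : ∀ {t : Term P.X} {α : Bool} {y : D}, Eval g (.d α n t) y →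
      ∃ z, Eval g t z ∧ OmegaCategory.d α n z = y := by
    rintro t α y (_ | ⟨_, _, h⟩)
    exact ⟨_, h, rfl⟩
  obtain ⟨w, h1, h2⟩ := h
  obtain ⟨y, hy, e1⟩ := key h1
  obtain ⟨z, hz, e2⟩ := key h2
  exact ⟨y, z, hy, hz, e1.trans e2.symm⟩

theorem exists_eval (hg : Respects P g) {a b : Term P.X} (h : Rel P a b) :
    ∃ y, Eval g a y ∧ Eval g b y := by
  induction h with
  | gen x => exact ⟨_, .gen x, .gen x⟩
  | relD h => exact ⟨_, .d _ _ (.gen _), by rw [hg.relD h]; exact .gen _⟩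
  | relC h _ ih =>
    obtain ⟨_, _, ⟨⟩, ⟨⟩, hyz⟩ := Eval.composable ih
    exact ⟨_, .comp _ hyz (.gen _) (.gen _), by rw [hg.relC h hyz]; exact .gen _⟩
  | relE h => exact ⟨_, .gen _, by rw [hg.relE h]; exact .gen _⟩
  | symm _ ih => obtain ⟨y, h1, h2⟩ := ih; exact ⟨y, h2, h1⟩
  | trans _ _ ih1 ih2 =>
    obtain ⟨y, h1, h2⟩ := ih1
    obtain ⟨z, h3, h4⟩ := ih2
    exact ⟨y, h1, h2.unique h3 ▸ h4⟩
  | d_congr α n h ih => obtain ⟨y, h1, h2⟩ := ih; exact ⟨_, .d _ _ h1, .d _ _ h2⟩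
  | comp_congr _ _ _ ih1 ih2 ih =>
    obtain ⟨y, z, h1, h2, h⟩ := Eval.composable ih
    obtain ⟨y', h3, h4⟩ := ih1
    obtain ⟨z', h5, h6⟩ := ih2
    obtain rfl := h1.unique h3
    obtain rfl := h2.unique h5
    exact ⟨_, .comp _ h h1 h2, .comp _ h h4 h6⟩
  | d_d_of_lt α β _ h ih =>
    obtain ⟨y, h1, _⟩ := ih
    exact ⟨_, .d _ _ (.d _ _ h1), by rw [OmegaCategory.d_d_of_lt α β y h]; exact .d _ _ h1⟩
  | d_d_of_ge α β _ h ih =>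
    obtain ⟨y, h1, _⟩ := ih
    refine ⟨_, .d _ _ (.d _ _ h1), ?_⟩
    rw [OmegaCategory.d_d_of_ge α β y h]
    exact .d _ _ h1
  | source_comp n _ ih =>
    obtain ⟨y, h1, _⟩ := ih
    refine ⟨_, .comp n (OmegaCategory.d_d_of_ge _ _ _ le_rfl) (.d false n h1) h1, ?_⟩
    rw [OmegaCategory.source_comp]; exact h1
  | comp_target n _ ih =>
    obtain ⟨y, h1, _⟩ := ih
    refine ⟨_, .comp n (OmegaCategory.d_d_of_ge _ _ _ le_rfl).symm h1 (.d true n h1), ?_⟩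
    rw [OmegaCategory.comp_target]; exact h1
  | d_false_comp _ _ _ _ _ ih =>
    obtain ⟨y, z, h1, h2, h⟩ := Eval.composable ih
    refine ⟨_, .d _ _ (.comp _ h h1 h2), ?_⟩
    rw [OmegaCategory.d_false_comp]; exact .d _ _ h1
  | d_true_comp _ _ _ _ _ ih =>
    obtain ⟨y, z, h1, h2, h⟩ := Eval.composable ih
    refine ⟨_, .d _ _ (.comp _ h h1 h2), ?_⟩
    rw [OmegaCategory.d_true_comp]; exact .d _ _ h2
  | @d_comp a b m n α hmn _ _ _ _ _ ih =>
    obtain ⟨y, z, h1, h2, h⟩ := Eval.composable ih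
    have h' : OmegaCategory.d true n (OmegaCategory.d α m y) =
        OmegaCategory.d false n (OmegaCategory.d α m z) := by
      rcases lt_or_gt_of_ne hmn with hl | hl
      · rw [OmegaCategory.d_d_of_ge _ _ _ hl.le, OmegaCategory.d_d_of_ge _ _ _ hl.le,
          ← OmegaCategory.d_d_of_lt true α y hl, h, OmegaCategory.d_d_of_lt _ _ _ hl]
      · rw [OmegaCategory.d_d_of_lt _ _ _ hl, OmegaCategory.d_d_of_lt _ _ _ hl, h]
    refine ⟨_, .d _ _ (.comp _ h h1 h2), ?_⟩
    rw [OmegaCategory.d_comp α y z hmn h h']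
    exact .comp _ h' (.d _ _ h1) (.d _ _ h2)
  | assoc _ _ _ _ _ _ _ _ ih1 ih2 =>
    obtain ⟨y, z, h1, h2, h⟩ := Eval.composable ih1
    obtain ⟨z', w, h3, h4, h'⟩ := Eval.composable ih2
    obtain rfl := h2.unique h3
    have e1 := (OmegaCategory.d_true_comp _ y z h).trans h'
    have e2 := h.trans (OmegaCategory.d_false_comp _ z w h').symm
    refine ⟨_, .comp _ e1 (.comp _ h h1 h2) h4, ?_⟩
    rw [OmegaCategory.assoc _ y z w h h' e1 e2]
    exact .comp _ e2 h1 (.comp _ h' h2 h4)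
  | exchange hmn _ _ _ _ _ _ _ _ _ _ _ _ _ _ ihxy ihzw ihxz ihyw ih ih' =>
    obtain ⟨x, y, hx, hy, hxy⟩ := Eval.composable ihxy
    obtain ⟨z, w, hz, hw, hzw⟩ := Eval.composable ihzw
    obtain ⟨x', z', hx', hz', hxz⟩ := Eval.composable ihxz
    obtain ⟨y', w', hy', hw', hyw⟩ := Eval.composable ihyw
    obtain rfl := hx.unique hx'
    obtain rfl := hy.unique hy'
    obtain rfl := hz.unique hz'
    obtain rfl := hw.unique hw'
    obtain ⟨p, q, hp, hq, h⟩ := Eval.composable ih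
    obtain ⟨p', q', hp', hq', h'⟩ := Eval.composable ih'
    obtain rfl := Eval.unique (.comp _ hxy hx hy) hp
    obtain rfl := Eval.unique (.comp _ hzw hz hw) hq
    obtain rfl := Eval.unique (.comp _ hxz hx hz) hp'
    obtain rfl := Eval.unique (.comp _ hyw hy hw) hq'
    refine ⟨_, .comp _ h hp hq, ?_⟩
    rw [OmegaCategory.exchange x y z w hmn hxy hzw hxz hyw h h']
    exact .comp _ h' hp' hq'

theorem exists_eval_carrier (hg : Respects P g) (q : P.Carrier) :
    ∃ y, ∀ t h, cls t h = q → Eval g t y := by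
  obtain ⟨t, ht, rfl⟩ := exists_rep q
  obtain ⟨y, h1, _⟩ := exists_eval hg ht
  refine ⟨y, fun t' h' e => ?_⟩
  obtain ⟨z, h2, h3⟩ := exists_eval hg (cls_eq.1 e)
  exact (h3.unique h1) ▸ h2

/-- The `ω`-functor out of a presented `ω`-category determined by images of the generators. -/
noncomputable def lift (hg : Respects P g) : OmegaFunctor P.Carrier D where
  toFun q := (exists_eval_carrier hg q).choose
  map_d α n q := by
    obtain ⟨t, ht, rfl⟩ := exists_rep q
    exact ((exists_eval_carrier hg _).choose_spec (.d α n t) (ht.d_congr α n) rfl).unique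
      (.d α n ((exists_eval_carrier hg _).choose_spec t ht rfl))
  map_comp n p q h h' := by
    obtain ⟨a, ha, rfl⟩ := exists_rep p
    obtain ⟨b, hb, rfl⟩ := exists_rep q
    exact ((exists_eval_carrier hg _).choose_spec (.comp n a b)
      (.comp_congr ha hb (cls_eq.1 h)) (ccomp_mk h).symm).unique
      (.comp n h' ((exists_eval_carrier hg _).choose_spec a ha rfl)
        ((exists_eval_carrier hg _).choose_spec b hb rfl))

theorem lift_ofGen (hg : Respects P g) (x : P.X) : lift hg (ofGen x) = g x :=
  ((exists_eval_carrier hg _).choose_spec (.gen x) (.gen x) rfl).unique (.gen x)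

theorem functor_ext {f f' : OmegaFunctor P.Carrier D} (h : ∀ x, f (ofGen x) = f' (ofGen x)) :
    f = f' := by
  have key : ∀ t ht, f (cls t ht) = f' (cls t ht) := by
    suffices H : ∀ {a b : Term P.X}, Rel P a b →
        (∀ ha, f (cls a ha) = f' (cls a ha)) ∧ (∀ hb, f (cls b hb) = f' (cls b hb)) from
      fun t ht => (H ht).1 ht
    have tr : ∀ {a b : Term P.X}, Rel P a b → (∀ ha, f (cls a ha) = f' (cls a ha)) →
        (∀ hb, f (cls b hb) = f' (cls b hb)) := by
      intro a b hab h1 hb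
      rw [← cls_eq (ha := hab.trans hab.symm) |>.2 hab]
      exact h1 _
    have hd : ∀ {a : Term P.X} (α : Bool) (n : ℕ), Rel P a a →
        (∀ ha, f (cls a ha) = f' (cls a ha)) →
        ∀ hb, f (cls (.d α n a) hb) = f' (cls (.d α n a) hb) := by
      intro a α n ha h1 hb
      have e : cls (.d α n a) hb = OmegaCategory.d α n (cls a ha) := rfl
      rw [e, f.map_d, f'.map_d, h1]
    have hc : ∀ {a b : Term P.X} {n : ℕ}, Rel P a a → Rel P b b →
        Rel P (.d true n a) (.d false n b) →
        (∀ ha, f (cls a ha) = f' (cls a ha)) → (∀ hb, f (cls b hb) = f' (cls b hb)) →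
        ∀ hc, f (cls (.comp n a b) hc) = f' (cls (.comp n a b) hc) := by
      intro a b n ha hb hab h1 h2 hc
      have hh : OmegaCategory.d true n (cls a ha) = OmegaCategory.d false n (cls b hb) :=
        cls_eq.2 hab
      have e : cls (.comp n a b) hc = OmegaCategory.comp n (cls a ha) (cls b hb) hh :=
        (ccomp_mk hh).symm
      rw [e, f.map_comp _ _ _ hh (f.map_composable hh),
        f'.map_comp _ _ _ hh (f'.map_composable hh)]
      exact comp_congr (h1 _) (h2 _) _
    intro a b hab
    induction hab with
    | gen x => exact ⟨fun _ => h x, fun _ => h x⟩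
    | relD h' => exact ⟨hd _ _ (.gen _) fun _ => h _, fun _ => h _⟩
    | relC _ h' _ => exact ⟨hc (.gen _) (.gen _) h' (fun _ => h _) (fun _ => h _), fun _ => h _⟩
    | relE => exact ⟨fun _ => h _, fun _ => h _⟩
    | symm _ ih => exact ih.symm
    | trans _ _ ih1 ih2 => exact ⟨ih1.1, ih2.2⟩
    | d_congr α n h ih => exact ⟨hd _ _ (h.trans h.symm) ih.1, hd _ _ (h.symm.trans h) ih.2⟩
    | comp_congr h1 h2 h ih1 ih2 ih =>
      have h3 := hc (h1.trans h1.symm) (h2.trans h2.symm) h ih1.1 ih2.1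
      exact ⟨h3, tr (.comp_congr h1 h2 h) h3⟩
    | d_d_of_lt α β h _ ih =>
      exact ⟨hd _ _ (h.d_congr _ _) (hd _ _ h ih.1), hd _ _ h ih.1⟩
    | d_d_of_ge α β h _ ih =>
      exact ⟨hd _ _ (h.d_congr _ _) (hd _ _ h ih.1), hd _ _ h ih.1⟩
    | source_comp n h ih => exact ⟨tr (Rel.source_comp n h).symm ih.1, ih.1⟩
    | comp_target n h ih => exact ⟨tr (Rel.comp_target n h).symm ih.1, ih.1⟩
    | d_false_comp h1 h2 h ih1 ih2 ih =>
      exact ⟨hd _ _ (.comp_congr h1 h2 h) (hc h1 h2 h ih1.1 ih2.1), hd _ _ h1 ih1.1⟩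
    | d_true_comp h1 h2 h ih1 ih2 ih =>
      exact ⟨hd _ _ (.comp_congr h1 h2 h) (hc h1 h2 h ih1.1 ih2.1), hd _ _ h2 ih2.1⟩
    | @d_comp a b m n α hmn h1 h2 h ih1 ih2 ih =>
      have h3 := hd α m (Rel.comp_congr h1 h2 h) (hc h1 h2 h ih1.1 ih2.1)
      exact ⟨h3, tr (.d_comp α hmn h1 h2 h) h3⟩
    | assoc h1 h2 h3 h4 h5 ih1 ih2 ih3 =>
      have h6 := hc (Rel.comp_congr h1 h2 h4) h3 ((Rel.d_true_comp h1 h2 h4).trans h5)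
        (hc h1 h2 h4 ih1.1 ih2.1) ih3.1
      exact ⟨h6, tr (.assoc h1 h2 h3 h4 h5) h6⟩
    | exchange hmn hx hy hz hw hxy hzw hxz hyw h h' ihx ihy ihz ihw =>
      have h6 := hc (Rel.comp_congr hx hy hxy) (Rel.comp_congr hz hw hzw) h
        (hc hx hy hxy ihx.1 ihy.1) (hc hz hw hzw ihz.1 ihw.1)
      exact ⟨h6, tr (.exchange hmn hx hy hz hw hxy hzw hxz hyw h h') h6⟩
  apply OmegaFunctor.ext
  funext q
  obtain ⟨t, ht, rfl⟩ := exists_rep q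
  exact key t ht

end Lift

end Presentation

/-! ### Globular sets and free `ω`-categories -/

/-- Globular sets. -/
structure GlobSet where
  cells : ℕ → Type u
  s : ∀ n, cells (n + 1) → cells n
  t : ∀ n, cells (n + 1) → cells n
  s_s : ∀ n x, s n (s (n + 1) x) = s n (t (n + 1) x)
  t_s : ∀ n x, t n (s (n + 1) x) = t n (t (n + 1) x)

/-- Morphisms of globular sets. -/
@[ext]
structure GlobSet.Hom (G H : GlobSet.{u}) where
  app : ∀ n, G.cells n → H.cells n
  app_s : ∀ n x, app n (G.s n x) = H.s n (app (n + 1) x)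
  app_t : ∀ n x, app n (G.t n x) = H.t n (app (n + 1) x)

instance : Category GlobSet.{u} where
  Hom G H := GlobSet.Hom G H
  id G := ⟨fun _ x => x, fun _ _ => rfl, fun _ _ => rfl⟩
  comp f g := ⟨fun n x => g.app n (f.app n x), fun n x => by rw [f.app_s, g.app_s],
    fun n x => by rw [f.app_t, g.app_t]⟩

/-- The forgetful functor `𝕌 : ωCat ⥤ GlobSet`; its `n`-cells are the morphisms of dimension at
most `n`. -/
noncomputable def forgetGlob : OmegaCat.{u} ⥤ GlobSet.{u} where
  obj C :=
    { cells := fun n => {x : C // dim x ≤ n}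
      s := fun n x => ⟨d false n x.1, dim_d_le _ _ _⟩
      t := fun n x => ⟨d true n x.1, dim_d_le _ _ _⟩
      s_s := fun n x => Subtype.ext
        ((d_d_of_lt _ _ _ (Nat.lt_succ_self n)).trans (d_d_of_lt _ _ _ (Nat.lt_succ_self n)).symm)
      t_s := fun n x => Subtype.ext
        ((d_d_of_lt _ _ _ (Nat.lt_succ_self n)).trans
          (d_d_of_lt _ _ _ (Nat.lt_succ_self n)).symm) }
  map {_ _} f :=
    { app := fun n x => ⟨f.toFun x.1, (f.dim_le x.1).trans x.2⟩
      app_s := fun n x => Subtype.ext (f.map_d _ _ _)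
      app_t := fun n x => Subtype.ext (f.map_d _ _ _) }

namespace GlobSet

/-- The presentation of the free `ω`-category on a globular set: an `n`-cell is a generator of
dimension at most `n`, with the prescribed `(n-1)`-source and `(n-1)`-target. -/
def presentation (G : GlobSet.{u}) : Presentation.{u} where
  X := Σ n, G.cells n
  relD x α n y := (n = x.1 ∧ x = y) ∨
    ∃ z : G.cells (n + 1), x = ⟨n + 1, z⟩ ∧ y = ⟨n, if α then G.t n z else G.s n z⟩
  relC _ _ _ _ := False
  relE _ _ := False
  fin x := ⟨x.1, Or.inl ⟨rfl, rfl⟩, Or.inl ⟨rfl, rfl⟩⟩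

/-- The free `ω`-category on a globular set. -/
noncomputable def free (G : GlobSet.{u}) : OmegaCat.{u} := G.presentation.toOmegaCat

theorem d_ofGen_self (G : GlobSet.{u}) (n : ℕ) (x : G.cells n) (α : Bool) :
    d α n (Presentation.ofGen (P := G.presentation) ⟨n, x⟩) =
      Presentation.ofGen (P := G.presentation) ⟨n, x⟩ :=
  Presentation.cls_eq.2 (.relD (Or.inl ⟨rfl, rfl⟩))

theorem d_ofGen_succ (G : GlobSet.{u}) (n : ℕ) (x : G.cells (n + 1)) (α : Bool) :
    d α n (Presentation.ofGen (P := G.presentation) ⟨n + 1, x⟩) =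
      Presentation.ofGen (P := G.presentation) ⟨n, if α then G.t n x else G.s n x⟩ :=
  Presentation.cls_eq.2 (.relD (Or.inr ⟨x, rfl, rfl⟩))

theorem respects (G : GlobSet.{u}) {D : OmegaCat.{u}} (f : G ⟶ forgetGlob.obj D) :
    Presentation.Respects G.presentation (D := D) fun x => (f.app x.1 x.2).1 where
  relD := by
    rintro x α n y (⟨rfl, rfl⟩ | ⟨z, rfl, rfl⟩)
    · exact d_of_dim_le _ (f.app x.1 x.2).2
    · cases α
      · exact (congrArg Subtype.val (f.app_s n z)).symm
      · exact (congrArg Subtype.val (f.app_t n z)).symm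
  relC h := h.elim
  relE h := h.elim

/-- The universal property of the free `ω`-category. -/
noncomputable def freeEquiv (G : GlobSet.{u}) (D : OmegaCat.{u}) :
    (G.free ⟶ D) ≃ (G ⟶ forgetGlob.obj D) where
  toFun F :=
    { app := fun n x => ⟨F.toFun (Presentation.ofGen (P := G.presentation) ⟨n, x⟩),
        (dim_le_iff _ _ false).2
          ((F.map_d _ _ _).symm.trans (congrArg F.toFun (G.d_ofGen_self n x false)))⟩
      app_s := fun n x => Subtype.ext
        ((congrArg F.toFun (G.d_ofGen_succ n x false)).symm.trans (F.map_d _ _ _))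
      app_t := fun n x => Subtype.ext
        ((congrArg F.toFun (G.d_ofGen_succ n x true)).symm.trans (F.map_d _ _ _)) }
  invFun f := Presentation.lift (G.respects f)
  left_inv F := Presentation.functor_ext fun x => Presentation.lift_ofGen _ x
  right_inv f := by
    apply GlobSet.Hom.ext
    funext n x
    exact Subtype.ext (Presentation.lift_ofGen (G.respects f) _)

end GlobSet

/-- The free `ω`-category functor `𝔽 : GlobSet ⥤ ωCat`. -/
noncomputable def freeOmega : GlobSet.{u} ⥤ OmegaCat.{u} :=
  Adjunction.leftAdjointOfEquiv (G := forgetGlob) GlobSet.freeEquiv (fun _ _ _ _ _ => rfl)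

/-- The adjunction `𝔽 ⊣ 𝕌`. -/
noncomputable def freeAdj : freeOmega.{u} ⊣ forgetGlob.{u} :=
  Adjunction.adjunctionOfEquivLeft _ _

/-! ### Pushouts of `ω`-categories -/

section Pushout

variable {A B C : OmegaCat.{u}} (f : A ⟶ B) (g : A ⟶ C)

/-- The presentation of the pushout of `B ← A → C`. -/
def pushoutPresentation : Presentation.{u} where
  X := B ⊕ C
  relD x α n y := (∃ b : B, x = .inl b ∧ y = .inl (d α n b)) ∨
    ∃ c : C, x = .inr c ∧ y = .inr (d α n c)
  relC n x y z := (∃ (b b' : B) (h : d true n b = d false n b'),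
      x = .inl b ∧ y = .inl b' ∧ z = .inl (comp n b b' h)) ∨
    ∃ (c c' : C) (h : d true n c = d false n c'),
      x = .inr c ∧ y = .inr c' ∧ z = .inr (comp n c c' h)
  relE x y := ∃ a : A, x = .inl (f.toFun a) ∧ y = .inr (g.toFun a)
  fin x := by
    rcases x with b | c
    · exact ⟨dim b, Or.inl ⟨b, rfl, by rw [(dim_spec b).1]⟩, Or.inl ⟨b, rfl, by rw [(dim_spec b).2]⟩⟩
    · exact ⟨dim c, Or.inr ⟨c, rfl, by rw [(dim_spec c).1]⟩, Or.inr ⟨c, rfl, by rw [(dim_spec c).2]⟩⟩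

open Presentation in
/-- The first coprojection. -/
def pushoutInl : B ⟶ (pushoutPresentation f g).toOmegaCat :=
  OmegaFunctor.mk (A := B) (B := (pushoutPresentation f g).Carrier)
    (fun b => ofGen (P := pushoutPresentation f g) (.inl b))
    (fun _ _ b => (cls_eq.2 (.relD (Or.inl ⟨b, rfl, rfl⟩))).symm)
    (fun _ b b' h h' => Eq.symm ((ccomp_mk h').trans
      (cls_eq.2 (.relC (Or.inl ⟨b, b', h, rfl, rfl, rfl⟩) (cls_eq.1 h')))))

open Presentation in
/-- The second coprojection. -/
def pushoutInr : C ⟶ (pushoutPresentation f g).toOmegaCat :=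
  OmegaFunctor.mk (A := C) (B := (pushoutPresentation f g).Carrier)
    (fun b => ofGen (P := pushoutPresentation f g) (.inr b))
    (fun _ _ b => (cls_eq.2 (.relD (Or.inr ⟨b, rfl, rfl⟩))).symm)
    (fun _ b b' h h' => Eq.symm ((ccomp_mk h').trans
      (cls_eq.2 (.relC (Or.inr ⟨b, b', h, rfl, rfl, rfl⟩) (cls_eq.1 h')))))

theorem pushout_condition : f ≫ pushoutInl f g = g ≫ pushoutInr f g :=
  OmegaFunctor.ext (funext fun a => Presentation.cls_eq.2 (.relE ⟨a, rfl, rfl⟩))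

theorem pushout_respects {D : OmegaCat.{u}} (h : B ⟶ D) (k : C ⟶ D) (w : f ≫ h = g ≫ k) :
    Presentation.Respects (pushoutPresentation f g) (D := D)
      (Sum.elim (fun b => h.toFun b) (fun c => k.toFun c)) where
  relD := by
    rintro x α n y (⟨b, rfl, rfl⟩ | ⟨c, rfl, rfl⟩)
    · exact (h.map_d α n b).symm
    · exact (k.map_d α n c).symm
  relC := by
    rintro n x y z (⟨b, b', hb, rfl, rfl, rfl⟩ | ⟨c, c', hc, rfl, rfl, rfl⟩) h'
    · exact (h.map_comp n b b' hb h').symm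
    · exact (k.map_comp n c c' hc h').symm
  relE := by
    rintro x y ⟨a, rfl, rfl⟩
    exact congrFun (congrArg OmegaFunctor.toFun w) a

theorem pushout_isPushout : IsPushout f g (pushoutInl f g) (pushoutInr f g) where
  w := pushout_condition f g
  isColimit' := ⟨PushoutCocone.IsColimit.mk _
    (fun s => Presentation.lift (pushout_respects f g s.inl s.inr s.condition))
    (fun s => OmegaFunctor.ext (funext fun b => Presentation.lift_ofGen
      (pushout_respects f g s.inl s.inr s.condition) (.inl b)))
    (fun s => OmegaFunctor.ext (funext fun c => Presentation.lift_ofGen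
      (pushout_respects f g s.inl s.inr s.condition) (.inr c)))
    (fun s m h1 h2 => Presentation.functor_ext (by
      rintro (b | c)
      · exact (congrFun (congrArg OmegaFunctor.toFun h1) b).trans
          (Presentation.lift_ofGen (pushout_respects f g s.inl s.inr s.condition) (.inl b)).symm
      · exact (congrFun (congrArg OmegaFunctor.toFun h2) c).trans
          (Presentation.lift_ofGen (pushout_respects f g s.inl s.inr s.condition) (.inr c)).symm))⟩

end Pushout

instance : HasPushouts OmegaCat.{u} :=
  haveI : ∀ {X Y Z : OmegaCat.{u}} {f : X ⟶ Y} {g : X ⟶ Z}, HasColimit (span f g) :=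
    fun {_ _ _ f g} => (pushout_isPushout f g).hasPushout
  hasPushouts_of_hasColimit_span _

/-! ### The negative semi-path `ω`-category -/

namespace NCOmegaCat

variable (C : NCOmegaCat.{u})

/-- The generating pairs `(x, x *_0 z)` of `ℛ⁻`, where `x`, `z` and `x *_0 z` all belong to `ℙC`. -/
def InitStep (x y : C.Path) : Prop :=
  ∃ (z : C.Path) (h : d true 0 x.1 = d false 0 z.1), y.1 = comp 0 x.1 z.1 h

/-- The equivalence relation `ℛ⁻` on `ℙC` generated by the pairs `(x, x *_0 z)`. -/
def RMinus (x y : C.Path) : Prop := Relation.EqvGen C.InitStep x y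

variable {C}

theorem InitStep.d {x y : C.Path} (h : C.InitStep x y) (α : Bool) (n : ℕ) :
    C.InitStep (OmegaCategory.d α n x) (OmegaCategory.d α n y) := by
  obtain ⟨z, h0, hy⟩ := h
  have h1 : OmegaCategory.d true 0 (OmegaCategory.d α (n + 1) x.1) =
      OmegaCategory.d false 0 (OmegaCategory.d α (n + 1) z.1) := by
    rw [d_d_of_lt _ _ _ (Nat.succ_pos n), d_d_of_lt _ _ _ (Nat.succ_pos n), h0]
  refine ⟨OmegaCategory.d α n z, h1, ?_⟩
  change OmegaCategory.d α (n + 1) y.1 = _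
  rw [hy]
  exact d_comp α x.1 z.1 (Nat.succ_ne_zero n) h0 h1

theorem RMinus.d {x y : C.Path} (h : C.RMinus x y) (α : Bool) (n : ℕ) :
    C.RMinus (OmegaCategory.d α n x) (OmegaCategory.d α n y) := by
  induction h with
  | rel _ _ h => exact .rel _ _ (h.d α n)
  | refl => exact .refl _
  | symm _ _ _ ih => exact .symm _ _ ih
  | trans _ _ _ _ _ ih1 ih2 => exact .trans _ _ _ ih1 ih2

theorem RMinus.map {C D : NCOmegaCat.{u}} (f : C ⟶ D) {x y : C.Path} (h : C.RMinus x y) :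
    D.RMinus ((pathFunctor.map f).toFun x) ((pathFunctor.map f).toFun y) := by
  induction h with
  | rel x y h =>
    obtain ⟨z, h0, hy⟩ := h
    refine .rel _ _ ⟨(pathFunctor.map f).toFun z, f.functor.map_composable h0, ?_⟩
    exact (congrArg f.functor.toFun hy).trans (f.functor.map_comp _ _ _ _ _)
  | refl => exact .refl _
  | symm _ _ _ ih => exact .symm _ _ ih
  | trans _ _ _ _ _ ih1 ih2 => exact .trans _ _ _ ih1 ih2

variable (C)

/-- The quotient globular set `𝕌ℙC/ℛ⁻`. -/
noncomputable def quotGlob : GlobSet.{u} where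
  cells n := Quot fun x y : {x : C.Path // dim x ≤ n} => C.RMinus x.1 y.1
  s n := Quot.map (fun x => ⟨d false n x.1, dim_d_le _ _ _⟩) fun _ _ h => h.d false n
  t n := Quot.map (fun x => ⟨d true n x.1, dim_d_le _ _ _⟩) fun _ _ h => h.d true n
  s_s n := Quot.ind fun x => congrArg (Quot.mk _)
    ((forgetGlob.obj (pathFunctor.obj C)).s_s n x)
  t_s n := Quot.ind fun x => congrArg (Quot.mk _)
    ((forgetGlob.obj (pathFunctor.obj C)).t_s n x)

/-- The canonical morphism `φ : 𝕌ℙC ⟶ 𝕌ℙC/ℛ⁻`. -/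
noncomputable def toQuotGlob : forgetGlob.obj (pathFunctor.obj C) ⟶ C.quotGlob :=
  GlobSet.Hom.mk (G := forgetGlob.obj (pathFunctor.obj C)) (H := C.quotGlob)
    (fun _ x => Quot.mk _ x) (fun _ _ => rfl) (fun _ _ => rfl)

/-- The negative semi-path `ω`-category `ℙ⁻C`: the pushout in `ωCat` of
`𝔽(φ) : 𝔽𝕌ℙC ⟶ 𝔽(𝕌ℙC/ℛ⁻)` and the counit `𝔽𝕌ℙC ⟶ ℙC`. -/
noncomputable def semiPath : OmegaCat.{u} :=
  pushout (freeOmega.map C.toQuotGlob) (freeAdj.counit.app (pathFunctor.obj C))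

/-- The canonical `ω`-functor `A : 𝔽(𝕌ℙC/ℛ⁻) ⟶ ℙ⁻C`. -/
noncomputable def quotToSemiPath : freeOmega.obj C.quotGlob ⟶ C.semiPath :=
  pushout.inl _ _

/-- The canonical `ω`-functor `h⁻ : ℙC ⟶ ℙ⁻C`. -/
noncomputable def hMinus : pathFunctor.obj C ⟶ C.semiPath :=
  pushout.inr _ _

theorem semiPath_condition : freeOmega.map C.toQuotGlob ≫ C.quotToSemiPath =
    freeAdj.counit.app (pathFunctor.obj C) ≫ C.hMinus :=
  pushout.condition

variable {C}

/-- The morphism `𝕌ℙC/ℛ⁻ ⟶ 𝕌D` induced by an `ω`-functor `ℙC ⟶ D` that identifies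
`ℛ⁻`-equivalent elements. -/
noncomputable def quotGlobDesc {D : OmegaCat.{u}} (μ : pathFunctor.obj C ⟶ D)
    (hμ : ∀ x y : C.Path, C.RMinus x y → μ.toFun x = μ.toFun y) :
    C.quotGlob ⟶ forgetGlob.obj D :=
  GlobSet.Hom.mk (G := C.quotGlob) (H := forgetGlob.obj D)
    (fun n => Quot.lift (fun x => (forgetGlob.map μ).app n x)
      fun x y h => Subtype.ext (hμ x.1 y.1 h))
    (fun n => Quot.ind fun x => (forgetGlob.map μ).app_s n x)
    (fun n => Quot.ind fun x => (forgetGlob.map μ).app_t n x)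

theorem semiPath_desc_condition {D : OmegaCat.{u}} (μ : pathFunctor.obj C ⟶ D)
    (hμ : ∀ x y : C.Path, C.RMinus x y → μ.toFun x = μ.toFun y) :
    freeOmega.map C.toQuotGlob ≫ (freeAdj.homEquiv _ _).symm (quotGlobDesc μ hμ) =
      freeAdj.counit.app (pathFunctor.obj C) ≫ μ := by
  rw [← Adjunction.homEquiv_naturality_left_symm]
  have : C.toQuotGlob ≫ quotGlobDesc μ hμ = forgetGlob.map μ := rfl
  rw [this, Adjunction.homEquiv_counit]
  exact freeAdj.counit_naturality μ

/-- The `ω`-functor `ℙ⁻C ⟶ D` induced by an `ω`-functor `ℙC ⟶ D` that identifies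
`ℛ⁻`-equivalent elements. -/
noncomputable def semiPathDesc {D : OmegaCat.{u}} (μ : pathFunctor.obj C ⟶ D)
    (hμ : ∀ x y : C.Path, C.RMinus x y → μ.toFun x = μ.toFun y) : C.semiPath ⟶ D :=
  pushout.desc ((freeAdj.homEquiv _ _).symm (quotGlobDesc μ hμ)) μ (semiPath_desc_condition μ hμ)

theorem hMinus_semiPathDesc {D : OmegaCat.{u}} (μ : pathFunctor.obj C ⟶ D)
    (hμ : ∀ x y : C.Path, C.RMinus x y → μ.toFun x = μ.toFun y) :
    C.hMinus ≫ semiPathDesc μ hμ = μ :=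
  pushout.inr_desc _ _ _

theorem semiPath_hom_ext {D : OmegaCat.{u}} {f g : C.semiPath ⟶ D}
    (h : C.hMinus ≫ f = C.hMinus ≫ g) : f = g := by
  refine pushout.hom_ext ?_ h
  change C.quotToSemiPath ≫ f = C.quotToSemiPath ≫ g
  apply (freeAdj.homEquiv _ _).injective
  have e : C.toQuotGlob ≫ freeAdj.homEquiv _ _ (C.quotToSemiPath ≫ f) =
      C.toQuotGlob ≫ freeAdj.homEquiv _ _ (C.quotToSemiPath ≫ g) := by
    rw [← Adjunction.homEquiv_naturality_left, ← Adjunction.homEquiv_naturality_left,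
      ← Category.assoc, ← Category.assoc, semiPath_condition, Category.assoc, Category.assoc, h]
  apply GlobSet.Hom.ext
  funext n q
  induction q using Quot.ind with
  | mk x => exact congrFun (congrFun (congrArg GlobSet.Hom.app e) n) x

theorem hMinus_eq_of_rMinus {x y : C.Path} (h : C.RMinus x y) :
    C.hMinus.toFun x = C.hMinus.toFun y := by
  have e : forgetGlob.map C.hMinus =
      C.toQuotGlob ≫ freeAdj.homEquiv _ _ C.quotToSemiPath := by
    rw [← Adjunction.homEquiv_naturality_left, semiPath_condition, Adjunction.homEquiv_unit,
      Functor.map_comp, Adjunction.right_triangle_components_assoc]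
  let n := max (dim x) (dim y)
  have h1 := congrFun (congrFun (congrArg GlobSet.Hom.app e) n) ⟨x, le_max_left _ _⟩
  have h2 := congrFun (congrFun (congrArg GlobSet.Hom.app e) n) ⟨y, le_max_right _ _⟩
  have h3 : C.toQuotGlob.app n ⟨x, le_max_left _ _⟩ = C.toQuotGlob.app n ⟨y, le_max_right _ _⟩ :=
    Quot.sound h
  have h4 := h1.trans ((congrArg ((freeAdj.homEquiv _ _ C.quotToSemiPath).app n) h3).trans h2.symm)
  exact congrArg Subtype.val h4

end NCOmegaCat

/-- The action of `ℙ⁻` on morphisms, determined by `h⁻ ≫ ℙ⁻f = ℙf ≫ h⁻`. -/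
noncomputable def NCOmegaCat.semiPathMap {C D : NCOmegaCat.{u}} (f : C ⟶ D) :
    C.semiPath ⟶ D.semiPath :=
  NCOmegaCat.semiPathDesc (pathFunctor.map f ≫ D.hMinus)
    fun _ _ h => NCOmegaCat.hMinus_eq_of_rMinus (h.map f)

theorem NCOmegaCat.hMinus_semiPathMap {C D : NCOmegaCat.{u}} (f : C ⟶ D) :
    C.hMinus ≫ semiPathMap f = pathFunctor.map f ≫ D.hMinus :=
  hMinus_semiPathDesc _ _

/-- The functor `ℙ⁻ : ωCat₁ ⥤ ωCat`. -/
noncomputable def semiPathFunctor : NCOmegaCat.{u} ⥤ OmegaCat.{u} where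
  obj C := C.semiPath
  map f := NCOmegaCat.semiPathMap f
  map_id C := NCOmegaCat.semiPath_hom_ext (by
    rw [NCOmegaCat.hMinus_semiPathMap, CategoryTheory.Functor.map_id, Category.id_comp, Category.comp_id])
  map_comp {C D E} f g := NCOmegaCat.semiPath_hom_ext (by
    rw [NCOmegaCat.hMinus_semiPathMap, ← Category.assoc, NCOmegaCat.hMinus_semiPathMap,
      Category.assoc, NCOmegaCat.hMinus_semiPathMap, Functor.map_comp, Category.assoc])

/-- The canonical natural transformation `h⁻ : ℙ ⟶ ℙ⁻`. -/
noncomputable def hMinusNat : pathFunctor.{u} ⟶ semiPathFunctor.{u} where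
  app C := C.hMinus
  naturality {_ _} f := (NCOmegaCat.hMinus_semiPathMap f).symm

/-- The discrete `ω`-category on a set: every morphism is `0`-dimensional. -/
structure Disc (X : Type u) where
  as : X

instance (X : Type u) : OmegaCategory (Disc X) where
  d _ _ x := x
  comp _ x _ _ := x
  d_d_of_lt _ _ _ _ := rfl
  d_d_of_ge _ _ _ _ := rfl
  source_comp _ _ _ := rfl
  comp_target _ _ _ := rfl
  d_false_comp _ _ _ _ := rfl
  d_true_comp _ _ _ h := h
  d_comp _ _ _ _ _ _ := rfl
  assoc _ _ _ _ _ _ _ _ := rfl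
  exchange _ _ _ _ _ _ _ _ _ _ _ := rfl
  exists_dim _ := ⟨0, rfl, rfl⟩

namespace NCOmegaCat

variable (C : NCOmegaCat.{u})

/-- The `0`-source map `s_0 : ℙC → C_0`, seen as an `ω`-functor to a discrete `ω`-category. -/
noncomputable def pathSource :
    pathFunctor.obj C ⟶ (⟨Disc (zeroCells.obj C)⟩ : OmegaCat.{u}) :=
  OmegaFunctor.mk (A := C.Path) (B := Disc (zeroCells.obj C))
    (fun x => ⟨⟨d false 0 x.1, Nat.le_zero.1 (dim_d_le _ _ _)⟩⟩)
    (fun _ n x => congrArg Disc.mk (Subtype.ext (d_d_of_lt _ _ x.1 (Nat.succ_pos n))))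
    (fun n x y h _ => congrArg Disc.mk (Subtype.ext (by
      change d false 0 (comp (n + 1) x.1 y.1 _) = d false 0 x.1
      rw [← d_d_of_lt false false (comp (n + 1) x.1 y.1 _) (Nat.succ_pos n), d_false_comp,
        d_d_of_lt _ _ _ (Nat.succ_pos n)])))

theorem pathSource_eq {x y : C.Path} (h : C.RMinus x y) :
    C.pathSource.toFun x = C.pathSource.toFun y := by
  induction h with
  | rel x y h =>
    obtain ⟨z, h0, hy⟩ := h
    refine congrArg Disc.mk (Subtype.ext ?_)
    change d false 0 x.1 = d false 0 y.1
    rw [hy, d_false_comp]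
  | refl => rfl
  | symm _ _ _ ih => exact ih.symm
  | trans _ _ _ _ _ ih1 ih2 => exact ih1.trans ih2

/-- The map `s_0 : ℙ⁻C → C_0` induced by the `0`-source map of `C`. -/
noncomputable def semiPathSource :
    C.semiPath ⟶ (⟨Disc (zeroCells.obj C)⟩ : OmegaCat.{u}) :=
  semiPathDesc C.pathSource fun _ _ h => C.pathSource_eq h

end NCOmegaCat

/-! ### The `ω`-category of a chain complex with a finite basis

A cell is a double sequence of chains `(x_i^-, x_i^+)` with non-negative coefficients such that
`∂ x_{i+1}^α = x_i^+ - x_i^-` and `x_0^α` has augmentation `1`. For the chain complexes of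
cubes and simplexes this is Steiner's construction of the `ω`-categories `I^n` and `Δ^n`. The
cell `X` with chains `x_i^α` corresponds to the set of faces `R(X)` generated by the faces that
occur in some `x_i^α`. -/

/-- A finite graded set of faces with incidence numbers: `inc b c` is the coefficient of `c` in
the boundary of `b`. -/
structure FaceComplex where
  Face : Type
  [fintype : Fintype Face]
  [decEq : DecidableEq Face]
  dim : Face → ℕ
  inc : Face → Face → ℤ

attribute [instance] FaceComplex.fintype FaceComplex.decEq

namespace FaceComplex

/-- The cells of the `ω`-category of a face complex. -/
@[ext]
structure Cell (K : FaceComplex) where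
  coeff : ℕ → Bool → K.Face → ℕ
  supp : ∀ i α b, coeff i α b ≠ 0 → K.dim b = i
  bdry : ∀ i α c,
    ∑ b, (coeff (i + 1) α b : ℤ) * K.inc b c = (coeff i true c : ℤ) - coeff i false c
  aug : ∀ α, ∑ b, coeff 0 α b = 1

variable {K : FaceComplex}

/-- `d_n^α (x) = (x_0^±, …, x_{n-1}^±, x_n^α, x_n^α, 0, …)`. -/
def Cell.d (α : Bool) (n : ℕ) (x : K.Cell) : K.Cell where
  coeff i β := if i < n then x.coeff i β else if i = n then x.coeff n α else 0
  supp i β b h := by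
    split_ifs at h with h1 h2
    · exact x.supp _ _ _ h
    · subst h2; exact x.supp _ _ _ h
    · exact absurd rfl h
  bdry i β c := by
    rcases lt_trichotomy (i + 1) n with h | h | h
    · simp only [h, show i < n by omega, if_true]; exact x.bdry _ _ _
    · subst h; simp only [lt_irrefl, if_false, if_true, Nat.lt_succ_self]; exact x.bdry _ _ _
    · simp [show ¬ (i + 1 < n) by omega, show ¬ (i < n) by omega, show ¬ (i + 1 = n) by omega]
  aug β := by
    rcases Nat.eq_zero_or_pos n with rfl | h
    · simpa using x.aug α
    · simpa [h] using x.aug β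

/-- `x *_n y`: the chains of degree `< n` are the common ones, in degree `n` it is
`(x_n^-, y_n^+)`, and in degrees `> n` the chains are added. -/
def Cell.comp (n : ℕ) (x y : K.Cell) (h : x.d true n = y.d false n) : K.Cell where
  coeff i β := if i < n then x.coeff i β
    else if i = n then (if β then y.coeff n true else x.coeff n false)
    else x.coeff i β + y.coeff i β
  supp i β b h := by
    split_ifs at h with h1 h2 h3
    · exact x.supp _ _ _ h
    · subst h2; exact y.supp _ _ _ h
    · subst h2; exact x.supp _ _ _ h
    · rw [Pi.add_apply] at h
      by_cases h4 : x.coeff i β b = 0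
      · exact y.supp i β b (by omega)
      · exact x.supp i β b h4
  bdry i β c := by
    have hlt : ∀ i < n, ∀ β, x.coeff i β = y.coeff i β := by
      intro i hi β
      have := congrFun (congrFun (congrArg Cell.coeff h) i) β
      simpa [Cell.d, hi] using this
    have heq : x.coeff n true = y.coeff n false := by
      have := congrFun (congrFun (congrArg Cell.coeff h) n) true
      simpa [Cell.d] using this
    rcases lt_trichotomy (i + 1) n with h | h | h
    · simp only [h, show i < n by omega, if_true]; exact x.bdry _ _ _
    · subst h
      simp only [lt_irrefl, if_false, if_true, Nat.lt_succ_self]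
      cases β
      · exact x.bdry _ _ _
      · rw [hlt i (Nat.lt_succ_self i), hlt i (Nat.lt_succ_self i)]; exact y.bdry _ _ _
    · have e : ∑ b, ((x.coeff (i + 1) β + y.coeff (i + 1) β) b : ℕ) *
          K.inc b c = (∑ b, (x.coeff (i + 1) β b : ℤ) * K.inc b c) +
          ∑ b, (y.coeff (i + 1) β b : ℤ) * K.inc b c := by
        rw [← Finset.sum_add_distrib]
        refine Finset.sum_congr rfl fun b _ => ?_
        rw [Pi.add_apply]; push_cast; ring
      simp only [show ¬ (i + 1 < n) by omega, show ¬ (i < n) by omega, show ¬ (i + 1 = n) by omega,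
        if_false]
      rw [e, x.bdry, y.bdry]
      by_cases h2 : i = n
      · subst h2
        simp [heq]
      · simp only [h2, if_false, Pi.add_apply]; push_cast; ring
  aug β := by
    rcases Nat.eq_zero_or_pos n with rfl | h
    · cases β
      · simpa using x.aug false
      · simpa using y.aug true
    · simpa [h] using x.aug β

theorem Cell.d_eq_lt {n : ℕ} {x y : K.Cell} (h : x.d true n = y.d false n) {i : ℕ} (hi : i < n)
    (β : Bool) : x.coeff i β = y.coeff i β := by
  have := congrFun (congrFun (congrArg Cell.coeff h) i) β
  simpa [Cell.d, hi] using this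

theorem Cell.d_eq_self {n : ℕ} {x y : K.Cell} (h : x.d true n = y.d false n) :
    x.coeff n true = y.coeff n false := by
  have := congrFun (congrFun (congrArg Cell.coeff h) n) true
  simpa [Cell.d] using this

/-- The `ω`-category of a face complex. -/
instance : OmegaCategory K.Cell where
  d := Cell.d
  comp := Cell.comp
  d_d_of_lt {m n} α β x h := by
    ext i γ b
    simp only [Cell.d]
    split_ifs <;> first | rfl | omega
  d_d_of_ge {m n} α β x h := by
    ext i γ b
    simp only [Cell.d]
    split_ifs <;> first | rfl | omega
  source_comp n x h := by
    ext i γ b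
    simp only [Cell.d, Cell.comp]
    split_ifs <;> subst_vars <;> simp_all
  comp_target n x h := by
    ext i γ b
    simp only [Cell.d, Cell.comp]
    split_ifs <;> subst_vars <;> simp_all
  d_false_comp n x y h := by
    ext i γ b
    simp only [Cell.d, Cell.comp]
    split_ifs <;> subst_vars <;> simp_all
  d_true_comp n x y h := by
    ext i γ b
    simp only [Cell.d, Cell.comp]
    split_ifs with h1 h2 h3
    · rw [Cell.d_eq_lt h h1]
    · exact absurd h3 (lt_irrefl n)
    · rfl
    · rfl
  d_comp {m n} α x y hmn h h' := by
    ext i γ b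
    simp only [Cell.d, Cell.comp]
    rcases lt_or_gt_of_ne hmn with hl | hl
    · have := Cell.d_eq_lt h hl α
      split_ifs <;> subst_vars <;> first | rfl | omega
    · split_ifs <;> subst_vars <;> first | rfl | omega
  assoc n x y z hxy hyz h h' := by
    ext i γ b
    simp only [Cell.comp]
    split_ifs <;> simp_all [add_assoc]
  exchange {m n} x y z w hmn hxy hzw hxz hyw h h' := by
    ext i γ b
    simp only [Cell.comp]
    rcases lt_or_gt_of_ne hmn with hl | hl
    · have e1 := Cell.d_eq_lt hxy hl
      have e2 := Cell.d_eq_lt hzw hl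
      have e3 := Cell.d_eq_self hxz
      rcases lt_trichotomy i m with h1 | h1 | h1
      · simp [h1, h1.trans hl]
      · subst h1; simp [hl]
      · simp only [show ¬ i < m by omega, show ¬ i = m by omega, if_false]
        split_ifs <;> simp only [Pi.add_apply] <;> first | rfl | omega
    · have e1 := Cell.d_eq_lt hxz hl
      have e2 := Cell.d_eq_lt hyw hl
      rcases lt_trichotomy i n with h1 | h1 | h1
      · simp [h1, h1.trans hl]
      · subst h1; simp [hl]
      · simp only [show ¬ i < n by omega, show ¬ i = n by omega, if_false]
        split_ifs <;> simp only [Pi.add_apply] <;> first | rfl | omega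
  exists_dim x := by
    have key : ∀ α, x.d α (∑ b, K.dim b + 1) = x := by
      intro α
      ext i γ b
      simp only [Cell.d]
      have h0 : ∀ j β, ∑ b, K.dim b + 1 ≤ j → x.coeff j β b = 0 := by
        intro j β hj
        by_contra h
        have h1 := x.supp _ _ _ h
        have h2 := Finset.single_le_sum (f := K.dim) (fun _ _ => Nat.zero_le _) (Finset.mem_univ b)
        omega
      split_ifs with h1 h2
      · rfl
      · rw [h0 _ _ le_rfl, h0 _ _ h2.ge]
      · rw [h0 _ _ (by omega)]; rfl
    exact ⟨_, key false, key true⟩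

theorem d_coeff (α : Bool) (n : ℕ) (x : K.Cell) (i : ℕ) (β : Bool) :
    (OmegaCategory.d α n x).coeff i β =
      if i < n then x.coeff i β else if i = n then x.coeff n α else 0 := rfl

theorem comp_coeff (n : ℕ) (x y : K.Cell) (h : OmegaCategory.d true n x = OmegaCategory.d false n y)
    (i : ℕ) (β : Bool) : (OmegaCategory.comp n x y h).coeff i β =
      if i < n then x.coeff i β
      else if i = n then (if β then y.coeff n true else x.coeff n false)
      else x.coeff i β + y.coeff i β := rfl

/-- Maps of faces that do not raise dimensions and induce chain maps, where faces whose dimension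
drops are sent to `0`. -/
@[ext]
structure Hom (K L : FaceComplex) where
  map : K.Face → L.Face
  dim_le : ∀ b, L.dim (map b) ≤ K.dim b
  comm : ∀ b c', (if L.dim (map b) = K.dim b then L.inc (map b) c' else 0) =
    ∑ c, if map c = c' ∧ L.dim c' = K.dim c then K.inc b c else 0

variable {L M : FaceComplex}

/-- The image of a chain of degree `i`. -/
def Hom.push (g : Hom K L) (i : ℕ) (x : K.Face → ℕ) : L.Face → ℕ :=
  fun b' => ∑ b, if g.map b = b' ∧ L.dim b' = i then x b else 0

theorem Hom.push_add (g : Hom K L) (i : ℕ) (x y : K.Face → ℕ) :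
    g.push i (x + y) = g.push i x + g.push i y := by
  funext b'
  simp only [Hom.push, Pi.add_apply, ← Finset.sum_add_distrib]
  exact Finset.sum_congr rfl fun b _ => by split_ifs <;> rfl

theorem Hom.push_zero (g : Hom K L) (i : ℕ) : g.push i 0 = 0 := by
  funext b'
  simp [Hom.push]

/-- The cell map induced by a map of face complexes. -/
def Hom.cellMap (g : Hom K L) (x : K.Cell) : L.Cell where
  coeff i α := g.push i (x.coeff i α)
  supp i α b' h := by
    by_contra h0
    exact h (by simp [Hom.push, h0])
  bdry i α c' := by
    have e : ∀ β, ((g.push i (x.coeff i β) c' : ℕ) : ℤ) =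
        ∑ c, if g.map c = c' ∧ L.dim c' = K.dim c then (x.coeff i β c : ℤ) else 0 := by
      intro β
      simp only [Hom.push]
      push_cast
      refine Finset.sum_congr rfl fun c _ => ?_
      by_cases h : x.coeff i β c = 0
      · simp [h]
      · rw [x.supp _ _ _ h]
    rw [e, e, ← Finset.sum_sub_distrib]
    have e2 : ∀ b', ((g.push (i + 1) (x.coeff (i + 1) α) b' : ℕ) : ℤ) * L.inc b' c' =
        ∑ b, if g.map b = b' then (x.coeff (i + 1) α b : ℤ) *
          (if L.dim (g.map b) = K.dim b then L.inc (g.map b) c' else 0) else 0 := by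
      intro b'
      simp only [Hom.push]
      push_cast
      rw [Finset.sum_mul]
      refine Finset.sum_congr rfl fun b _ => ?_
      by_cases h : x.coeff (i + 1) α b = 0
      · simp [h]
      · rw [x.supp _ _ _ h]
        by_cases h1 : g.map b = b'
        · subst h1; simp
        · simp [h1]
    simp only [e2]
    rw [Finset.sum_comm]
    simp only [Finset.sum_ite_eq, Finset.mem_univ, if_true, g.comm, Finset.mul_sum]
    rw [Finset.sum_comm]
    refine Finset.sum_congr rfl fun c _ => ?_
    split_ifs with h
    · exact x.bdry i α c
    · simp
  aug α := by
    rw [← x.aug α]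
    simp only [Hom.push]
    rw [Finset.sum_comm]
    refine Finset.sum_congr rfl fun b _ => ?_
    by_cases h : x.coeff 0 α b = 0
    · simp [h]
    · have h1 := x.supp _ _ _ h
      have h2 : L.dim (g.map b) = 0 := Nat.le_zero.1 (h1 ▸ g.dim_le b)
      rw [Finset.sum_eq_single (g.map b)]
      · simp [h2]
      · intro b' _ hb'
        simp [hb'.symm]
      · simp

/-- The `ω`-functor induced by a map of face complexes. -/
def Hom.functor (g : Hom K L) : OmegaFunctor K.Cell L.Cell where
  toFun := g.cellMap
  map_d α n x := by
    apply Cell.ext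
    funext i β
    simp only [Hom.cellMap, d_coeff]
    split_ifs with h1 h2
    · rfl
    · subst h2; rfl
    · exact g.push_zero i
  map_comp n x y h h' := by
    apply Cell.ext
    funext i β
    simp only [Hom.cellMap, comp_coeff]
    split_ifs with h1 h2 h3
    · rfl
    · subst h2; rfl
    · subst h2; rfl
    · exact g.push_add i _ _

/-- Identities. -/
def Hom.id (K : FaceComplex) : Hom K K where
  map b := b
  dim_le _ := le_rfl
  comm b c' := by
    rw [Finset.sum_eq_single c'] <;> simp +contextual

theorem Hom.id_functor : (Hom.id K).functor = OmegaFunctor.id K.Cell := by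
  apply OmegaFunctor.ext
  funext x
  apply Cell.ext
  funext i α b'
  change ∑ b, (if b = b' ∧ K.dim b' = i then x.coeff i α b else 0) = x.coeff i α b'
  rw [Finset.sum_eq_single b']
  · by_cases h : x.coeff i α b' = 0
    · simp [h]
    · simp [x.supp _ _ _ h]
  · intro b _ hb; simp [hb]
  · simp

theorem Hom.functor_comp (g : Hom K L) (h : Hom L M) (k : Hom K M)
    (hk : ∀ b, k.map b = h.map (g.map b)) : k.functor = g.functor.comp h.functor := by
  apply OmegaFunctor.ext
  funext x
  apply Cell.ext
  funext i α b''
  change k.push i (x.coeff i α) b'' = h.push i (g.push i (x.coeff i α)) b''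
  simp only [Hom.push]
  have e : ∀ b', (if h.map b' = b'' ∧ M.dim b'' = i then
      ∑ b, (if g.map b = b' ∧ L.dim b' = i then x.coeff i α b else 0) else 0) =
      ∑ b, if g.map b = b' then (if k.map b = b'' ∧ M.dim b'' = i then x.coeff i α b else 0)
        else 0 := by
    intro b'
    by_cases h1 : h.map b' = b'' ∧ M.dim b'' = i
    · rw [if_pos h1]
      refine Finset.sum_congr rfl fun b _ => ?_
      by_cases h2 : g.map b = b'
      · subst h2
        rw [hk]
        simp only [true_and, if_true, h1, and_self]
        by_cases h3 : x.coeff i α b = 0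
        · simp [h3]
        · have h4 := x.supp _ _ _ h3
          have h5 := g.dim_le b
          have h6 := h.dim_le (g.map b)
          rw [h1.1] at h6
          rw [if_pos (by omega)]
      · simp [h2]
    · rw [if_neg h1]
      symm
      refine Finset.sum_eq_zero fun b _ => ?_
      by_cases h2 : g.map b = b'
      · subst h2; rw [hk]; simp [h1]
      · simp [h2]
  simp only [e]
  rw [Finset.sum_comm]
  simp

end FaceComplex

/-! ### Cubes -/

namespace Cube

/-- Faces of the `n`-cube: words of length `n` in `{-, 0, +}`, encoded as the signs `-1, 0, 1`. -/
abbrev Word (n : ℕ) : Type := Fin n → SignType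

/-- The number of zeros of a word: the dimension of the face. -/
def zeros {n : ℕ} (w : Word n) : ℕ := (Finset.univ.filter fun i => w i = 0).card

/-- The number of zeros of a word before position `j`. -/
def zerosBefore {n : ℕ} (w : Word n) (j : Fin n) : ℕ :=
  (Finset.univ.filter fun i => i < j ∧ w i = 0).card

/-- Incidence numbers of the cube: the face obtained by replacing the `i`-th zero (`i ≥ 1`) by
`(-)^i` occurs in the source (coefficient `-1`), and the one obtained by replacing it by
`(-)^{i+1}` occurs in the target (coefficient `1`). -/
def inc {n : ℕ} (w v : Word n) : ℤ :=
  ∑ j, if w j = 0 then (-1) ^ zerosBefore w j *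
    ((if v = Function.update w j 1 then 1 else 0) -
      (if v = Function.update w j (-1) then 1 else 0)) else 0

/-- The face complex of the `n`-cube. -/
@[reducible]
def complex (n : ℕ) : FaceComplex where
  Face := Word n
  dim := zeros
  inc := inc

/-- The map of words induced by a monotone map `θ`: the `j`-th letter of the image is the maximum
(for `- < 0 < +`) of the letters in positions `i` with `θ i = j`, and `-` if there are none. -/
def pushWord {m n : ℕ} (θ : Fin m →o Fin n) (w : Word m) : Word n :=
  fun j => (Finset.univ.filter fun i => θ i = j).sup w

section

variable {m n : ℕ} (θ : Fin m →o Fin n) (w : Word m)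

theorem le_pushWord (i : Fin m) : w i ≤ pushWord θ w (θ i) :=
  Finset.le_sup (f := w) (by simp)

theorem pushWord_eq_iff_ne_bot {j : Fin n} (h : pushWord θ w j ≠ -1) :
    ∃ i, θ i = j ∧ w i = pushWord θ w j := by
  have hne : (Finset.univ.filter fun i => θ i = j).Nonempty := by
    by_contra h0
    rw [Finset.not_nonempty_iff_eq_empty] at h0
    apply h
    simp only [pushWord, h0, Finset.sup_empty]
    rfl
  obtain ⟨i, hi, e⟩ := Finset.exists_mem_eq_sup _ hne w
  exact ⟨i, by simpa using hi, e.symm⟩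

theorem pushWord_le {j : Fin n} {s : SignType} (h : ∀ i, θ i = j → w i ≤ s) :
    pushWord θ w j ≤ s :=
  Finset.sup_le fun i hi => h i (by simpa using hi)

/-- A zero of a word is good if its image is a zero and it is the only zero mapped there. -/
def Good : Prop := ∀ i, w i = 0 → pushWord θ w (θ i) = 0 ∧ ∀ k, w k = 0 → θ k = θ i → k = i

theorem zeros_pushWord_subset :
    (Finset.univ.filter fun j => pushWord θ w j = 0) ⊆
      (Finset.univ.filter fun i => w i = 0).image θ := by
  intro j hj
  simp only [Finset.mem_filter, Finset.mem_univ, true_and] at hj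
  obtain ⟨i, hi, e⟩ := pushWord_eq_iff_ne_bot θ w (j := j) (by rw [hj]; decide)
  simp only [Finset.mem_image, Finset.mem_filter, Finset.mem_univ, true_and]
  exact ⟨i, e.trans hj, hi⟩

theorem zeros_pushWord_le : zeros (pushWord θ w) ≤ zeros w :=
  (Finset.card_le_card (zeros_pushWord_subset θ w)).trans Finset.card_image_le

theorem good_iff : zeros (pushWord θ w) = zeros w ↔ Good θ w := by
  constructor
  · intro h
    have h1 : ((Finset.univ.filter fun i => w i = 0).image θ).card =
        (Finset.univ.filter fun i => w i = 0).card :=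
      le_antisymm Finset.card_image_le
        (h.symm.le.trans (Finset.card_le_card (zeros_pushWord_subset θ w)))
    have h2 := Finset.eq_of_subset_of_card_le (zeros_pushWord_subset θ w) (h1.trans h.symm).le
    have h3 := Finset.card_image_iff.1 h1
    intro i hi
    constructor
    · have : θ i ∈ (Finset.univ.filter fun i => w i = 0).image θ :=
        Finset.mem_image_of_mem _ (by simpa using hi)
      rw [← h2] at this
      simpa using this
    · intro k hk e
      exact h3 (by simpa using hk) (by simpa using hi) e
  · intro h
    have h1 : (Finset.univ.filter fun j => pushWord θ w j = 0) =
        (Finset.univ.filter fun i => w i = 0).image θ := by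
      refine (zeros_pushWord_subset θ w).antisymm ?_
      intro j hj
      obtain ⟨i, hi, rfl⟩ := Finset.mem_image.1 hj
      simpa using (h i (by simpa using hi)).1
    rw [zeros, h1]
    apply Finset.card_image_of_injOn
    intro k hk i hi e
    exact (h i (by simpa using hi)).2 k (by simpa using hk) e

theorem zeros_update {j : Fin m} {s : SignType} (hj : w j = 0) (hs : s ≠ 0) :
    zeros (Function.update w j s) + 1 = zeros w := by
  have : (Finset.univ.filter fun i => Function.update w j s i = 0) =
      (Finset.univ.filter fun i => w i = 0).erase j := by
    ext i
    by_cases h : i = j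
    · subst h; simp [hs]
    · simp [h]
  rw [zeros, this, Finset.card_erase_add_one (by simpa using hj), zeros]

theorem pushWord_update_of_good (h : Good θ w) {j : Fin m} (hj : w j = 0) {s : SignType} :
    pushWord θ (Function.update w j s) = Function.update (pushWord θ w) (θ j) s := by
  funext k
  by_cases hk : k = θ j
  · subst hk
    rw [Function.update_self]
    apply le_antisymm
    · apply pushWord_le
      intro i hi
      by_cases hij : i = j
      · subst hij; simp
      · rw [Function.update_of_ne hij]
        have h1 : w i ≤ 0 := by rw [← (h j hj).1, ← hi]; exact le_pushWord θ w i
        have h2 : w i ≠ 0 := fun h0 => hij ((h j hj).2 i h0 hi)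
        revert h1 h2
        generalize w i = a
        revert a s
        decide
    · have := le_pushWord θ (Function.update w j s) j
      rwa [Function.update_self] at this
  · rw [Function.update_of_ne hk]
    apply Finset.sup_congr rfl
    intro i hi
    rw [Function.update_of_ne]
    rintro rfl
    exact hk (Finset.mem_filter.1 hi).2.symm

theorem zerosBefore_pushWord (h : Good θ w) {j : Fin m} (hj : w j = 0) :
    zerosBefore (pushWord θ w) (θ j) = zerosBefore w j := by
  have : (Finset.univ.filter fun i => i < θ j ∧ pushWord θ w i = 0) =
      (Finset.univ.filter fun i => i < j ∧ w i = 0).image θ := by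
    ext k
    simp only [Finset.mem_filter, Finset.mem_univ, true_and, Finset.mem_image]
    constructor
    · rintro ⟨h1, h2⟩
      obtain ⟨i, rfl, e⟩ := pushWord_eq_iff_ne_bot θ w (j := k) (by rw [h2]; decide)
      exact ⟨i, ⟨lt_of_not_ge fun h3 => absurd (θ.monotone h3) (not_le.2 h1), e.trans h2⟩, rfl⟩
    · rintro ⟨i, ⟨h1, h2⟩, rfl⟩
      refine ⟨lt_of_le_of_ne (θ.monotone h1.le) fun e => h1.ne ((h j hj).2 i h2 e), (h i h2).1⟩
  rw [zerosBefore, this, Finset.card_image_of_injOn, zerosBefore]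
  intro k hk i hi e
  have hk' : k < j ∧ w k = 0 := by simpa using hk
  have hi' : i < j ∧ w i = 0 := by simpa using hi
  exact (h i hi'.2).2 k hk'.2 e

theorem chain_comm (v' : Word n) :
    (if zeros (pushWord θ w) = zeros w then inc (pushWord θ w) v' else 0) =
      ∑ v, if pushWord θ v = v' ∧ zeros v' = zeros v then inc w v else 0 := by
  -- rewrite the right-hand side as a sum over the zeros of `w`
  let T : Fin m → SignType → ℤ := fun j s =>
    if pushWord θ (Function.update w j s) = v' ∧ zeros v' = zeros (Function.update w j s)
      then 1 else 0
  have hR : (∑ v, if pushWord θ v = v' ∧ zeros v' = zeros v then inc w v else 0) =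
      ∑ j, if w j = 0 then (-1) ^ zerosBefore w j * (T j 1 - T j (-1)) else 0 := by
    simp only [inc, ← Finset.sum_filter (p := fun v => pushWord θ v = v' ∧ zeros v' = zeros v)]
    rw [Finset.sum_comm]
    refine Finset.sum_congr rfl fun j _ => ?_
    split_ifs with hj
    · rw [← Finset.mul_sum, Finset.sum_sub_distrib]
      simp [T, Finset.sum_ite_eq']
    · simp
  rw [hR]
  have hT0 : ∀ j s, w j = 0 → s ≠ 0 → ¬ Good θ (Function.update w j s) → T j s = 0 := by
    intro j s _ _ hg
    simp only [T]
    rw [if_neg]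
    rintro ⟨rfl, h⟩
    exact hg ((good_iff _ _).1 h)
  by_cases hg : Good θ w
  · rw [if_pos ((good_iff θ w).2 hg)]
    have hT : ∀ j s, w j = 0 → s ≠ 0 →
        T j s = if v' = Function.update (pushWord θ w) (θ j) s then 1 else 0 := by
      intro j s hj hs
      simp only [T, pushWord_update_of_good θ w hg hj]
      refine if_congr ⟨fun h => h.1.symm, ?_⟩ rfl rfl
      rintro rfl
      refine ⟨rfl, ?_⟩
      have h1 := zeros_update w hj hs
      have h2 := zeros_update (pushWord θ w) (hg j hj).1 hs
      have h3 := (good_iff θ w).2 hg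
      omega
    simp only [inc]
    rw [← Finset.sum_filter, ← Finset.sum_filter]
    symm
    refine Finset.sum_bij (fun j _ => θ j) ?_ ?_ ?_ ?_
    · intro j hj
      simpa using (hg j (by simpa using hj)).1
    · intro k hk j hj e
      exact (hg j (by simpa using hj)).2 k (by simpa using hk) e
    · intro k hk
      have hk' : pushWord θ w k = 0 := by simpa using hk
      obtain ⟨i, hi, e⟩ := pushWord_eq_iff_ne_bot θ w (j := k) (by rw [hk']; decide)
      exact ⟨i, by simpa using e.trans hk', hi⟩
    · intro j hj
      have hj' : w j = 0 := by simpa using hj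
      rw [hT j 1 hj' (by decide), hT j (-1) hj' (by decide), zerosBefore_pushWord θ w hg hj']
  · rw [if_neg (fun h => hg ((good_iff θ w).1 h))]
    symm
    by_cases hA : ∃ i p, w i = 0 ∧ w p = 1 ∧ θ p = θ i
    · obtain ⟨i, p, hi, hp, hpi⟩ := hA
      refine Finset.sum_eq_zero fun j _ => ?_
      split_ifs with hj
      · have hpj : p ≠ j := by rintro rfl; rw [hj] at hp; exact absurd hp (by decide)
        by_cases hij : j = i
        · subst hij
          have e : ∀ s, pushWord θ (Function.update w j s) = pushWord θ (Function.update w j 1) := by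
            intro s
            funext k
            by_cases hk : k = θ j
            · subst hk
              have hs : ∀ s, pushWord θ (Function.update w j s) (θ j) = 1 := by
                intro s
                have := le_pushWord θ (Function.update w j s) p
                rw [Function.update_of_ne hpj, hp, hpi] at this
                revert this
                generalize pushWord θ (Function.update w j s) (θ j) = a
                revert a
                decide
              rw [hs, hs]
            · apply Finset.sup_congr rfl
              intro l hl
              have : l ≠ j := by rintro rfl; exact hk (Finset.mem_filter.1 hl).2.symm
              rw [Function.update_of_ne this, Function.update_of_ne this]
          have hz : zeros (Function.update w j 1) = zeros (Function.update w j (-1)) := by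
            have h1 := zeros_update w hj (s := 1) (by decide)
            have h2 := zeros_update w hj (s := -1) (by decide)
            omega
          simp only [T, e (-1), hz, sub_self, mul_zero]
        · have hb : ∀ s, ¬ Good θ (Function.update w j s) := by
            intro s hgs
            have h1 := (hgs i (by rw [Function.update_of_ne (Ne.symm hij)]; exact hi)).1
            have h2 := le_pushWord θ (Function.update w j s) p
            rw [Function.update_of_ne hpj, hp, hpi, h1] at h2
            exact absurd h2 (by decide)
          rw [hT0 j 1 hj (by decide) (hb _), hT0 j (-1) hj (by decide) (hb _)]
          simp
      · rfl
    · have hA' : ∀ i, w i = 0 → pushWord θ w (θ i) = 0 := by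
        intro i hi
        by_contra h0
        have h1 := le_pushWord θ w i
        rw [hi] at h1
        have h2 : pushWord θ w (θ i) = 1 := by
          revert h0 h1
          generalize pushWord θ w (θ i) = a
          revert a
          decide
        obtain ⟨p, hp, e⟩ := pushWord_eq_iff_ne_bot θ w (j := θ i) (by rw [h2]; decide)
        exact hA ⟨i, p, hi, e.trans h2, hp⟩
      -- two zeros with the same image, chosen adjacent
      obtain ⟨a, b₀, ha, hb₀, hab₀, hθ₀⟩ : ∃ a b, w a = 0 ∧ w b = 0 ∧ a < b ∧ θ a = θ b := by
        simp only [Good] at hg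
        push Not at hg
        obtain ⟨i, hi, h⟩ := hg
        obtain ⟨k, hk, e, hne⟩ := h (hA' i hi)
        rcases lt_or_gt_of_ne hne with hl | hl
        · exact ⟨k, i, hk, hi, hl, e⟩
        · exact ⟨i, k, hi, hk, hl, e.symm⟩
      have hS : (Finset.univ.filter fun k => a < k ∧ w k = 0).Nonempty :=
        ⟨b₀, by simp [hab₀, hb₀]⟩
      obtain ⟨b, hbmem, hbmin⟩ := Finset.exists_min_image _ (fun k => k) hS
      obtain ⟨hab, hb⟩ : a < b ∧ w b = 0 := by simpa using hbmem
      have hθ : θ a = θ b := by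
        apply le_antisymm (θ.monotone hab.le)
        rw [hθ₀]
        exact θ.monotone (hbmin b₀ (by simp [hab₀, hb₀]))
      have hzb : zerosBefore w b = zerosBefore w a + 1 := by
        have : (Finset.univ.filter fun i => i < b ∧ w i = 0) =
            insert a (Finset.univ.filter fun i => i < a ∧ w i = 0) := by
          ext k
          simp only [Finset.mem_filter, Finset.mem_univ, true_and, Finset.mem_insert]
          constructor
          · rintro ⟨h1, h2⟩
            rcases lt_trichotomy k a with h3 | h3 | h3
            · exact Or.inr ⟨h3, h2⟩
            · exact Or.inl h3
            · exact absurd (hbmin k (by simp [h3, h2])) (not_le.2 h1)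
          · rintro (rfl | ⟨h1, h2⟩)
            · exact ⟨hab, ha⟩
            · exact ⟨h1.trans hab, h2⟩
        rw [zerosBefore, this, Finset.card_insert_of_notMem (by simp), zerosBefore]
      have hother : ∀ j, j ≠ a → j ≠ b → w j = 0 → ∀ s, s ≠ 0 → T j s = 0 := by
        intro j hja hjb hj s hs
        apply hT0 j s hj hs
        intro hgs
        have := (hgs a (by rw [Function.update_of_ne hja.symm]; exact ha)).2 b
          (by rw [Function.update_of_ne hjb.symm]; exact hb) hθ.symm
        exact hab.ne this.symm
      have hplus : ∀ j k, w j = 0 → w k = 0 → j ≠ k → θ j = θ k → T j 1 = 0 := by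
        intro j k hj hk hjk e
        apply hT0 j 1 hj (by decide)
        intro hgs
        have h1 := (hgs k (by rw [Function.update_of_ne hjk.symm]; exact hk)).1
        have h2 := le_pushWord θ (Function.update w j 1) j
        rw [Function.update_self, e, h1] at h2
        exact absurd h2 (by decide)
      have hminus : T a (-1) = T b (-1) := by
        have e : ∀ j k, w j = 0 → w k = 0 → j ≠ k → θ j = θ k →
            pushWord θ (Function.update w j (-1)) = pushWord θ w := by
          intro j k hj hk hjk e
          funext l
          apply le_antisymm
          · apply pushWord_le
            rintro i rfl
            by_cases hij : i = j
            · subst hij; rw [Function.update_self]; exact bot_le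
            · rw [Function.update_of_ne hij]; exact le_pushWord θ w i
          · apply pushWord_le
            rintro i rfl
            by_cases hij : i = j
            · subst hij
              have := le_pushWord θ (Function.update w i (-1)) k
              rwa [Function.update_of_ne hjk.symm, hk, ← e, ← hj] at this
            · have := le_pushWord θ (Function.update w j (-1)) i
              rwa [Function.update_of_ne hij] at this
        have hz : zeros (Function.update w a (-1)) = zeros (Function.update w b (-1)) := by
          have h1 := zeros_update w ha (s := -1) (by decide)
          have h2 := zeros_update w hb (s := -1) (by decide)
          omega
        simp only [T, e a b ha hb hab.ne hθ, e b a hb ha hab.ne' hθ.symm, hz]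
      rw [Finset.sum_eq_add a b hab.ne]
      · rw [if_pos ha, if_pos hb, hplus a b ha hb hab.ne hθ, hplus b a hb ha hab.ne' hθ.symm,
          hminus, hzb, pow_succ]
        ring
      · rintro j - ⟨hja, hjb⟩
        split_ifs with hj
        · rw [hother j hja hjb hj 1 (by decide), hother j hja hjb hj (-1) (by decide)]
          simp
        · rfl
      · simp
      · simp

end

/-- The map of face complexes induced by a monotone map. -/
def mapHom {m n : ℕ} (θ : Fin m →o Fin n) : FaceComplex.Hom (complex m) (complex n) where
  map := pushWord θ
  dim_le := zeros_pushWord_le θ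
  comm w v' := by
    have := chain_comm θ w v'
    convert this using 1

end Cube

/-! ### Atoms -/

/-- The sign `-1` of sources and `1` of targets. -/
def sg (α : Bool) : ℤ := if α then 1 else -1

open Classical in
theorem alternating_sum {n : ℕ} (α : Bool) (c : Fin n → ℤ) (S : Finset (Fin n)) :
    (∀ j ∈ S, c j = 1 ∨ c j = -1) →
    ∑ j ∈ S, c j * (if ∀ k ∈ S, (k < j → c k = sg α) ∧ (j < k → c k = -sg α) then 1 else 0) =
      (if ∀ k ∈ S, c k = 1 then 1 else 0) - (if ∀ k ∈ S, c k = -1 then 1 else 0) := by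
  induction S using Finset.induction_on_max with
  | empty => simp
  | insert M S hM ih =>
    intro hc
    have hMS : M ∉ S := fun h => lt_irrefl _ (hM M h)
    rw [Finset.sum_insert hMS]
    have h1 : ∀ j ∈ S, (if ∀ k ∈ insert M S, (k < j → c k = sg α) ∧ (j < k → c k = -sg α)
        then (1 : ℤ) else 0) =
        (if c M = -sg α then 1 else 0) *
          (if ∀ k ∈ S, (k < j → c k = sg α) ∧ (j < k → c k = -sg α) then 1 else 0) := by
      intro j hj
      have hjM := hM j hj
      rw [ite_zero_mul_ite_zero, one_mul]
      refine if_congr ?_ rfl rfl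
      rw [Finset.forall_mem_insert]
      simp [hjM, hjM.not_gt]
    have h2 : (if ∀ k ∈ insert M S, (k < M → c k = sg α) ∧ (M < k → c k = -sg α)
        then (1 : ℤ) else 0) = if ∀ k ∈ S, c k = sg α then 1 else 0 := by
      refine if_congr ?_ rfl rfl
      rw [Finset.forall_mem_insert]
      constructor
      · intro h k hk
        exact (h.2 k hk).1 (hM k hk)
      · intro h
        refine ⟨by simp, fun k hk => ⟨fun _ => h k hk, fun h3 => absurd (hM k hk) h3.not_gt⟩⟩
    rw [h2, Finset.sum_congr rfl fun j hj => by rw [h1 j hj, mul_left_comm], ← Finset.mul_sum,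
      ih fun j hj => hc j (Finset.mem_insert_of_mem hj)]
    simp only [Finset.forall_mem_insert]
    cases α <;> rcases hc M (Finset.mem_insert_self M S) with h | h <;> rw [h] <;>
      simp [sg] <;> split_ifs <;> norm_num

namespace Cube

/-- The faces `v` occurring in the `i`-dimensional source (`α = false`) or target (`α = true`) of
the face `w`: `v` is an `i`-dimensional subface of `w`, and each zero of `w` at a position `k` that
is not a zero of `v` is replaced by the sign `sg α * (-1)^z`, where `z` is the number of zeros of
`v` before `k`. -/
def AtomMem {n : ℕ} (w : Word n) (i : ℕ) (α : Bool) (v : Word n) : Prop :=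
  zeros v = i ∧ (∀ k, w k ≠ 0 → v k = w k) ∧
    ∀ k, w k = 0 → v k ≠ 0 → ((v k : SignType) : ℤ) * (-1) ^ zerosBefore v k = sg α

theorem zerosBefore_update {n : ℕ} (v : Word n) {j : Fin n} (hj : v j ≠ 0) (k : Fin n) :
    zerosBefore (Function.update v j 0) k = zerosBefore v k + if j < k then 1 else 0 := by
  have : (Finset.univ.filter fun i => i < k ∧ Function.update v j 0 i = 0) =
      if j < k then insert j (Finset.univ.filter fun i => i < k ∧ v i = 0)
        else (Finset.univ.filter fun i => i < k ∧ v i = 0) := by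
    split_ifs with h
    · ext i
      by_cases hi : i = j
      · subst hi; simp [h]
      · simp [hi]
    · ext i
      by_cases hi : i = j
      · subst hi; simp [h]
      · simp [hi]
  rw [zerosBefore, this]
  split_ifs with h
  · rw [Finset.card_insert_of_notMem (by simp [hj]), zerosBefore]
  · rfl

theorem sign_cases (s : SignType) (hs : s ≠ 0) (z : ℕ) :
    (s : ℤ) * (-1) ^ z = 1 ∨ (s : ℤ) * (-1) ^ z = -1 := by
  rcases neg_one_pow_eq_or ℤ z with h | h <;> rw [h] <;> revert s <;> decide

open Classical in
theorem atom_bdry {n : ℕ} (w : Word n) (i : ℕ) (α : Bool) (v : Word n) :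
    ∑ u, (((if AtomMem w (i + 1) α u then 1 else 0 : ℕ) : ℤ)) * inc u v =
      ((if AtomMem w i true v then 1 else 0 : ℕ) : ℤ) -
        ((if AtomMem w i false v then 1 else 0 : ℕ) : ℤ) := by
  let c : Fin n → ℤ := fun k => ((v k : SignType) : ℤ) * (-1) ^ zerosBefore v k
  let S : Finset (Fin n) := Finset.univ.filter fun k => w k = 0 ∧ v k ≠ 0
  let P : Prop := zeros v = i ∧ ∀ k, w k ≠ 0 → v k = w k
  have hS : ∀ k, k ∈ S ↔ w k = 0 ∧ v k ≠ 0 := fun k => by simp [S]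
  have hc : ∀ j ∈ S, c j = 1 ∨ c j = -1 := fun j hj => sign_cases _ ((hS j).1 hj).2 _
  have hmem : ∀ β, AtomMem w i β v ↔ P ∧ ∀ k ∈ S, c k = sg β := by
    intro β
    simp only [AtomMem, P, and_assoc]
    refine and_congr_right fun _ => and_congr_right fun _ => forall_congr' fun k => ?_
    rw [hS]
    exact and_imp.symm
  -- the left-hand side as a sum over positions
  have hL : ∑ u, (((if AtomMem w (i + 1) α u then 1 else 0 : ℕ) : ℤ)) * inc u v =
      ∑ j, if v j ≠ 0 then c j *
        (if AtomMem w (i + 1) α (Function.update v j 0) then 1 else 0) else 0 := by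
    simp only [inc, Finset.mul_sum]
    rw [Finset.sum_comm]
    refine Finset.sum_congr rfl fun j _ => ?_
    rw [Finset.sum_eq_single (Function.update v j 0)]
    · simp only [Function.update_self, if_true, Function.update_idem]
      have e : ∀ s, (v = Function.update v j s) ↔ v j = s := by
        intro s
        constructor
        · intro h
          have := congrFun h j
          rwa [Function.update_self] at this
        · rintro rfl
          exact (Function.update_eq_self j v).symm
      simp only [e]
      split_ifs with h1 h2 h3 h4 h5 h6
      all_goals first | (exfalso; simp_all; done) | skip
      all_goals simp_all [c, zerosBefore_update]
      generalize v j = a at *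
      revert a
      decide
    · intro u _ hu
      split_ifs with h1 h2 h3 h4
      all_goals try simp
      all_goals (exfalso; apply hu; subst_vars; funext k; by_cases hk : k = j)
      all_goals simp_all
    · simp
  have hU : ∀ j, v j ≠ 0 → (AtomMem w (i + 1) α (Function.update v j 0) ↔
      P ∧ j ∈ S ∧ ∀ k ∈ S, (k < j → c k = sg α) ∧ (j < k → c k = -sg α)) := by
    intro j hj
    have hz : zeros (Function.update v j 0) = zeros v + 1 := by
      have := zeros_update (Function.update v j 0) (j := j) (s := v j) (by simp) hj
      rw [Function.update_idem, Function.update_eq_self] at this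
      exact this.symm
    constructor
    · rintro ⟨h1, h2, h3⟩
      have hwj : w j = 0 := by
        by_contra h0
        have := h2 j h0
        rw [Function.update_self] at this
        exact h0 this.symm
      refine ⟨⟨by omega, fun k hk => ?_⟩, (hS j).2 ⟨hwj, hj⟩, fun k hk => ?_⟩
      · have hkj : k ≠ j := by rintro rfl; exact hk hwj
        have := h2 k hk
        rwa [Function.update_of_ne hkj] at this
      · have hk' := (hS k).1 hk
        have h4 : k ≠ j → c k * (-1) ^ (if j < k then 1 else 0) = sg α := by
          intro hkj
          have := h3 k hk'.1 (by rw [Function.update_of_ne hkj]; exact hk'.2)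
          rw [Function.update_of_ne hkj, zerosBefore_update v hj, pow_add, ← mul_assoc] at this
          exact this
        constructor
        · intro hl
          have := h4 hl.ne
          rwa [if_neg hl.not_gt, pow_zero, mul_one] at this
        · intro hl
          have := h4 hl.ne'
          rw [if_pos hl] at this
          linarith
    · rintro ⟨⟨h1, h2⟩, h3, h4⟩
      have h3' := (hS j).1 h3
      refine ⟨by omega, fun k hk => ?_, fun k hk hvk => ?_⟩
      · have hkj : k ≠ j := by rintro rfl; exact hk h3'.1
        rw [Function.update_of_ne hkj]
        exact h2 k hk
      · have hkj : k ≠ j := by rintro rfl; simp at hvk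
        rw [Function.update_of_ne hkj] at hvk ⊢
        rw [zerosBefore_update v hj, pow_add, ← mul_assoc]
        have h5 := h4 k ((hS k).2 ⟨hk, hvk⟩)
        change c k * _ = _
        rcases lt_or_gt_of_ne hkj with hl | hl
        · rw [if_neg hl.not_gt, pow_zero, mul_one]
          exact h5.1 hl
        · rw [if_pos hl, h5.2 hl]
          ring
  rw [hL]
  have hfin : ∀ j, (if v j ≠ 0 then c j *
      (if AtomMem w (i + 1) α (Function.update v j 0) then 1 else 0) else 0) =
      (if P then 1 else 0) * (if j ∈ S then c j *
        (if ∀ k ∈ S, (k < j → c k = sg α) ∧ (j < k → c k = -sg α) then 1 else 0) else 0) := by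
    intro j
    by_cases hj : v j ≠ 0
    · rw [if_pos hj]
      simp only [hU j hj]
      by_cases hP : P <;> by_cases hjS : j ∈ S <;> simp [hP, hjS]
    · have : j ∉ S := fun h => hj ((hS j).1 h).2
      rw [if_neg hj, if_neg this, mul_zero]
  rw [Finset.sum_congr rfl fun j _ => hfin j, ← Finset.mul_sum, ← Finset.sum_filter,
    Finset.filter_mem_eq_inter, Finset.univ_inter, alternating_sum α c S hc, hmem, hmem]
  by_cases hP : P <;> simp [hP, sg]

theorem zeros_eq_zero {n : ℕ} {v : Word n} : zeros v = 0 ↔ ∀ k, v k ≠ 0 := by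
  simp [zeros, Finset.filter_eq_empty_iff]

/-- The sign as a letter. -/
def letter (α : Bool) : SignType := if α then 1 else -1

theorem atomMem_zero {n : ℕ} (w : Word n) (α : Bool) (v : Word n) :
    AtomMem w 0 α v ↔ v = fun k => if w k = 0 then letter α else w k := by
  constructor
  · rintro ⟨h1, h2, h3⟩
    rw [zeros_eq_zero] at h1
    funext k
    split_ifs with hk
    · have hz : zerosBefore v k = 0 := by
        simp [zerosBefore, h1]
      have := h3 k hk (h1 k)
      rw [hz, pow_zero, mul_one] at this
      clear h2 h3
      generalize v k = a at this ⊢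
      revert this
      revert a α
      decide
    · exact h2 k hk
  · intro h
    have hv : ∀ k, v k ≠ 0 := by
      intro k
      rw [h]
      dsimp only
      split_ifs with hk
      · cases α <;> decide
      · exact hk
    refine ⟨zeros_eq_zero.2 hv, fun k hk => by rw [h]; simp [hk], fun k hk _ => ?_⟩
    have hz : zerosBefore v k = 0 := by
      simp [zerosBefore, hv]
    rw [hz, h]
    cases α <;> simp [hk, letter, sg]

open Classical in
/-- The atom `R(w)` of `I^n` generated by a face `w`. -/
noncomputable def atom {n : ℕ} (w : Word n) : (complex n).Cell where
  coeff i α v := if AtomMem w i α v then 1 else 0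
  supp i α v h := by
    by_contra h0
    exact h (if_neg fun h1 => h0 h1.1)
  bdry i α v := atom_bdry w i α v
  aug α := by
    simp only [atomMem_zero]
    simp

end Cube

/-- The `ω`-category `I^n` of the `n`-cube. -/
abbrev CubeCat (n : ℕ) : Type := (Cube.complex n).Cell

namespace Cube

/-- The initial vertex `-_n`. -/
def botWord (n : ℕ) : Word n := fun _ => -1

/-- The interior `0_n`. -/
def topWord (n : ℕ) : Word n := fun _ => 0

/-- The face functor between cubes induced by a monotone map. -/
def mapFunctor {m n : ℕ} (θ : Fin m →o Fin n) : OmegaFunctor (CubeCat m) (CubeCat n) :=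
  (mapHom θ).functor

/-- For the injection omitting the value `i`, the letter `-` is inserted in position `i`. -/
theorem pushWord_succAbove {n : ℕ} (i : Fin (n + 1)) (w : Word n) :
    pushWord (Fin.succAboveOrderEmb i).toOrderHom w = i.insertNth (-1) w := by
  funext j
  refine Fin.succAboveCases i ?_ (fun k => ?_) j
  · rw [Fin.insertNth_apply_same]
    by_contra h
    obtain ⟨k, hk, -⟩ := pushWord_eq_iff_ne_bot _ w h
    exact Fin.succAbove_ne i k hk
  · rw [Fin.insertNth_apply_succAbove]
    apply le_antisymm
    · apply pushWord_le
      intro l hl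
      rw [Fin.succAbove_right_injective hl]
    · exact le_pushWord (Fin.succAboveOrderEmb i).toOrderHom w k

/-- For the surjection taking the value `i` twice, the letters in positions `i` and `i + 1` are
replaced by their maximum. -/
theorem pushWord_predAbove {n : ℕ} (i : Fin n) (w : Word (n + 1)) (j : Fin n) :
    pushWord ⟨i.predAbove, Fin.predAbove_right_monotone i⟩ w j =
      if j < i then w j.castSucc else if j = i then max (w i.castSucc) (w i.succ)
        else w j.succ := by
  have hval : ∀ k : Fin (n + 1), i.predAbove k = j ↔
      (k = j.castSucc ∧ j ≤ i) ∨ (k = j.succ ∧ i ≤ j) := by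
    intro k
    simp only [Fin.predAbove, Fin.ext_iff, Fin.lt_def, Fin.le_def]
    split_ifs with h <;> simp <;> simp at h <;> omega
  have hle : ∀ k : Fin (n + 1), i.predAbove k = j → w k ≤
      pushWord ⟨i.predAbove, Fin.predAbove_right_monotone i⟩ w j := by
    rintro k rfl
    exact le_pushWord ⟨i.predAbove, Fin.predAbove_right_monotone i⟩ w k
  apply le_antisymm
  · apply pushWord_le
    intro k hk
    rcases (hval k).1 hk with ⟨rfl, h⟩ | ⟨rfl, h⟩
    · rcases h.lt_or_eq with h | rfl
      · rw [if_pos h]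
      · rw [if_neg (lt_irrefl _), if_pos rfl]; exact le_max_left _ _
    · rcases h.lt_or_eq with h | rfl
      · rw [if_neg h.not_gt, if_neg h.ne']
      · rw [if_neg (lt_irrefl _), if_pos rfl]; exact le_max_right _ _
  · split_ifs with h1 h2
    · exact hle _ ((hval _).2 (Or.inl ⟨rfl, h1.le⟩))
    · subst h2
      exact max_le (hle _ ((hval _).2 (Or.inl ⟨rfl, le_rfl⟩)))
        (hle _ ((hval _).2 (Or.inr ⟨rfl, le_rfl⟩)))
    · exact hle _ ((hval _).2 (Or.inr ⟨rfl, not_lt.1 h1⟩))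

/-- The vertex words. -/
theorem pushWord_botWord {m n : ℕ} (θ : Fin m →o Fin n) : pushWord θ (botWord m) = botWord n := by
  funext j
  by_contra h
  obtain ⟨i, -, e⟩ := pushWord_eq_iff_ne_bot θ (botWord m) (j := j) h
  exact h e.symm

theorem mapFunctor_id (n : ℕ) : mapFunctor (OrderHom.id (α := Fin n)) = OmegaFunctor.id _ := by
  rw [← FaceComplex.Hom.id_functor]
  have : mapHom (OrderHom.id (α := Fin n)) = FaceComplex.Hom.id _ := by
    apply FaceComplex.Hom.ext
    funext w j
    apply le_antisymm
    · apply pushWord_le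
      rintro i rfl
      exact le_rfl
    · exact le_pushWord OrderHom.id w j
  rw [mapFunctor, this]

theorem pushWord_comp {l m n : ℕ} (θ : Fin l →o Fin m) (η : Fin m →o Fin n) (w : Word l) :
    pushWord (η.comp θ) w = pushWord η (pushWord θ w) := by
  funext j
  apply le_antisymm
  · apply pushWord_le
    rintro i rfl
    exact (le_pushWord θ w i).trans (le_pushWord η (pushWord θ w) (θ i))
  · apply pushWord_le
    rintro k rfl
    apply pushWord_le
    rintro i rfl
    exact le_pushWord (η.comp θ) w i

theorem mapFunctor_comp {l m n : ℕ} (θ : Fin l →o Fin m) (η : Fin m →o Fin n) :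
    mapFunctor (η.comp θ) = (mapFunctor θ).comp (mapFunctor η) :=
  FaceComplex.Hom.functor_comp _ _ _ (pushWord_comp θ η)

theorem cell_ext_of_vertex {n : ℕ} {x y : CubeCat n} (hx : dim x = 0) (hy : dim y = 0)
    (h : x.coeff 0 false = y.coeff 0 false) : x = y := by
  rw [← d_of_dim_le false hx.le, ← d_of_dim_le false hy.le]
  apply FaceComplex.Cell.ext
  funext i β
  simp only [FaceComplex.d_coeff]
  split_ifs <;> first | rfl | omega

theorem atom_coeff_zero {n : ℕ} (w : Word n) (α : Bool) :
    (atom w).coeff 0 α = Pi.single (fun k => if w k = 0 then letter α else w k) 1 := by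
  classical
  funext v
  simp only [atom, atomMem_zero, Pi.single_apply]

theorem dim_atom_botWord (n : ℕ) : dim (atom (botWord n)) = 0 := by
  classical
  refine Nat.le_zero.1 ((dim_le_iff _ 0 false).2 ?_)
  apply FaceComplex.Cell.ext
  funext i β
  rw [FaceComplex.d_coeff]
  rcases Nat.eq_zero_or_pos i with rfl | hi
  · rw [if_neg (lt_irrefl 0), if_pos rfl, atom_coeff_zero, atom_coeff_zero]
    rfl
  · rw [if_neg (Nat.not_lt_zero i), if_neg hi.ne']
    funext v
    simp only [atom, Pi.zero_apply]
    rw [if_neg]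
    rintro ⟨h1, h2, -⟩
    have : v = botWord n := funext fun k => h2 k (by simp [botWord])
    rw [this] at h1
    simp [zeros, botWord] at h1
    omega

/-- `s_0 R(0_n) = R(-_n)`, and more generally for words in `{-, 0}`. -/
theorem d_zero_atom {n : ℕ} (w : Word n) (hw : ∀ k, w k ≤ 0) :
    d false 0 (atom w) = atom (botWord n) := by
  apply cell_ext_of_vertex (Nat.le_zero.1 (dim_d_le _ _ _)) (dim_atom_botWord n)
  rw [FaceComplex.d_coeff, if_neg (lt_irrefl 0), if_pos rfl, atom_coeff_zero, atom_coeff_zero]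
  have key : ∀ a : SignType, a ≤ 0 → (if a = 0 then (-1 : SignType) else a) = -1 := by decide
  congr 1
  funext k
  exact key _ (hw k)

theorem mapFunctor_atom_botWord {m n : ℕ} (θ : Fin m →o Fin n) :
    (mapFunctor θ) (atom (botWord m)) = atom (botWord n) := by
  apply cell_ext_of_vertex
    (Nat.le_zero.1 (((mapFunctor θ).dim_le _).trans (dim_atom_botWord m).le)) (dim_atom_botWord n)
  rw [atom_coeff_zero]
  change (mapHom θ).push 0 _ = _
  rw [atom_coeff_zero]
  funext v
  have e : ∀ n, (fun k => if botWord n k = 0 then letter false else botWord n k) = botWord n := by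
    intro n; funext k; simp [botWord]
  rw [e, e]
  simp only [FaceComplex.Hom.push, Pi.single_apply]
  rw [Finset.sum_eq_single (botWord m)]
  · change (if pushWord θ (botWord m) = v ∧ zeros v = 0 then _ else _) = _
    rw [pushWord_botWord]
    by_cases h : v = botWord n
    · subst h; simp [zeros, botWord]
    · simp [h, Ne.symm h]
  · intro b _ hb; simp [hb]
  · simp

/-- A `1`-dimensional morphism of a cube is not a loop. -/
theorem not_loop {n : ℕ} {u : CubeCat n} (hu : dim u = 1) : u.coeff 0 true ≠ u.coeff 0 false := by
  intro h
  classical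
  let p : Word n → ℤ := fun v => ∑ k, if v k = 1 then 1 else 0
  have hp : ∀ (b : Word n) (j : Fin n), b j = 0 →
      p (Function.update b j 1) - p (Function.update b j (-1)) = 1 := by
    intro b j hj
    simp only [p, ← Finset.sum_sub_distrib]
    rw [Finset.sum_eq_single j]
    · simp
    · intro k _ hk; simp [hk]
    · simp
  have hinc : ∀ b : Word n, zeros b = 1 → ∑ v, p v * inc b v = 1 := by
    intro b hb
    have e : ∑ v, p v * inc b v = ∑ j, if b j = 0 then (-1) ^ zerosBefore b j else 0 := by
      simp only [inc, Finset.mul_sum]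
      rw [Finset.sum_comm]
      refine Finset.sum_congr rfl fun j _ => ?_
      split_ifs with hj
      · have e1 : ∀ v, p v * ((-1) ^ zerosBefore b j *
            ((if v = Function.update b j 1 then 1 else 0) -
              (if v = Function.update b j (-1) then 1 else 0))) =
            (-1) ^ zerosBefore b j * ((if v = Function.update b j 1 then p v else 0) -
              (if v = Function.update b j (-1) then p v else 0)) := by
          intro v
          split_ifs <;> ring
        simp only [e1, ← Finset.mul_sum, Finset.sum_sub_distrib, Finset.sum_ite_eq',
          Finset.mem_univ, if_true, hp b j hj, mul_one]
      · simp
    obtain ⟨j, hj⟩ := Finset.card_eq_one.1 hb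
    have hj' : ∀ k, b k = 0 ↔ k = j := fun k => by
      have := Finset.ext_iff.1 hj k
      simpa using this
    have hz : zerosBefore b j = 0 := by
      simp only [zerosBefore, hj', Finset.card_eq_zero]
      ext k
      simp only [Finset.mem_filter, Finset.mem_univ, true_and, Finset.notMem_empty, iff_false]
      rintro ⟨h1, rfl⟩
      exact lt_irrefl _ h1
    rw [e]
    simp [hj', hz]
  have h0 : ∀ α, u.coeff 1 α = 0 := by
    intro α
    have e : ∑ b, (u.coeff 1 α b : ℤ) = 0 := by
      have e1 : ∑ v, p v * ∑ b, (u.coeff 1 α b : ℤ) * inc b v = 0 := by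
        refine Finset.sum_eq_zero fun v _ => ?_
        have := u.bdry 0 α v
        rw [h, sub_self] at this
        rw [this, mul_zero]
      rw [← e1]
      simp only [Finset.mul_sum]
      rw [Finset.sum_comm]
      refine Finset.sum_congr rfl fun b _ => ?_
      by_cases hb : u.coeff 1 α b = 0
      · simp [hb]
      · have := hinc b (u.supp _ _ _ hb)
        calc (u.coeff 1 α b : ℤ) = u.coeff 1 α b * ∑ v, p v * inc b v := by rw [this, mul_one]
          _ = _ := by
            rw [Finset.mul_sum]
            exact Finset.sum_congr rfl fun v _ => by ring
    funext b
    have := (Finset.sum_eq_zero_iff_of_nonneg (fun b _ => Int.natCast_nonneg _)).1 e b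
      (Finset.mem_univ b)
    exact_mod_cast this
  have h1 : d false 0 u = u := by
    have h2 := d_of_dim_le false hu.le
    apply FaceComplex.Cell.ext
    funext i β
    rw [FaceComplex.d_coeff]
    rcases Nat.lt_trichotomy i 1 with hi | rfl | hi
    · obtain rfl : i = 0 := by omega
      rw [if_neg (lt_irrefl 0), if_pos rfl]
      cases β
      · rfl
      · exact h.symm
    · rw [if_neg (by omega), if_neg (by omega), h0]
    · rw [if_neg (by omega), if_neg (by omega), ← h2, FaceComplex.d_coeff, if_neg (by omega),
        if_neg (by omega)]
  have h3 := (dim_le_iff u 0 false).2 h1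
  omega

/-- The condition on an `ω`-functor `x : I^n ⟶ C` defining `ωCat(I^n, C)^-`: each
`1`-dimensional morphism of `I^n` starting at the initial vertex has a `1`-dimensional image. -/
def IsNegative {n : ℕ} {C : Type u} [OmegaCategory C] (x : OmegaFunctor (CubeCat n) C) : Prop :=
  ∀ u : CubeCat n, d false 0 u = atom (botWord n) → dim u = 1 → dim (x u) = 1

theorem dim_mapFunctor {m n : ℕ} (θ : Fin m →o Fin n) {u : CubeCat m}
    (h0 : d false 0 u = atom (botWord m)) (hu : dim u = 1) : dim ((mapFunctor θ) u) = 1 := by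
  classical
  have h1 : dim ((mapFunctor θ) u) ≤ 1 := hu ▸ (mapFunctor θ).dim_le u
  by_contra hne
  have h2 : dim ((mapFunctor θ) u) ≤ 0 := by omega
  apply not_loop hu
  -- the final vertex of `u` is sent to the initial vertex
  have h3 : (mapFunctor θ) (d true 0 u) = atom (botWord n) := by
    rw [(mapFunctor θ).map_d, d_of_dim_le true h2, ← d_of_dim_le false h2, ← (mapFunctor θ).map_d,
      h0, mapFunctor_atom_botWord]
  have h4 : u.coeff 0 false = Pi.single (botWord m) 1 := by
    have := congrArg (fun x : CubeCat m => x.coeff 0 false) h0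
    simp only [FaceComplex.d_coeff, atom_coeff_zero, lt_irrefl, if_false, if_true] at this
    rw [this]
    congr 1
  have h5 : ∀ v, u.coeff 0 true v ≠ 0 → v = botWord m := by
    intro v hv
    by_contra hvb
    have hpv : pushWord θ v ≠ botWord n := by
      intro e
      apply hvb
      funext k
      have := le_pushWord θ v k
      rw [e] at this
      exact le_bot_iff.1 this
    have hz : zeros (pushWord θ v) = 0 :=
      Nat.le_zero.1 ((zeros_pushWord_le θ v).trans (u.supp _ _ _ hv).le)
    have h6 := congrArg (fun x : CubeCat n => x.coeff 0 false (pushWord θ v)) h3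
    simp only [atom_coeff_zero] at h6
    have e : (fun k => if botWord n k = 0 then letter false else botWord n k) = botWord n := by
      funext k; simp [botWord]
    rw [e, Pi.single_eq_of_ne hpv] at h6
    change ∑ b, (if pushWord θ b = pushWord θ v ∧ zeros (pushWord θ v) = 0 then
      (d true 0 u).coeff 0 false b else 0) = 0 at h6
    have h7 := (Finset.sum_eq_zero_iff.1 h6) v (Finset.mem_univ v)
    rw [if_pos ⟨rfl, hz⟩, FaceComplex.d_coeff, if_neg (lt_irrefl 0), if_pos rfl] at h7
    exact hv h7
  rw [h4]
  funext v
  by_cases hv : v = botWord m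
  · subst hv
    rw [Pi.single_eq_same, ← u.aug true, Finset.sum_eq_single (botWord m)]
    · intro b _ hb
      by_contra h
      exact hb (h5 b h)
    · simp
  · rw [Pi.single_eq_of_ne hv]
    by_contra h
    exact hv (h5 v h)

theorem IsNegative.precomp {m n : ℕ} {C : Type u} [OmegaCategory C]
    {x : OmegaFunctor (CubeCat n) C} (hx : IsNegative x) (θ : Fin m →o Fin n) :
    IsNegative ((mapFunctor θ).comp x) := by
  intro u h0 hu
  refine hx _ ?_ (dim_mapFunctor θ h0 hu)
  rw [← (mapFunctor θ).map_d, h0, mapFunctor_atom_botWord]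

/-- The morphism `R(0_{n+1})`. -/
noncomputable def top (n : ℕ) : CubeCat n := atom (topWord n)

theorem dim_top_le (n : ℕ) : dim (top n) ≤ n := by
  classical
  refine (dim_le_iff _ n false).2 ?_
  apply FaceComplex.Cell.ext
  funext i β
  rw [FaceComplex.d_coeff]
  have hz : ∀ v : Word n, zeros v ≤ n := fun v => by
    have := Finset.card_le_univ (Finset.univ.filter fun i => v i = 0)
    rw [Fintype.card_fin] at this
    exact this
  split_ifs with h1 h2
  · rfl
  · subst h2
    funext v
    simp only [top, atom]
    refine if_congr ?_ rfl rfl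
    constructor <;> rintro ⟨h3, h4, h5⟩
    all_goals
      have h6 : ∀ k, v k = 0 := by
        have : (Finset.univ.filter fun k => v k = 0) = Finset.univ :=
          Finset.eq_univ_of_card _ (by simpa [zeros] using h3)
        intro k
        have := Finset.mem_univ k
        rw [← ‹(Finset.univ.filter fun k => v k = 0) = Finset.univ›] at this
        simpa using this
      exact ⟨h3, h4, fun k _ hk => absurd (h6 k) hk⟩
  · funext v
    simp only [top, atom, Pi.zero_apply]
    rw [if_neg]
    rintro ⟨h3, -⟩
    have := hz v
    omega

theorem dim_d_one_top (n : ℕ) : dim (d false 1 (top (n + 1))) = 1 := by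
  classical
  refine le_antisymm (dim_d_le _ _ _) ?_
  by_contra h
  have h0 : dim (d false 1 (top (n + 1))) ≤ 0 := by omega
  have h1 := congrArg (fun x : CubeCat (n + 1) => x.coeff 0) (d_of_dim_le false h0)
  have h2 := congrFun h1 true
  rw [d_d_of_lt _ _ _ Nat.zero_lt_one] at h2
  simp only [FaceComplex.d_coeff, top, atom_coeff_zero, lt_irrefl, if_false, if_true,
    Nat.zero_lt_one] at h2
  have h3 := congrFun h2 (fun k => if topWord (n + 1) k = 0 then letter false else topWord (n + 1) k)
  rw [Pi.single_eq_same, Pi.single_eq_of_ne] at h3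
  · omega
  · intro e
    have := congrFun e 0
    simp [topWord, letter] at this

theorem d_zero_top (n : ℕ) : d false 0 (top n) = atom (botWord n) :=
  d_zero_atom _ fun _ => le_rfl

end Cube

/-! ### Simplexes -/

namespace Simplex

/-- Faces of the `n`-simplex: strictly increasing non-empty sequences, that is, non-empty subsets
of `{0, …, n}`. -/
abbrev Face (n : ℕ) : Type := {σ : Finset (Fin (n + 1)) // σ.Nonempty}

/-- The number of elements of `σ` before `j`. -/
def before {n : ℕ} (σ : Finset (Fin (n + 1))) (j : Fin (n + 1)) : ℕ := (σ.filter fun k => k < j).card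

/-- Incidence numbers of the simplex: the faces obtained by removing the element in an odd position
(counted from `1`) occur in the source (coefficient `-1`), and those obtained by removing the
element in an even position occur in the target (coefficient `1`). -/
def inc {n : ℕ} (σ τ : Face n) : ℤ :=
  ∑ j ∈ σ.1, if σ.1.erase j = τ.1 then (-1) ^ (before σ.1 j + 1) else 0

/-- The face complex of the `n`-simplex. -/
@[reducible]
def complex (n : ℕ) : FaceComplex where
  Face := Face n
  dim σ := σ.1.card - 1
  inc := inc

/-- The image of a face by a monotone map. -/
def imageFace {m n : ℕ} (θ : Fin (m + 1) →o Fin (n + 1)) (σ : Face m) : Face n :=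
  ⟨σ.1.image θ, σ.2.image θ⟩

theorem chain_comm {m n : ℕ} (θ : Fin (m + 1) →o Fin (n + 1)) (σ : Face m) (τ' : Face n) :
    (if (imageFace θ σ).1.card - 1 = σ.1.card - 1 then inc (imageFace θ σ) τ' else 0) =
      ∑ τ : Face m, if imageFace θ τ = τ' ∧ τ'.1.card - 1 = τ.1.card - 1 then inc σ τ else 0 := by
  let T : Fin (m + 1) → ℤ := fun j =>
    if (σ.1.erase j).image θ = τ'.1 ∧ τ'.1.card = (σ.1.erase j).card then 1 else 0
  have hR : ∑ τ : Face m, (if imageFace θ τ = τ' ∧ τ'.1.card - 1 = τ.1.card - 1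
      then inc σ τ else 0) = ∑ j ∈ σ.1, (-1) ^ (before σ.1 j + 1) * T j := by
    have e1 : ∀ τ : Face m, (if imageFace θ τ = τ' ∧ τ'.1.card - 1 = τ.1.card - 1
        then inc σ τ else 0) =
        ∑ j ∈ σ.1, if σ.1.erase j = τ.1 then (-1) ^ (before σ.1 j + 1) * T j else 0 := by
      intro τ
      have h1 : (imageFace θ τ = τ' ∧ τ'.1.card - 1 = τ.1.card - 1) ↔
          (τ.1.image θ = τ'.1 ∧ τ'.1.card = τ.1.card) := by
        have := τ.2.card_pos
        have := τ'.2.card_pos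
        rw [Subtype.ext_iff]
        refine and_congr_right fun _ => ?_
        omega
      simp only [h1, inc]
      by_cases h : τ.1.image θ = τ'.1 ∧ τ'.1.card = τ.1.card
      · rw [if_pos h]
        refine Finset.sum_congr rfl fun j _ => ?_
        split_ifs with h2
        · simp only [T, h2, h, and_self, if_true, mul_one]
        · rfl
      · rw [if_neg h]
        symm
        refine Finset.sum_eq_zero fun j _ => ?_
        split_ifs with h2
        · simp only [T, h2, h, if_false, mul_zero]
        · rfl
    simp only [e1]
    rw [Finset.sum_comm]
    refine Finset.sum_congr rfl fun j _ => ?_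
    by_cases h : (σ.1.erase j).Nonempty
    · rw [Finset.sum_eq_single ⟨σ.1.erase j, h⟩]
      · simp
      · intro τ _ hτ
        rw [if_neg]
        intro e
        exact hτ (Subtype.ext e.symm)
      · simp
    · have h0 : T j = 0 := by
        rw [Finset.not_nonempty_iff_eq_empty] at h
        simp only [T, h, Finset.image_empty]
        rw [if_neg]
        rintro ⟨h1, -⟩
        exact τ'.2.ne_empty h1.symm
      simp [h0]
  rw [hR]
  by_cases hinj : Set.InjOn θ σ.1
  · have hcard : (imageFace θ σ).1.card = σ.1.card := Finset.card_image_of_injOn hinj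
    rw [if_pos (by rw [hcard])]
    have e : inc (imageFace θ σ) τ' = ∑ j ∈ σ.1, if (σ.1.image θ).erase (θ j) = τ'.1
        then (-1) ^ (before (σ.1.image θ) (θ j) + 1) else 0 := by
      simp only [inc, imageFace]
      exact Finset.sum_image hinj
    rw [e]
    refine Finset.sum_congr rfl fun j hj => ?_
    have h1 : (σ.1.erase j).image θ = (σ.1.image θ).erase (θ j) := by
      ext k
      simp only [Finset.mem_image, Finset.mem_erase]
      constructor
      · rintro ⟨l, ⟨h2, h3⟩, rfl⟩
        exact ⟨fun e => h2 (hinj h3 hj e), l, h3, rfl⟩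
      · rintro ⟨h2, l, h3, rfl⟩
        exact ⟨l, ⟨fun e => h2 (by rw [e]), h3⟩, rfl⟩
    have h2 : before (σ.1.image θ) (θ j) = before σ.1 j := by
      have : (σ.1.image θ).filter (fun k => k < θ j) = (σ.1.filter fun k => k < j).image θ := by
        ext k
        simp only [Finset.mem_filter, Finset.mem_image]
        constructor
        · rintro ⟨⟨l, h3, rfl⟩, h4⟩
          exact ⟨l, ⟨h3, lt_of_not_ge fun h5 => h4.not_ge (θ.monotone h5)⟩, rfl⟩
        · rintro ⟨l, ⟨h3, h4⟩, rfl⟩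
          exact ⟨⟨l, h3, rfl⟩, lt_of_le_of_ne (θ.monotone h4.le) fun e => h4.ne (hinj h3 hj e)⟩
      rw [before, this, Finset.card_image_of_injOn (hinj.mono (Finset.coe_subset.2
        (Finset.filter_subset _ _))), before]
    rw [← h1, h2]
    by_cases h3 : (σ.1.erase j).image θ = τ'.1
    · have h4 : τ'.1.card = (σ.1.erase j).card := by
        rw [← h3]
        exact Finset.card_image_of_injOn (hinj.mono (Finset.coe_subset.2 (Finset.erase_subset _ _)))
      simp only [T]
      rw [if_pos h3, if_pos ⟨h3, h4⟩, mul_one]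
    · simp only [T]
      rw [if_neg h3, if_neg (fun h => h3 h.1), mul_zero]
  · have hlt : (imageFace θ σ).1.card < σ.1.card := by
      refine lt_of_le_of_ne Finset.card_image_le fun e => hinj ?_
      exact Finset.card_image_iff.1 e
    have hpos := (imageFace θ σ).2.card_pos
    rw [if_neg (by omega)]
    obtain ⟨a, b₀, ha, hb₀, hab₀, hθ₀⟩ : ∃ a b, a ∈ σ.1 ∧ b ∈ σ.1 ∧ a < b ∧ θ a = θ b := by
      simp only [Set.InjOn] at hinj
      push Not at hinj
      obtain ⟨i, hi, k, hk, e, hne⟩ := hinj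
      rcases lt_or_gt_of_ne hne with hl | hl
      · exact ⟨i, k, hi, hk, hl, e⟩
      · exact ⟨k, i, hk, hi, hl, e.symm⟩
    obtain ⟨b, hbmem, hbmin⟩ := Finset.exists_min_image (σ.1.filter fun k => a < k) (fun k => k)
      ⟨b₀, by simp [hab₀, hb₀]⟩
    obtain ⟨hb, hab⟩ : b ∈ σ.1 ∧ a < b := by simpa using hbmem
    have hθ : θ a = θ b := by
      apply le_antisymm (θ.monotone hab.le)
      rw [hθ₀]
      exact θ.monotone (hbmin b₀ (by simp [hab₀, hb₀]))
    have hbefore : before σ.1 b = before σ.1 a + 1 := by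
      have : (σ.1.filter fun k => k < b) = insert a (σ.1.filter fun k => k < a) := by
        ext k
        simp only [Finset.mem_filter, Finset.mem_insert]
        constructor
        · rintro ⟨h1, h2⟩
          rcases lt_trichotomy k a with h3 | h3 | h3
          · exact Or.inr ⟨h1, h3⟩
          · exact Or.inl h3
          · exact absurd (hbmin k (by simp [h1, h3])) (not_le.2 h2)
        · rintro (rfl | ⟨h1, h2⟩)
          · exact ⟨ha, hab⟩
          · exact ⟨h1, h2.trans hab⟩
      rw [before, this, Finset.card_insert_of_notMem (by simp), before]
    have him : ∀ j k, k ∈ σ.1 → j ≠ k → θ j = θ k → (σ.1.erase j).image θ = σ.1.image θ := by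
      intro j k hk hjk e
      ext l
      simp only [Finset.mem_image, Finset.mem_erase]
      constructor
      · rintro ⟨p, ⟨-, h2⟩, h3⟩
        exact ⟨p, h2, h3⟩
      · rintro ⟨p, h2, h3⟩
        by_cases hp : p = j
        · subst hp
          exact ⟨k, ⟨hjk.symm, hk⟩, e ▸ h3⟩
        · exact ⟨p, ⟨hp, h2⟩, h3⟩
    have hT : T a = T b := by
      simp only [T, him a b hb hab.ne hθ, him b a ha hab.ne' hθ.symm,
        Finset.card_erase_of_mem ha, Finset.card_erase_of_mem hb]
    rw [Finset.sum_eq_add a b hab.ne]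
    · rw [hT, hbefore, pow_succ _ (before σ.1 a + 1)]
      ring
    · rintro j - ⟨hja, hjb⟩
      have : T j = 0 := by
        simp only [T]
        rw [if_neg]
        rintro ⟨h1, h2⟩
        rw [← h1] at h2
        have h3 : Set.InjOn θ (σ.1.erase j) := Finset.card_image_iff.1 h2
        exact hab.ne (h3 (by simp [ha, hja.symm]) (by simp [hb, hjb.symm]) hθ)
      rw [this, mul_zero]
    · exact fun h => absurd ha h
    · exact fun h => absurd hb h

/-- The map of face complexes induced by a monotone map. -/
def mapHom {m n : ℕ} (θ : Fin (m + 1) →o Fin (n + 1)) :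
    FaceComplex.Hom (complex m) (complex n) where
  map := imageFace θ
  dim_le σ := Nat.sub_le_sub_right Finset.card_image_le 1
  comm σ τ' := by
    have := chain_comm θ σ τ'
    convert this using 1

/-- The faces `τ` occurring in the `i`-dimensional source (`α = false`) or target (`α = true`) of
the face `σ`: `τ` is an `i`-dimensional subface of `σ` such that `(-1)^(z+1) = sg α` for each
removed element `k`, where `z` is the number of elements of `τ` before `k`. -/
def AtomMem {n : ℕ} (σ : Face n) (i : ℕ) (α : Bool) (τ : Face n) : Prop :=
  τ.1.card = i + 1 ∧ τ.1 ⊆ σ.1 ∧ ∀ k ∈ σ.1 \ τ.1, (-1 : ℤ) ^ (before τ.1 k + 1) = sg α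

theorem before_insert {n : ℕ} {τ : Finset (Fin (n + 1))} {j : Fin (n + 1)} (hj : j ∉ τ)
    (k : Fin (n + 1)) : before (insert j τ) k = before τ k + if j < k then 1 else 0 := by
  rw [before, Finset.filter_insert]
  split_ifs with h
  · rw [Finset.card_insert_of_notMem (by simp [hj]), before]
  · rfl

open Classical in
theorem atom_bdry {n : ℕ} (σ : Face n) (i : ℕ) (α : Bool) (τ : Face n) :
    ∑ υ, (((if AtomMem σ (i + 1) α υ then 1 else 0 : ℕ) : ℤ)) * inc υ τ =
      ((if AtomMem σ i true τ then 1 else 0 : ℕ) : ℤ) -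
        ((if AtomMem σ i false τ then 1 else 0 : ℕ) : ℤ) := by
  let c : Fin (n + 1) → ℤ := fun k => (-1) ^ (before τ.1 k + 1)
  let S : Finset (Fin (n + 1)) := σ.1 \ τ.1
  let P : Prop := τ.1.card = i + 1 ∧ τ.1 ⊆ σ.1
  have hS : ∀ k, k ∈ S ↔ k ∈ σ.1 ∧ k ∉ τ.1 := fun k => Finset.mem_sdiff
  have hc : ∀ j ∈ S, c j = 1 ∨ c j = -1 := fun j _ => neg_one_pow_eq_or ℤ _
  have hmem : ∀ β, AtomMem σ i β τ ↔ P ∧ ∀ k ∈ S, c k = sg β := by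
    intro β
    simp only [AtomMem, P, and_assoc]
    rfl
  let ins : Fin (n + 1) → Face n := fun j => ⟨insert j τ.1, Finset.insert_nonempty _ _⟩
  have hL : ∑ υ, (((if AtomMem σ (i + 1) α υ then 1 else 0 : ℕ) : ℤ)) * inc υ τ =
      ∑ j, if j ∉ τ.1 then c j * (if AtomMem σ (i + 1) α (ins j) then 1 else 0) else 0 := by
    have e : ∀ υ : Face n, inc υ τ =
        ∑ j, if j ∈ υ.1 ∧ υ.1.erase j = τ.1 then (-1) ^ (before υ.1 j + 1) else 0 := by
      intro υ
      rw [inc, ← Finset.sum_filter, ← Finset.sum_filter]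
      refine Finset.sum_congr ?_ fun _ _ => rfl
      ext j
      simp
    simp only [e, Finset.mul_sum]
    rw [Finset.sum_comm]
    refine Finset.sum_congr rfl fun j _ => ?_
    by_cases hj : j ∉ τ.1
    · rw [if_pos hj, Finset.sum_eq_single (ins j)]
      · have e2 : j ∈ (ins j).1 ∧ (ins j).1.erase j = τ.1 :=
          ⟨Finset.mem_insert_self _ _, Finset.erase_insert hj⟩
        rw [if_pos e2]
        simp only [ins, c, before_insert hj, lt_irrefl, if_false, add_zero]
        split_ifs <;> simp
      · intro υ _ hυ
        suffices h0 : ¬ (j ∈ υ.1 ∧ υ.1.erase j = τ.1) by rw [if_neg h0, mul_zero]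
        rintro ⟨h1, h2⟩
        apply hυ
        apply Subtype.ext
        change υ.1 = insert j τ.1
        rw [← h2, Finset.insert_erase h1]
      · simp
    · rw [if_neg hj]
      refine Finset.sum_eq_zero fun υ _ => ?_
      suffices h0 : ¬ (j ∈ υ.1 ∧ υ.1.erase j = τ.1) by rw [if_neg h0, mul_zero]
      rintro ⟨h1, h2⟩
      apply hj
      rw [← h2]
      simp
  have hU : ∀ j, j ∉ τ.1 → (AtomMem σ (i + 1) α (ins j) ↔
      P ∧ j ∈ S ∧ ∀ k ∈ S, (k < j → c k = sg α) ∧ (j < k → c k = -sg α)) := by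
    intro j hj
    have hcard : (insert j τ.1).card = τ.1.card + 1 := Finset.card_insert_of_notMem hj
    have hck : ∀ k, (-1 : ℤ) ^ (before (insert j τ.1) k + 1) =
        c k * (-1) ^ (if j < k then 1 else 0) := by
      intro k
      rw [before_insert hj, add_right_comm, pow_add]
    have hiff : ∀ k, k ≠ j → (c k * (-1) ^ (if j < k then 1 else 0) = sg α ↔
        (k < j → c k = sg α) ∧ (j < k → c k = -sg α)) := by
      intro k hkj
      rcases lt_or_gt_of_ne hkj with hl | hl
      · simp [hl, hl.not_gt]
      · simp only [hl, hl.not_gt, if_true, pow_one, mul_neg, mul_one, false_imp_iff, true_and,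
          true_imp_iff]
        constructor <;> intro h <;> linarith
    simp only [AtomMem, ins, hcard, P, Finset.insert_subset_iff, hck]
    constructor
    · rintro ⟨h1, ⟨h2, h3⟩, h4⟩
      refine ⟨⟨by omega, h3⟩, (hS j).2 ⟨h2, hj⟩, fun k hk => ?_⟩
      by_cases hkj : k = j
      · subst hkj; simp
      · rw [← hiff k hkj]
        apply h4
        rw [hS] at hk
        simp [hk, hkj]
    · rintro ⟨⟨h1, h2⟩, h3, h4⟩
      refine ⟨by omega, ⟨((hS j).1 h3).1, h2⟩, fun k hk => ?_⟩
      simp only [Finset.mem_sdiff, Finset.mem_insert, not_or] at hk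
      rw [hiff k hk.2.1]
      exact h4 k ((hS k).2 ⟨hk.1, hk.2.2⟩)
  rw [hL]
  have hfin : ∀ j, (if j ∉ τ.1 then c j *
      (if AtomMem σ (i + 1) α (ins j) then 1 else 0) else 0) =
      (if P then 1 else 0) * (if j ∈ S then c j *
        (if ∀ k ∈ S, (k < j → c k = sg α) ∧ (j < k → c k = -sg α) then 1 else 0) else 0) := by
    intro j
    by_cases hj : j ∉ τ.1
    · rw [if_pos hj]
      simp only [hU j hj]
      by_cases hP : P <;> by_cases hjS : j ∈ S <;> simp [hP, hjS]
    · have : j ∉ S := fun h => hj ((hS j).1 h).2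
      rw [if_neg hj, if_neg this, mul_zero]
  rw [Finset.sum_congr rfl fun j _ => hfin j, ← Finset.mul_sum, ← Finset.sum_filter,
    Finset.filter_mem_eq_inter, Finset.univ_inter, alternating_sum α c S hc, hmem, hmem]
  by_cases hP : P <;> simp [hP, sg]

/-- The final vertex of a face for `α = false`, the initial one for `α = true`. -/
def vertex {n : ℕ} (σ : Face n) (α : Bool) : Fin (n + 1) := if α then σ.1.min' σ.2 else σ.1.max' σ.2

/-- A vertex, as a face. -/
def point {n : ℕ} (a : Fin (n + 1)) : Face n := ⟨{a}, Finset.singleton_nonempty a⟩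

theorem before_singleton {n : ℕ} (a k : Fin (n + 1)) : before {a} k = if a < k then 1 else 0 := by
  rw [before, Finset.filter_singleton]
  split_ifs <;> rfl

theorem atomMem_zero {n : ℕ} (σ : Face n) (α : Bool) (τ : Face n) :
    AtomMem σ 0 α τ ↔ τ = point (vertex σ α) := by
  have key : ∀ a, AtomMem σ 0 α (point a) ↔ a = vertex σ α := by
    intro a
    have h1 : ∀ k, k ≠ a → ((-1 : ℤ) ^ (before {a} k + 1) = sg α ↔
        if α then a < k else k < a) := by
      intro k hk
      rw [before_singleton]
      rcases lt_or_gt_of_ne hk with h | h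
      · cases α <;> simp [sg, h, h.not_gt]
      · cases α <;> simp [sg, h, h.not_gt]
    simp only [AtomMem, point, Finset.card_singleton, zero_add, true_and,
      Finset.singleton_subset_iff, Finset.mem_sdiff, Finset.mem_singleton]
    constructor
    · rintro ⟨h2, h3⟩
      have h4 : ∀ k ∈ σ.1, k ≠ a → if α then a < k else k < a := fun k hk hka =>
        (h1 k hka).1 (h3 k ⟨hk, hka⟩)
      cases α
      · refine le_antisymm (Finset.le_max' _ _ h2) (Finset.max'_le _ σ.2 _ fun k hk => ?_)
        by_cases hka : k = a
        · exact hka.le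
        · exact le_of_lt (by simpa using h4 k hk hka)
      · refine le_antisymm (Finset.le_min' _ σ.2 _ fun k hk => ?_) (Finset.min'_le _ _ h2)
        by_cases hka : k = a
        · exact hka.ge
        · exact le_of_lt (by simpa using h4 k hk hka)
    · rintro rfl
      refine ⟨?_, fun k hk => ?_⟩
      · cases α
        · exact Finset.max'_mem _ σ.2
        · exact Finset.min'_mem _ σ.2
      · rw [h1 k hk.2]
        cases α
        · exact lt_of_le_of_ne (Finset.le_max' _ _ hk.1) hk.2
        · exact lt_of_le_of_ne (Finset.min'_le _ _ hk.1) (Ne.symm hk.2)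
  constructor
  · intro h
    obtain ⟨a, ha⟩ := Finset.card_eq_one.1 h.1
    have : τ = point a := Subtype.ext ha
    subst this
    rw [(key a).1 h]
  · rintro rfl
    exact (key _).2 rfl

open Classical in
/-- The atom `R(σ)` of `Δ^n` generated by a face `σ`. -/
noncomputable def atom {n : ℕ} (σ : Face n) : (complex n).Cell where
  coeff i α τ := if AtomMem σ i α τ then 1 else 0
  supp i α τ h := by
    have h0 : AtomMem σ i α τ := by
      by_contra h0
      exact h (if_neg h0)
    change τ.1.card - 1 = i
    rw [h0.1]
    rfl
  bdry i α τ := atom_bdry σ i α τ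
  aug α := by
    simp only [atomMem_zero]
    simp

end Simplex

/-- The `ω`-category `Δ^n` of the `n`-simplex. -/
abbrev SimplexCat (n : ℕ) : Type := (Simplex.complex n).Cell

namespace Simplex

/-- The `ω`-functor between simplexes induced by a monotone map. -/
def mapFunctor {m n : ℕ} (θ : Fin (m + 1) →o Fin (n + 1)) :
    OmegaFunctor (SimplexCat m) (SimplexCat n) :=
  (mapHom θ).functor

theorem mapFunctor_id (n : ℕ) :
    mapFunctor (OrderHom.id (α := Fin (n + 1))) = OmegaFunctor.id _ := by
  rw [← FaceComplex.Hom.id_functor]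
  have : mapHom (OrderHom.id (α := Fin (n + 1))) = FaceComplex.Hom.id _ := by
    apply FaceComplex.Hom.ext
    funext σ
    exact Subtype.ext Finset.image_id
  rw [mapFunctor, this]

theorem mapFunctor_comp {l m n : ℕ} (θ : Fin (l + 1) →o Fin (m + 1))
    (η : Fin (m + 1) →o Fin (n + 1)) :
    mapFunctor (η.comp θ) = (mapFunctor θ).comp (mapFunctor η) :=
  FaceComplex.Hom.functor_comp _ _ _ fun σ =>
    Subtype.ext (Finset.image_image (s := σ.1) (f := θ) (g := η)).symm

theorem cell_ext_of_vertex {n : ℕ} {x y : SimplexCat n} (hx : dim x = 0) (hy : dim y = 0)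
    (h : x.coeff 0 false = y.coeff 0 false) : x = y := by
  rw [← d_of_dim_le false hx.le, ← d_of_dim_le false hy.le]
  apply FaceComplex.Cell.ext
  funext i β
  simp only [FaceComplex.d_coeff]
  split_ifs <;> first | rfl | omega

theorem atom_coeff_zero {n : ℕ} (σ : Face n) (α : Bool) :
    (atom σ).coeff 0 α = Pi.single (point (vertex σ α)) 1 := by
  classical
  funext τ
  simp only [atom, atomMem_zero, Pi.single_apply]

theorem dim_atom_le {n : ℕ} (σ : Face n) : dim (atom σ) ≤ σ.1.card - 1 := by
  classical
  have hpos := σ.2.card_pos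
  refine (dim_le_iff _ _ false).2 ?_
  apply FaceComplex.Cell.ext
  funext i β
  rw [FaceComplex.d_coeff]
  split_ifs with h1 h2
  · rfl
  · subst h2
    funext τ
    simp only [atom]
    refine if_congr ?_ rfl rfl
    constructor <;> rintro ⟨h3, h4, h5⟩
    all_goals
      have h6 : τ.1 = σ.1 := Finset.eq_of_subset_of_card_le h4 (by omega)
      exact ⟨h3, h4, by simp [h6]⟩
  · funext τ
    simp only [atom, Pi.zero_apply]
    rw [if_neg]
    rintro ⟨h3, h4, -⟩
    have := Finset.card_le_card h4
    omega

theorem dim_atom_point {n : ℕ} (a : Fin (n + 1)) : dim (atom (point a)) = 0 :=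
  Nat.le_zero.1 (dim_atom_le (point a))

theorem d_zero_atom {n : ℕ} (σ : Face n) (α : Bool) :
    d α 0 (atom σ) = atom (point (vertex σ α)) := by
  apply cell_ext_of_vertex (Nat.le_zero.1 (dim_d_le _ _ _)) (dim_atom_point _)
  rw [FaceComplex.d_coeff, if_neg (lt_irrefl 0), if_pos rfl, atom_coeff_zero, atom_coeff_zero]
  cases α <;> simp [vertex, point]

/-- The morphism `(0 < 1 < … < n)` of `Δ^n`. -/
noncomputable def top (n : ℕ) : SimplexCat n := atom ⟨Finset.univ, Finset.univ_nonempty⟩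

theorem dim_top_le (n : ℕ) : dim (top n) ≤ n := by
  have h := dim_atom_le (n := n) ⟨Finset.univ, Finset.univ_nonempty⟩
  rw [Finset.card_univ, Fintype.card_fin] at h
  exact h

theorem mapFunctor_top_zero {n : ℕ} (θ : Fin 1 →o Fin (n + 1)) :
    (mapFunctor θ) (top 0) = atom (point (θ 0)) := by
  apply cell_ext_of_vertex (Nat.le_zero.1 (((mapFunctor θ).dim_le _).trans (dim_top_le 0)))
    (dim_atom_point _)
  rw [atom_coeff_zero]
  change (mapHom θ).push 0 _ = _
  rw [top, atom_coeff_zero]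
  funext τ
  simp only [FaceComplex.Hom.push, Pi.single_apply]
  have h0 : ∀ σ : Face 0, σ = point 0 := by
    intro σ
    apply Subtype.ext
    have e : ∀ a : Fin (0 + 1), a = 0 := fun a => Fin.eq_zero a
    obtain ⟨a, ha⟩ := σ.2
    rw [e a] at ha
    ext k
    rw [e k]
    simp [point, ha]
  rw [Finset.sum_eq_single (point 0)]
  · rw [h0 (point (vertex ⟨Finset.univ, _⟩ false)), if_pos rfl]
    have h1 : (mapHom θ).map (point 0) = point (θ 0) := Subtype.ext (Finset.image_singleton _ _)
    have h2 : vertex (point (θ 0)) false = θ 0 := by simp [vertex, point]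
    rw [h1, h2]
    by_cases h : τ = point (θ 0)
    · subst h; simp [point]
    · simp [h, Ne.symm h]
  · intro b _ hb; exact absurd (h0 b) hb
  · simp

/-- The vertices of a simplex have the same image in a discrete `ω`-category. -/
theorem disc_point {n : ℕ} {X : Type u} (F : OmegaFunctor (SimplexCat n) (Disc X))
    (a b : Fin (n + 1)) : F (atom (point a)) = F (atom (point b)) := by
  wlog hab : a ≤ b generalizing a b
  · exact (this b a (le_of_not_ge hab)).symm
  let e : Face n := ⟨{a, b}, Finset.insert_nonempty _ _⟩
  have h1 : vertex e true = a := by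
    refine le_antisymm (Finset.min'_le _ _ (by simp [e])) (Finset.le_min' _ e.2 _ ?_)
    simp [e, hab]
  have h2 : vertex e false = b := by
    refine le_antisymm (Finset.max'_le _ e.2 _ ?_) (Finset.le_max' _ _ (by simp [e]))
    simp [e, hab]
  have h3 := F.map_d true 0 (atom e)
  have h4 := F.map_d false 0 (atom e)
  rw [d_zero_atom, h1] at h3
  rw [d_zero_atom, h2] at h4
  exact h3.trans h4.symm

end Simplex

/-! ### Cuts -/

/-- The set of `n`-simplexes of an augmented simplicial set, as a functor. -/
def nSimplices (n : ℕ) : SimplicialObject.Augmented (Type u) ⥤ Type u :=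
  SimplicialObject.Augmented.drop ⋙
    (CategoryTheory.evaluation SimplexCategoryᵒᵖ (Type u)).obj (Opposite.op (SimplexCategory.mk n))

/-- A cut `(F, P, ev)`. -/
structure Cut where
  F : NCOmegaCat.{u} ⥤ SimplicialObject.Augmented (Type u)
  P : NCOmegaCat.{u} ⥤ OmegaCat.{u}
  ev : ∀ n : ℕ, F ⋙ nSimplices n ⟶ P ⋙ tr n

/-- A morphism of cuts `(φ, ψ)`. -/
@[ext]
structure Cut.Hom (A B : Cut.{u}) where
  φ : A.F ⟶ B.F
  ψ : A.P ⟶ B.P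
  comm : ∀ n : ℕ,
    Functor.whiskerRight φ (nSimplices n) ≫ B.ev n = A.ev n ≫ Functor.whiskerRight ψ (tr n)

/-! ### The branching semi-cubical cut -/

/-- The simplicial set `[n] ↦ ωCat(I^{n+1}, C)^-`. -/
def cubicalSimplicial (C : NCOmegaCat.{u}) : SimplicialObject (Type u) :=
  { obj := fun n => {x : OmegaFunctor (CubeCat (n.unop.len + 1)) C // Cube.IsNegative x}
    map := fun {_ _} g => TypeCat.ofHom fun x =>
      ⟨(Cube.mapFunctor g.unop.toOrderHom).comp x.1, x.2.precomp _⟩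
    map_id := fun n => by
      refine ConcreteCategory.hom_ext _ _ fun x => Subtype.ext ?_
      change (Cube.mapFunctor OrderHom.id).comp x.1 = x.1
      rw [Cube.mapFunctor_id]
      rfl
    map_comp := fun {_ _ _} f g => by
      refine ConcreteCategory.hom_ext _ _ fun x => Subtype.ext ?_
      change (Cube.mapFunctor (f.unop.toOrderHom.comp g.unop.toOrderHom)).comp x.1 = _
      rw [Cube.mapFunctor_comp]
      rfl }

/-- The augmentation `x ↦ s_0 (x(0_1))`. -/
noncomputable def cubicalAugmentation (C : NCOmegaCat.{u}) :
    {x : OmegaFunctor (CubeCat 1) C // Cube.IsNegative x} ⟶ zeroCells.obj C :=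
  TypeCat.ofHom fun x => ⟨d false 0 (x.1 (Cube.top 1)), Nat.le_zero.1 (dim_d_le _ _ _)⟩

/-- The augmented simplicial set `𝒩⁻(C)`. -/
noncomputable def cubicalNerveObj (C : NCOmegaCat.{u}) : SimplicialObject.Augmented (Type u) :=
  SimplicialObject.augment (cubicalSimplicial C) (zeroCells.obj C) (cubicalAugmentation C) (by
    have key : ∀ (i : SimplexCategory) (g : SimplexCategory.mk 0 ⟶ i)
        (x : OmegaFunctor (CubeCat (i.len + 1)) C),
        d false 0 (x (Cube.mapFunctor g.toOrderHom (Cube.top 1))) =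
          x (Cube.atom (Cube.botWord _)) := by
      intro i g x
      rw [← x.map_d, ← OmegaFunctor.map_d, Cube.d_zero_top, Cube.mapFunctor_atom_botWord]
    intro i g₁ g₂
    ext x
    apply Subtype.ext
    exact (key i g₁ x.1).trans (key i g₂ x.1).symm)

theorem Cube.IsNegative.postcomp {n : ℕ} {C D : NCOmegaCat.{u}} {x : OmegaFunctor (CubeCat n) C}
    (hx : Cube.IsNegative x) (f : C ⟶ D) : Cube.IsNegative (x.comp f.functor) :=
  fun v h0 h1 => f.nonContracting _ (hx v h0 h1)

/-- The functor `𝒩⁻ : ωCat₁ ⥤ Sets_+^{Δᵒᵖ}`. -/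
noncomputable def cubicalNerve : NCOmegaCat.{u} ⥤ SimplicialObject.Augmented (Type u) where
  obj := cubicalNerveObj
  map {_ _} f :=
    { left := { app := fun _ => TypeCat.ofHom fun x => ⟨x.1.comp f.functor, x.2.postcomp f⟩ }
      right := zeroCells.map f
      w := by
        ext n x
        apply Subtype.ext
        exact (f.functor.map_d _ _ _).symm }

theorem Cube.IsNegative.one_le_dim {n : ℕ} {C : NCOmegaCat.{u}}
    {x : OmegaFunctor (CubeCat (n + 1)) C} (hx : Cube.IsNegative x) :
    1 ≤ dim (x (Cube.top (n + 1))) := by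
  apply NCOmegaCat.one_le_dim_of_d_one (α := false)
  rw [← x.map_d]
  apply hx
  · rw [d_d_of_lt _ _ _ Nat.zero_lt_one, Cube.d_zero_top]
  · exact Cube.dim_d_one_top n

/-- The branching semi-cubical cut `(𝒩⁻, ℙ)`, with `ev(x) = x(0_{n+1})`. -/
noncomputable def branchingSemiCubicalCut : Cut.{u} where
  F := cubicalNerve
  P := pathFunctor
  ev n :=
    { app := fun C => TypeCat.ofHom
        fun x : {x : OmegaFunctor (CubeCat (n + 1)) C // Cube.IsNegative x} =>
          (⟨⟨x.1 (Cube.top (n + 1)), x.2.one_le_dim⟩, (NCOmegaCat.dim_path_le_iff _ _).2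
            ((x.1.dim_le _).trans (Cube.dim_top_le _))⟩ : {y : C.Path // dim y ≤ n}) }

/-! ### The branching semi-globular cut -/

/-- The simplicial nerve `[n] ↦ ωCat(Δ^n, D)` of an `ω`-category. -/
def simplicialNerve (D : OmegaCat.{u}) : SimplicialObject (Type u) :=
  { obj := fun n => OmegaFunctor (SimplexCat n.unop.len) D
    map := fun {_ _} g => TypeCat.ofHom fun x => (Simplex.mapFunctor g.unop.toOrderHom).comp x
    map_id := fun n => by
      refine ConcreteCategory.hom_ext _ _ fun x => ?_
      change (Simplex.mapFunctor OrderHom.id).comp x = x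
      rw [Simplex.mapFunctor_id]
      rfl
    map_comp := fun {_ _ _} f g => by
      refine ConcreteCategory.hom_ext _ _ fun x => ?_
      change (Simplex.mapFunctor (f.unop.toOrderHom.comp g.unop.toOrderHom)).comp x = _
      rw [Simplex.mapFunctor_comp]
      rfl }

/-- The augmentation `x ↦ s_0 (x(0))`. -/
noncomputable def globularAugmentation (C : NCOmegaCat.{u}) :
    OmegaFunctor (SimplexCat 0) C.semiPath ⟶ zeroCells.obj C :=
  TypeCat.ofHom fun x => (C.semiPathSource.toFun (x (Simplex.top 0))).as

/-- The augmented simplicial set `𝒩^{gl⁻}(C)`. -/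
noncomputable def globularNerveObj (C : NCOmegaCat.{u}) : SimplicialObject.Augmented (Type u) :=
  SimplicialObject.augment (simplicialNerve C.semiPath) (zeroCells.obj C)
    (globularAugmentation C) (by
      intro i g₁ g₂
      refine ConcreteCategory.hom_ext _ _ fun (x : OmegaFunctor (SimplexCat i.len) C.semiPath) => ?_
      change (C.semiPathSource.toFun (x (Simplex.mapFunctor g₁.toOrderHom (Simplex.top 0)))).as =
        (C.semiPathSource.toFun (x (Simplex.mapFunctor g₂.toOrderHom (Simplex.top 0)))).as
      rw [Simplex.mapFunctor_top_zero, Simplex.mapFunctor_top_zero]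
      exact congrArg Disc.as (Simplex.disc_point
        (OmegaFunctor.comp (C := Disc (zeroCells.obj C)) x C.semiPathSource) _ _))

/-- The `ω`-functor between discrete `ω`-categories induced by a map. -/
def Disc.map {X Y : Type u} (f : X → Y) : (⟨Disc X⟩ : OmegaCat.{u}) ⟶ ⟨Disc Y⟩ :=
  OmegaFunctor.mk (A := Disc X) (B := Disc Y) (fun x => ⟨f x.as⟩) (fun _ _ _ => rfl)
    (fun _ _ _ _ _ => rfl)

theorem NCOmegaCat.semiPathSource_naturality {C D : NCOmegaCat.{u}} (f : C ⟶ D) :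
    semiPathMap f ≫ D.semiPathSource = C.semiPathSource ≫ Disc.map (zeroCells.map f) := by
  apply semiPath_hom_ext
  have h : ∀ E : NCOmegaCat.{u}, E.hMinus ≫ E.semiPathSource = E.pathSource :=
    fun E => hMinus_semiPathDesc _ _
  rw [← Category.assoc, hMinus_semiPathMap, Category.assoc, h, ← Category.assoc, h]
  apply OmegaFunctor.ext
  funext x
  exact congrArg Disc.mk (Subtype.ext (f.functor.map_d _ _ _).symm)

/-- The functor `𝒩^{gl⁻} : ωCat₁ ⥤ Sets_+^{Δᵒᵖ}`. -/
noncomputable def globularNerve : NCOmegaCat.{u} ⥤ SimplicialObject.Augmented (Type u) where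
  obj := globularNerveObj
  map {C D} f :=
    { left := { app := fun _ => TypeCat.ofHom fun x => x.comp (semiPathFunctor.map f) }
      right := zeroCells.map f
      w := by
        ext n x
        exact congrArg Disc.as (congrFun (congrArg OmegaFunctor.toFun
          (NCOmegaCat.semiPathSource_naturality f)) _) }
  map_id C := by
    refine SimplicialObject.Augmented.hom_ext _ _ ?_ (zeroCells.map_id C)
    apply NatTrans.ext
    funext n
    ext x
    change OmegaFunctor.comp x (semiPathFunctor.map (𝟙 C)) = x
    rw [CategoryTheory.Functor.map_id]
    rfl
  map_comp f g := by
    refine SimplicialObject.Augmented.hom_ext _ _ ?_ (zeroCells.map_comp f g)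
    apply NatTrans.ext
    funext n
    ext x
    change OmegaFunctor.comp x (semiPathFunctor.map (f ≫ g)) = _
    rw [CategoryTheory.Functor.map_comp]
    rfl

/-- The branching semi-globular cut `(𝒩^{gl⁻}, ℙ⁻)`, with `ev(x) = x(0 < 1 < … < n)`. -/
noncomputable def branchingSemiGlobularCut : Cut.{u} where
  F := globularNerve
  P := semiPathFunctor
  ev n :=
    { app := fun C => TypeCat.ofHom fun x : OmegaFunctor (SimplexCat n) C.semiPath =>
        (⟨x (Simplex.top n), (x.dim_le _).trans (Simplex.dim_top_le n)⟩ :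
          {y : C.semiPath // dim y ≤ n}) }

end Omega

/-!
Everything rests on the geometry of the initial vertex `-…-` of the cube `I^{n+1}`. The faces
through it, other than the vertex itself, are the words in `{-, 0}` with at least one zero; they
correspond to the faces of `Δ^n`, with dimensions lowered by one, and the signs of the boundaries
agree. An element `u` of `I^{n+1}` of positive dimension whose `0`-source is the initial vertex
(`Cube.Leaves`) therefore has a trace on these faces, the element `Cube.link u` of `Δ^n`. The link
turns the operations of index `m + 1` into those of index `m`, and it ignores `*_0`-composition on
the right, `link (u *_0 v) = link u`, because `v` no longer meets a face through the initial
vertex. This is exactly what `ℛ⁻` imposes on `ℙ⁻C`.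

Existence. Let `x` be a negative cube of `C` and write `G u = h⁻(x u)` for `u` leaving the initial
vertex; then `G` satisfies the same rules as the link (`semiPathValue_comp_succ`,
`semiPathValue_comp_zero`), and the point is that `G u` depends on `link u` only. By Steiner's
theory of loop-free augmented complexes with unital basis, here reduced to the excision argument of
`UnitalBasis.generated_atom`, every element of the cube is a composite of atoms. This gives an
induction principle for the elements leaving the initial vertex (`Cube.Leaves.induction`). Since
atoms are indecomposable (`UnitalBasis.dim_le_of_comp_eq_atom`), it shows that `G u` is the value of
`G` at the corresponding atom whenever `link u` is an atom
(`Cube.semiPathValue_eq_of_link_eq_atom`).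

To conclude without using that `Δ^n` is free, the link is given a section. Explicit positive chains
(`Cube.sectionCoeff`), compatible with boundaries, turn each element `y` of `Δ^n` into an element
`Cube.sectionCell y` of `I^{n+1}` with link `y`; this is compatible with all operations after the
shift of indices, so `y ↦ G (sectionCell y)` is an `ω`-functor `Cube.toSimplex : Δ^n → ℙ⁻C`.
Induction then gives `G u = toSimplex (link u)` for all `u` (`Cube.semiPathValue_eq`), from which
the compatibility with the simplicial operators, with the augmentations and with the evaluations
follows. In degree `-1` the morphism is the identity of `C_0`.

Uniqueness. An `ω`-functor on `Δ^n` is determined by its values on atoms (`Simplex.functor_ext`),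
each atom is the image of the top element of a simplex under a face operator
(`Simplex.exists_mapFunctor_top`), and on top elements the value is prescribed by the evaluations
and by `ψ = h⁻`. In degree `-1`, a natural endomorphism of `C ↦ C_0` is the identity, as one sees on
the `ω`-functors from the one-point `ω`-category (`zeroCells_endo`).
-/

namespace Omega

open OmegaCategory

/-! ### Generation of an `ω`-category under composition -/

/-- The elements obtained from `S` by iterated composition (in all directions). -/
inductive Generated {A : Type u} [OmegaCategory A] (S : Set A) : A → Prop
  | base {x : A} : x ∈ S → Generated S x
  | comp (n : ℕ) {x y : A} (h : d true n x = d false n y) :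
      Generated S x → Generated S y → Generated S (OmegaCategory.comp n x y h)

theorem dim_comp_le {A : Type u} [OmegaCategory A] {m k : ℕ} {x y : A}
    (h : d true k x = d false k y) (hx : dim x ≤ m) (hy : dim y ≤ m) : dim (comp k x y h) ≤ m := by
  rcases lt_or_ge k m with hk | hk
  · have e : d true k (d false m x) = d false k (d false m y) := by
      rw [d_of_dim_le false hx, d_of_dim_le false hy, h]
    rw [dim_le_iff _ _ false, d_comp false x y hk.ne' h e]
    exact comp_congr (d_of_dim_le _ hx) (d_of_dim_le _ hy) _
  · have e : y = d true k x := by rw [h, d_of_dim_le _ (hy.trans hk)]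
    rw [comp_congr rfl e, comp_target]
    exact hx

/-! ### Face complexes with a unital basis -/

namespace FaceComplex

variable {K : FaceComplex}

theorem Cell.coeff_eq_zero_of_dim_ne (x : K.Cell) {i : ℕ} {α : Bool} {b : K.Face}
    (h : K.dim b ≠ i) : x.coeff i α b = 0 := by
  by_contra h0
  exact h (x.supp i α b h0)

theorem Cell.coeff_eq_of_succ_eq_zero (x : K.Cell) {i : ℕ} {α : Bool}
    (h : x.coeff (i + 1) α = 0) : x.coeff i true = x.coeff i false := by
  funext c
  have := x.bdry i α c
  simp only [h, Pi.zero_apply, Nat.cast_zero, zero_mul, Finset.sum_const_zero] at this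
  omega

/-- A cell has dimension at most `m` if and only if its chains vanish above degree `m`. -/
theorem Cell.dim_le_iff_coeff (x : K.Cell) (m : ℕ) :
    Omega.dim x ≤ m ↔ ∀ i, m < i → ∀ α, x.coeff i α = 0 := by
  rw [dim_le_iff _ _ false]
  constructor
  · intro h i hi α
    rw [← h, d_coeff, if_neg (by omega), if_neg (by omega)]
  · intro h
    apply Cell.ext
    funext i α
    rw [d_coeff]
    split_ifs with h1 h2
    · rfl
    · subst h2
      cases α
      · rfl
      · exact (x.coeff_eq_of_succ_eq_zero (h _ (Nat.lt_succ_self i) true)).symm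
    · exact (h i (by omega) α).symm

/-- Composition in the `ω`-category of a face complex does not lower dimensions. -/
theorem Cell.dim_le_of_dim_comp_le {m k : ℕ} {x y : K.Cell}
    (h : OmegaCategory.d true k x = OmegaCategory.d false k y)
    (hc : Omega.dim (OmegaCategory.comp k x y h) ≤ m) : Omega.dim x ≤ m ∧ Omega.dim y ≤ m := by
  have key : ∀ i, k < i → m < i → ∀ α, x.coeff i α = 0 ∧ y.coeff i α = 0 := by
    intro i hi hm α
    have h1 := (Cell.dim_le_iff_coeff _ m).1 hc i hm α
    rw [comp_coeff, if_neg (by omega), if_neg (by omega)] at h1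
    constructor <;> funext b <;> have h2 := congrFun h1 b <;>
      simp only [Pi.add_apply, Pi.zero_apply] at h2 ⊢ <;> omega
  rcases le_or_gt k m with hk | hk
  · exact ⟨(x.dim_le_iff_coeff m).2 fun i hi α => (key i (by omega) hi α).1,
      (y.dim_le_iff_coeff m).2 fun i hi α => (key i (by omega) hi α).2⟩
  · have hx : Omega.dim x ≤ k := (x.dim_le_iff_coeff k).2 fun i hi α => (key i hi (by omega) α).1
    have hy : Omega.dim y ≤ k := (y.dim_le_iff_coeff k).2 fun i hi α => (key i hi (by omega) α).2
    rw [d_of_dim_le _ hx, d_of_dim_le _ hy] at h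
    subst h
    have e : OmegaCategory.comp k x x ‹_› = x := by
      rw [comp_congr rfl (d_of_dim_le true hx).symm, comp_target]
    rw [e] at hc
    exact ⟨hc, hc⟩

/-- A unital basis: each face `b` generates an atom, a cell whose only face of dimension at least
`dim b` is `b` itself, and whose sources and targets of dimension less than `dim b` have no face
in common. -/
structure UnitalBasis (K : FaceComplex) where
  atom : K.Face → K.Cell
  coeff_self : ∀ b α, (atom b).coeff (K.dim b) α = Pi.single b 1
  coeff_of_lt : ∀ b i α, K.dim b < i → (atom b).coeff i α = 0
  disjoint : ∀ b i c, i < K.dim b →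
    (atom b).coeff i false c = 0 ∨ (atom b).coeff i true c = 0

namespace UnitalBasis

variable (B : UnitalBasis K)

theorem inc_eq (b c : K.Face) (i : ℕ) (h : K.dim b = i + 1) :
    K.inc b c = ((B.atom b).coeff i true c : ℤ) - (B.atom b).coeff i false c := by
  rw [← (B.atom b).bdry i true c, ← h, B.coeff_self]
  rw [Finset.sum_eq_single b]
  · simp
  · intro a _ ha
    simp [Pi.single_eq_of_ne ha]
  · simp

theorem dim_atom (b : K.Face) : Omega.dim (B.atom b) = K.dim b := by
  refine le_antisymm (((B.atom b).dim_le_iff_coeff _).2 fun i hi α => B.coeff_of_lt b i α hi) ?_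
  by_contra h
  have h1 := ((B.atom b).dim_le_iff_coeff _).1 le_rfl _ (lt_of_not_ge h) true
  rw [B.coeff_self] at h1
  simpa using congrFun h1 b

theorem atom_injective : Function.Injective B.atom := by
  intro a b h
  have h1 := B.dim_atom a
  rw [h, B.dim_atom] at h1
  have h2 := B.coeff_self a true
  rw [h, ← h1, B.coeff_self] at h2
  by_contra hab
  have := congrFun h2 b
  rw [Pi.single_eq_same, Pi.single_eq_of_ne (Ne.symm hab)] at this
  exact one_ne_zero this

/-- If the chains of `x` and `y` above degree `m` add up to those of an atom, and the summand of
`y` has no face in the dimension of the atom, then it has none above degree `m`: it would lie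
both in the source and in the target of the atom. -/
theorem coeff_eq_zero_of_add {b : K.Face} {x y : K.Cell} {m : ℕ}
    (h : ∀ i, m < i → ∀ α, x.coeff i α + y.coeff i α = (B.atom b).coeff i α)
    (hy : ∀ α, y.coeff (K.dim b) α = 0) : ∀ i, m < i → ∀ α, y.coeff i α = 0 := by
  have key : ∀ k i, i + k = K.dim b → m < i → ∀ α, y.coeff i α = 0 := by
    intro k
    induction k with
    | zero => rintro i rfl _ α; exact hy α
    | succ k ih =>
      intro i hi hm α
      have h1 := y.coeff_eq_of_succ_eq_zero (ih (i + 1) (by omega) (by omega) true)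
      have h2 : y.coeff i α = y.coeff i false := by cases α <;> simp [h1]
      rw [h2]
      funext c
      have h3 := congrFun (h i hm false) c
      have h4 := congrFun (h i hm true) c
      simp only [Pi.add_apply] at h3 h4
      rw [h1] at h4
      rcases B.disjoint b i c (by omega) with h5 | h5
      · rw [h5] at h3; simp only [Pi.zero_apply]; omega
      · rw [h5] at h4; simp only [Pi.zero_apply]; omega
  intro i hm α
  rcases le_or_gt i (K.dim b) with hi | hi
  · exact key (K.dim b - i) i (by omega) hm α
  · have h1 := h i hm α
    rw [B.coeff_of_lt b i α hi] at h1
    funext c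
    have := congrFun h1 c
    simp only [Pi.add_apply, Pi.zero_apply] at this ⊢
    omega

/-- Atoms are indecomposable. -/
theorem dim_le_of_comp_eq_atom {b : K.Face} {x y : K.Cell} {m : ℕ}
    (h : OmegaCategory.d true m x = OmegaCategory.d false m y)
    (e : OmegaCategory.comp m x y h = B.atom b) : Omega.dim x ≤ m ∨ Omega.dim y ≤ m := by
  have hadd : ∀ i, m < i → ∀ α, x.coeff i α + y.coeff i α = (B.atom b).coeff i α := by
    intro i hi α
    rw [← e, comp_coeff, if_neg (by omega), if_neg (by omega)]
  rcases le_or_gt (K.dim b) m with hb | hb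
  · left
    exact (Cell.dim_le_of_dim_comp_le h (by rw [e, B.dim_atom]; exact hb)).1
  · have hs : ∀ α a, x.coeff (K.dim b) α a + y.coeff (K.dim b) α a =
        (Pi.single b 1 : K.Face → ℕ) a := by
      intro α a
      rw [← B.coeff_self b α, ← hadd _ hb]
      rfl
    have hz : ∀ α a, x.coeff (K.dim b + 1) α a = 0 ∧ y.coeff (K.dim b + 1) α a = 0 := by
      intro α a
      have h1 := congrFun (hadd (K.dim b + 1) (by omega) α) a
      rw [B.coeff_of_lt b _ α (Nat.lt_succ_self _)] at h1
      simp only [Pi.add_apply, Pi.zero_apply] at h1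
      omega
    have hx := x.coeff_eq_of_succ_eq_zero (α := true) (funext fun a => (hz true a).1)
    have hy := y.coeff_eq_of_succ_eq_zero (α := true) (funext fun a => (hz true a).2)
    have hne : ∀ α a, a ≠ b → x.coeff (K.dim b) α a = 0 ∧ y.coeff (K.dim b) α a = 0 := by
      intro α a ha
      have h1 := hs α a
      rw [Pi.single_eq_of_ne ha] at h1
      omega
    have hb1 := hs false b
    rw [Pi.single_eq_same] at hb1
    by_cases h0 : y.coeff (K.dim b) false b = 0
    · right
      refine (y.dim_le_iff_coeff m).2 (B.coeff_eq_zero_of_add hadd fun α => ?_)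
      have : y.coeff (K.dim b) α = y.coeff (K.dim b) false := by cases α <;> simp [hy]
      rw [this]
      funext a
      by_cases ha : a = b
      · rw [ha]; exact h0
      · exact (hne false a ha).2
    · left
      refine (x.dim_le_iff_coeff m).2 (B.coeff_eq_zero_of_add
        (fun i hi α => (add_comm _ _).trans (hadd i hi α)) fun α => ?_)
      have : x.coeff (K.dim b) α = x.coeff (K.dim b) false := by cases α <;> simp [hx]
      rw [this]
      funext a
      by_cases ha : a = b
      · rw [ha]; simp only [Pi.zero_apply]; omega
      · exact (hne false a ha).1

end UnitalBasis

end FaceComplex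

/-! ### Decomposition of cells into atoms -/

namespace FaceComplex

variable {K : FaceComplex}

/-- A splitting of the chains of `u` above degree `q`, together with an intermediate chain `M` of
degree `q`, is realized by a decomposition `u = y *_q z`. -/
theorem Cell.exists_comp_eq (u : K.Cell) (q : ℕ) (v w : ℕ → Bool → K.Face → ℕ) (M : K.Face → ℕ)
    (hvw : ∀ i, q < i → ∀ α, u.coeff i α = v i α + w i α)
    (hv : ∀ i, q < i → ∀ α c, ∑ b, (v (i + 1) α b : ℤ) * K.inc b c = v i true c - v i false c)
    (hM : ∀ α c, ∑ b, (v (q + 1) α b : ℤ) * K.inc b c = M c - u.coeff q false c)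
    (hMs : ∀ b, M b ≠ 0 → K.dim b = q)
    (hMb : ∀ j, j + 1 = q → ∀ c,
      ∑ b, (M b : ℤ) * K.inc b c = u.coeff j true c - u.coeff j false c)
    (hMa : q = 0 → ∑ b, M b = 1) :
    ∃ (y z : K.Cell) (h : OmegaCategory.d true q y = OmegaCategory.d false q z),
      u = OmegaCategory.comp q y z h ∧ (∀ i, q < i → y.coeff i = v i) ∧
        (∀ i, q < i → z.coeff i = w i) := by
  have hw : ∀ i, q < i → ∀ α c,
      ∑ b, (w (i + 1) α b : ℤ) * K.inc b c = w i true c - w i false c := by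
    intro i hi α c
    have h1 := u.bdry i α c
    simp only [hvw (i + 1) (by omega), hvw i hi, Pi.add_apply, Nat.cast_add, add_mul,
      Finset.sum_add_distrib] at h1
    have h2 := hv i hi α c
    linarith
  have hwM : ∀ α c, ∑ b, (w (q + 1) α b : ℤ) * K.inc b c = u.coeff q true c - M c := by
    intro α c
    have h1 := u.bdry q α c
    simp only [hvw (q + 1) (by omega), Pi.add_apply, Nat.cast_add, add_mul,
      Finset.sum_add_distrib] at h1
    have h2 := hM α c
    linarith
  let y : K.Cell :=
    { coeff := fun i β => if i < q then u.coeff i β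
        else if i = q then (if β then M else u.coeff q false) else v i β
      supp := by
        intro i β b h
        split_ifs at h with h1 h2 h3
        · exact u.supp _ _ _ h
        · exact (hMs b h).trans h2.symm
        · exact h2 ▸ u.supp _ _ _ h
        · have h4 := congrFun (hvw i (by omega) β) b
          rw [Pi.add_apply] at h4
          exact u.supp i β b (by omega)
      bdry := by
        intro i β c
        rcases lt_trichotomy (i + 1) q with h | h | h
        · simp only [h, show i < q by omega, if_true]
          exact u.bdry _ _ _
        · simp only [h, lt_irrefl, if_false, show i < q by omega, if_true]
          cases β
          · simp only [Bool.false_eq_true, if_false]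
            rw [← u.bdry i false c, h]
          · exact hMb i h c
        · simp only [show ¬ (i + 1 < q) by omega, show ¬ (i < q) by omega,
            show ¬ (i + 1 = q) by omega, if_false]
          by_cases h2 : i = q
          · subst h2
            simpa using hM β c
          · simp only [h2, if_false]
            exact hv i (by omega) β c
      aug := by
        intro β
        rcases Nat.eq_zero_or_pos q with h | h
        · cases β
          · simpa [h] using u.aug false
          · simpa [h] using hMa h
        · simpa [h] using u.aug β }
  let z : K.Cell :=
    { coeff := fun i β => if i < q then u.coeff i β
        else if i = q then (if β then u.coeff q true else M) else w i β
      supp := by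
        intro i β b h
        split_ifs at h with h1 h2 h3
        · exact u.supp _ _ _ h
        · exact h2 ▸ u.supp _ _ _ h
        · exact (hMs b h).trans h2.symm
        · have h4 := congrFun (hvw i (by omega) β) b
          rw [Pi.add_apply] at h4
          exact u.supp i β b (by omega)
      bdry := by
        intro i β c
        rcases lt_trichotomy (i + 1) q with h | h | h
        · simp only [h, show i < q by omega, if_true]
          exact u.bdry _ _ _
        · simp only [h, lt_irrefl, if_false, show i < q by omega, if_true]
          cases β
          · exact hMb i h c
          · simp only [if_true]
            rw [← u.bdry i true c, h]
        · simp only [show ¬ (i + 1 < q) by omega, show ¬ (i < q) by omega,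
            show ¬ (i + 1 = q) by omega, if_false]
          by_cases h2 : i = q
          · subst h2
            simpa using hwM β c
          · simp only [h2, if_false]
            exact hw i (by omega) β c
      aug := by
        intro β
        rcases Nat.eq_zero_or_pos q with h | h
        · cases β
          · simpa [h] using hMa h
          · simpa [h] using u.aug true
        · simpa [h] using u.aug β }
  have hyz : OmegaCategory.d true q y = OmegaCategory.d false q z := by
    apply Cell.ext
    funext i β
    simp only [d_coeff, y, z]
    split_ifs <;> first | rfl | omega | simp_all
  refine ⟨y, z, hyz, ?_, ?_, ?_⟩
  · apply Cell.ext
    funext i β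
    rw [comp_coeff]
    simp only [y, z]
    rcases lt_trichotomy i q with h1 | rfl | h1
    · simp only [if_pos h1]
    · cases β <;> simp
    · simp only [if_neg (show ¬ i < q by omega), if_neg (show ¬ i = q by omega)]
      exact hvw i h1 β
  · intro i hi
    funext β
    simp only [y, if_neg (show ¬ i < q by omega), if_neg (show ¬ i = q by omega)]
  · intro i hi
    funext β
    simp only [z, if_neg (show ¬ i < q by omega), if_neg (show ¬ i = q by omega)]

/-- The comparison of cells used for induction: the numbers of faces are compared from the highest
dimension downwards. -/
theorem Cell.induction_on_size {P : K.Cell → Prop}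
    (step : ∀ u : K.Cell, (∀ (y : K.Cell) (q : ℕ),
      (∀ i, q < i → ∀ α e, y.coeff i α e ≤ u.coeff i α e) →
      (∃ i α e, q < i ∧ y.coeff i α e < u.coeff i α e) → P y) → P u) (u : K.Cell) : P u := by
  classical
  let N := ∑ b, K.dim b
  let size : K.Cell → ℕ → ℕ := fun x i => ∑ α, ∑ e, x.coeff i α e
  let μ : K.Cell → Lex ((Fin (N + 1))ᵒᵈ → ℕ) := fun x =>
    toLex fun i => size x (OrderDual.ofDual i : Fin (N + 1))
  have wf : WellFounded fun x y : K.Cell => μ x < μ y := InvImage.wf μ wellFounded_lt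
  induction u using wf.induction with
  | _ u ih =>
    refine step u fun y q hle hlt => ih y ?_
    have hsz : ∀ i, q < i → size y i ≤ size u i := fun i hi =>
      Finset.sum_le_sum fun α _ => Finset.sum_le_sum fun e _ => hle i hi α e
    have hex : ∃ i, (q < i ∧ size y i < size u i) ∧ i ≤ N := by
      obtain ⟨i, α, e, hi, h⟩ := hlt
      refine ⟨i, ⟨hi, ?_⟩, ?_⟩
      · refine Finset.sum_lt_sum (fun α _ => Finset.sum_le_sum fun e _ => hle i hi α e)
          ⟨α, Finset.mem_univ _, ?_⟩
        exact Finset.sum_lt_sum (fun e _ => hle i hi α e) ⟨e, Finset.mem_univ _, h⟩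
      · have h1 := u.supp i α e (by omega)
        have := Finset.single_le_sum (f := K.dim) (fun _ _ => Nat.zero_le _) (Finset.mem_univ e)
        omega
    obtain ⟨i, ⟨⟨hi, hiu⟩, hiN⟩, hmax⟩ :
        ∃ i, ((q < i ∧ size y i < size u i) ∧ i ≤ N) ∧
          ∀ j, i < j → j ≤ N → ¬ (q < j ∧ size y j < size u j) := by
      obtain ⟨i₀, h0, h1⟩ := hex
      refine ⟨Nat.findGreatest (fun i => q < i ∧ size y i < size u i) N,
        ⟨Nat.findGreatest_spec (P := fun i => q < i ∧ size y i < size u i) h1 h0,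
          Nat.findGreatest_le N⟩, fun j hj hjN => Nat.findGreatest_is_greatest hj hjN⟩
    refine ⟨OrderDual.toDual ⟨i, by omega⟩, fun j hj => ?_, hiu⟩
    have hj' : i < (OrderDual.ofDual j : Fin (N + 1)).1 := hj
    have h1 := hmax _ hj' (by have := (OrderDual.ofDual j : Fin (N + 1)).2; omega)
    have h2 := hsz _ (hi.trans hj')
    exact le_antisymm h2 (by by_contra h3; exact h1 ⟨hi.trans hj', lt_of_not_ge h3⟩)

namespace UnitalBasis

variable (B : UnitalBasis K)

/-- Excision of a `(q+1)`-dimensional face `c` of `u`: if the `q`-source of `c` is contained in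
that of `u` (`β = false`), then `c` splits off at the beginning of `u` in direction `q`; if the
`q`-target of `c` is contained in that of `u` (`β = true`), it splits off at the end. -/
theorem exists_excision (u : K.Cell) (q : ℕ) (c : K.Face) (hc : K.dim c = q + 1)
    (hle : ∀ α, 1 ≤ u.coeff (q + 1) α c) (β : Bool)
    (hfree : ∀ e, (B.atom c).coeff q β e ≤ u.coeff q β e) :
    ∃ (y z : K.Cell) (h : OmegaCategory.d true q y = OmegaCategory.d false q z),
      u = OmegaCategory.comp q y z h ∧
      ((∀ i, q < i → ∀ α, y.coeff i α = (B.atom c).coeff i α ∧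
          z.coeff i α = u.coeff i α - (B.atom c).coeff i α) ∨
        (∀ i, q < i → ∀ α, z.coeff i α = (B.atom c).coeff i α ∧
          y.coeff i α = u.coeff i α - (B.atom c).coeff i α)) := by
  have hcle : ∀ i, q < i → ∀ α e, (B.atom c).coeff i α e ≤ u.coeff i α e := by
    intro i hi α e
    rcases Nat.lt_or_ge (q + 1) i with h | h
    · rw [B.coeff_of_lt c i α (by omega)]
      exact Nat.zero_le _
    · obtain rfl : i = q + 1 := by omega
      rw [← hc, B.coeff_self, hc]
      by_cases he : e = c
      · subst he; simpa using hle α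
      · rw [Pi.single_eq_of_ne he]; exact Nat.zero_le _
  let M : K.Face → ℕ := fun e => u.coeff q β e - (B.atom c).coeff q β e + (B.atom c).coeff q (!β) e
  have hMe : ∀ e, (M e : ℤ) =
      u.coeff q β e - (B.atom c).coeff q β e + (B.atom c).coeff q (!β) e := by
    intro e
    simp only [M]
    push_cast [Nat.cast_sub (hfree e)]
    ring
  have hMs : ∀ b, M b ≠ 0 → K.dim b = q := by
    intro b h
    by_contra h0
    simp only [M] at h
    rw [u.coeff_eq_zero_of_dim_ne h0, (B.atom c).coeff_eq_zero_of_dim_ne h0,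
      (B.atom c).coeff_eq_zero_of_dim_ne h0] at h
    exact h rfl
  have hMb : ∀ j, j + 1 = q → ∀ e,
      ∑ b, (M b : ℤ) * K.inc b e = u.coeff j true e - u.coeff j false e := by
    rintro j rfl e
    simp only [hMe, add_mul, sub_mul, Finset.sum_add_distrib, Finset.sum_sub_distrib,
      FaceComplex.Cell.bdry]
    ring
  have hMa : q = 0 → ∑ b, M b = 1 := by
    rintro rfl
    have h1 : ∀ (x : K.Cell) α, ∑ b, (x.coeff 0 α b : ℤ) = 1 := fun x α => by
      exact_mod_cast x.aug α
    have : ∑ b, (M b : ℤ) = 1 := by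
      simp only [hMe, Finset.sum_add_distrib, Finset.sum_sub_distrib, h1]
      ring
    exact_mod_cast this
  have hr : ∀ i, q < i → ∀ α, u.coeff i α =
      (B.atom c).coeff i α + (u.coeff i α - (B.atom c).coeff i α) := by
    intro i hi α
    funext e
    have := hcle i hi α e
    simp only [Pi.add_apply, Pi.sub_apply]
    omega
  cases β
  · obtain ⟨y, z, h, e, h1, h2⟩ := u.exists_comp_eq q (B.atom c).coeff
      (fun i α => u.coeff i α - (B.atom c).coeff i α) M hr
      (fun i _ α e => (B.atom c).bdry i α e)
      (fun α e => by rw [(B.atom c).bdry, hMe]; simp only [Bool.not_false]; ring) hMs hMb hMa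
    exact ⟨y, z, h, e, Or.inl fun i hi α => ⟨by rw [h1 i hi], by rw [h2 i hi]⟩⟩
  · have hsub : ∀ i, q < i → ∀ α e, (((u.coeff i α - (B.atom c).coeff i α) e : ℕ) : ℤ) =
        u.coeff i α e - (B.atom c).coeff i α e := by
      intro i hi α e
      rw [Pi.sub_apply, Nat.cast_sub (hcle i hi α e)]
    obtain ⟨y, z, h, e, h1, h2⟩ := u.exists_comp_eq q
      (fun i α => u.coeff i α - (B.atom c).coeff i α) (B.atom c).coeff M
      (fun i hi α => (hr i hi α).trans (add_comm _ _))
      (fun i hi α e => by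
        simp only [hsub _ (Nat.lt_succ_of_lt hi), hsub _ hi, sub_mul, Finset.sum_sub_distrib,
          FaceComplex.Cell.bdry]
        ring)
      (fun α e => by
        simp only [hsub _ (Nat.lt_succ_self q), sub_mul, Finset.sum_sub_distrib,
          FaceComplex.Cell.bdry, hMe, Bool.not_true]
        ring) hMs hMb hMa
    exact ⟨y, z, h, e, Or.inr fun i hi α => ⟨by rw [h2 i hi], by rw [h1 i hi]⟩⟩

/-- A cell that is not an atom coincides with some atom `⟨b⟩` above a degree `q + 1 ≤ dim b`, and
in degree `q + 1` it properly contains `⟨b⟩`. -/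
theorem eq_atom_or_exists_level (u : K.Cell) : (∃ b, u = B.atom b) ∨
    ∃ (b : K.Face) (q : ℕ) (r : K.Face → ℕ), q + 1 ≤ K.dim b ∧ r ≠ 0 ∧
      (∀ i, q + 1 < i → ∀ α, u.coeff i α = (B.atom b).coeff i α) ∧
      (∀ α, u.coeff (q + 1) α = (B.atom b).coeff (q + 1) α + r) := by
  classical
  obtain ⟨p, hp0, hp⟩ : ∃ p, (∃ α, u.coeff p α ≠ 0) ∧ ∀ i, p < i → ∀ α, u.coeff i α = 0 := by
    have hne : ∃ α, u.coeff 0 α ≠ 0 := by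
      refine ⟨true, fun h => ?_⟩
      have := u.aug true
      rw [h] at this
      simp at this
    let N := ∑ b, K.dim b
    have hN : ∀ i, N < i → ∀ α, u.coeff i α = 0 := by
      intro i hi α
      funext b
      apply u.coeff_eq_zero_of_dim_ne
      have := Finset.single_le_sum (f := K.dim) (fun _ _ => Nat.zero_le _) (Finset.mem_univ b)
      omega
    refine ⟨Nat.findGreatest (fun i => ∃ α, u.coeff i α ≠ 0) N,
      Nat.findGreatest_spec (P := fun i => ∃ α, u.coeff i α ≠ 0) (Nat.zero_le N) hne,
      fun i hi α => ?_⟩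
    rcases le_or_gt i N with h | h
    · by_contra h0
      exact Nat.findGreatest_is_greatest hi h ⟨α, h0⟩
    · exact hN i h α
  have hpp : ∀ α, u.coeff p α = u.coeff p false := by
    intro α
    have := u.coeff_eq_of_succ_eq_zero (hp (p + 1) (Nat.lt_succ_self p) true)
    cases α <;> simp [this]
  obtain ⟨b, hb⟩ : ∃ b, u.coeff p false b ≠ 0 := by
    obtain ⟨α, hα⟩ := hp0
    rw [hpp] at hα
    by_contra h
    push Not at h
    exact hα (funext h)
  have hdb : K.dim b = p := u.supp _ _ _ hb
  have hex : ∃ j, ∀ i, j ≤ i → ∀ α, u.coeff i α = (B.atom b).coeff i α :=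
    ⟨p + 1, fun i hi α => by rw [hp i hi, B.coeff_of_lt b i α (by omega)]⟩
  rcases Nat.eq_zero_or_pos (Nat.find hex) with h0 | h0
  · left
    refine ⟨b, Cell.ext ?_⟩
    funext i α
    exact Nat.find_spec hex i (by omega) α
  obtain ⟨j, hj⟩ : ∃ j, Nat.find hex = j + 1 := ⟨Nat.find hex - 1, by omega⟩
  have hspec : ∀ i, j < i → ∀ α, u.coeff i α = (B.atom b).coeff i α := fun i hi =>
    Nat.find_spec hex i (by omega)
  have hjp : j ≤ p := by
    have := Nat.find_min' hex (m := p + 1)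
      fun i hi α => by rw [hp i hi, B.coeff_of_lt b i α (by omega)]
    omega
  obtain ⟨r, hr⟩ : ∃ r : K.Face → ℕ, ∀ α, u.coeff j α = (B.atom b).coeff j α + r := by
    refine ⟨u.coeff j false - (B.atom b).coeff j false, fun α => ?_⟩
    funext e
    simp only [Pi.add_apply, Pi.sub_apply]
    rcases hjp.lt_or_eq with h | rfl
    · have h1 := u.bdry j true e
      rw [hspec (j + 1) (Nat.lt_succ_self j), (B.atom b).bdry] at h1
      have h2 := B.disjoint b j e (by omega)
      cases α <;> omega
    · rw [hpp α, ← hdb, B.coeff_self, B.coeff_self, hdb]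
      by_cases he : e = b
      · subst he; rw [Pi.single_eq_same]; omega
      · rw [Pi.single_eq_of_ne he]; omega
  have hr0 : r ≠ 0 := by
    rintro rfl
    have := Nat.find_min' hex (m := j) fun i hi α => by
      rcases hi.lt_or_eq with h | rfl
      · exact hspec i h α
      · rw [hr, add_zero]
    omega
  rcases Nat.eq_zero_or_pos j with rfl | hj0
  · exfalso
    apply hr0
    have h1 := u.aug true
    rw [hr] at h1
    simp only [Pi.add_apply, Finset.sum_add_distrib, (B.atom b).aug] at h1
    have h2 : ∑ e, r e = 0 := by omega
    funext e
    exact (Finset.sum_eq_zero_iff.1 h2) e (Finset.mem_univ e)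
  · obtain ⟨q, rfl⟩ : ∃ q, j = q + 1 := ⟨j - 1, by omega⟩
    exact Or.inr ⟨b, q, r, by omega, hr0, hspec, hr⟩

/-- In a loop-free complex every cell is a composite of atoms. The hypotheses say that the faces
have ranks such that an atom is preceded by the faces of its sources and followed by the faces of
its targets. -/
theorem generated_atom {R : Type*} [LinearOrder R] (rank : K.Face → R)
    (hsource : ∀ b i c, i < K.dim b → (B.atom b).coeff i false c ≠ 0 → rank c < rank b)
    (htarget : ∀ b i c, i < K.dim b → (B.atom b).coeff i true c ≠ 0 → rank b < rank c)
    (u : K.Cell) : Generated (Set.range B.atom) u := by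
  classical
  induction u using Cell.induction_on_size with
  | step u ih =>
  rcases B.eq_atom_or_exists_level u with ⟨b, rfl⟩ | ⟨b, q, r, hqb, hr0, habove, hat⟩
  · exact .base ⟨b, rfl⟩
  have hne : (Finset.univ.filter fun e => r e ≠ 0).Nonempty := by
    by_contra h
    rw [Finset.not_nonempty_iff_eq_empty, Finset.filter_eq_empty_iff] at h
    exact hr0 (funext fun e => by simpa using h (Finset.mem_univ e))
  have hrdim : ∀ e, r e ≠ 0 → K.dim e = q + 1 := by
    intro e he
    apply u.supp (q + 1) true
    rw [hat, Pi.add_apply]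
    omega
  -- the chains of `u` in degree `q`
  have hq : ∀ e, (u.coeff q true e : ℤ) - u.coeff q false e =
      ((B.atom b).coeff q true e - (B.atom b).coeff q false e) +
        ∑ a, (r a : ℤ) * ((B.atom a).coeff q true e - (B.atom a).coeff q false e) := by
    intro e
    rw [← u.bdry q true e, hat]
    simp only [Pi.add_apply, Nat.cast_add, add_mul, Finset.sum_add_distrib, (B.atom b).bdry]
    congr 1
    refine Finset.sum_congr rfl fun a _ => ?_
    by_cases ha : r a = 0
    · simp [ha]
    · rw [B.inc_eq a e q (hrdim a ha)]
  -- it suffices to excise a face `c` of `r`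
  have finish : ∀ c β, r c ≠ 0 → (∀ e, (B.atom c).coeff q β e ≤ u.coeff q β e) →
      Generated (Set.range B.atom) u := by
    intro c β hc hfree
    have hcd := hrdim c hc
    obtain ⟨y, z, h, e, hyz⟩ := B.exists_excision u q c hcd
      (fun α => by rw [hat, Pi.add_apply]; omega) β hfree
    have key : ∀ y z : K.Cell, (∀ i, q < i → ∀ α, y.coeff i α = (B.atom c).coeff i α ∧
        z.coeff i α = u.coeff i α - (B.atom c).coeff i α) →
        Generated (Set.range B.atom) y ∧ Generated (Set.range B.atom) z := by
      intro y z hyz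
      have hc1 : ∀ α, (B.atom c).coeff (q + 1) α = Pi.single c 1 := fun α => by
        rw [← hcd, B.coeff_self]
      have hle : ∀ i, q < i → ∀ α e, (B.atom c).coeff i α e ≤ u.coeff i α e := by
        intro i hi α e
        rcases Nat.lt_or_ge (q + 1) i with h | h
        · rw [B.coeff_of_lt c i α (by omega)]
          exact Nat.zero_le _
        · obtain rfl : i = q + 1 := by omega
          rw [hc1, hat, Pi.add_apply]
          by_cases he : e = c
          · subst he; rw [Pi.single_eq_same]; omega
          · rw [Pi.single_eq_of_ne he]; exact Nat.zero_le _
      constructor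
      · refine ih y q (fun i hi α e => by rw [(hyz i hi α).1]; exact hle i hi α e)
          ⟨K.dim b, true, b, by omega, ?_⟩
        rw [(hyz _ (by omega) true).1]
        rcases Nat.lt_or_ge (q + 1) (K.dim b) with h | h
        · rw [habove _ h, B.coeff_self, B.coeff_of_lt c _ true (by omega)]
          simp
        · obtain h' : K.dim b = q + 1 := by omega
          rw [h', hat, hc1, Pi.add_apply, ← h', B.coeff_self, Pi.single_eq_same]
          by_cases hbc : b = c
          · subst hbc; rw [Pi.single_eq_same]; omega
          · rw [Pi.single_eq_of_ne hbc]; omega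
      · refine ih z q (fun i hi α e => by
            rw [(hyz i hi α).2, Pi.sub_apply]; exact Nat.sub_le _ _)
          ⟨q + 1, true, c, Nat.lt_succ_self q, ?_⟩
        rw [(hyz _ (by omega) true).2, Pi.sub_apply, hc1, hat, Pi.add_apply, Pi.single_eq_same]
        omega
    rw [e]
    rcases hyz with hyz | hyz
    · exact .comp q h (key y z hyz).1 (key y z hyz).2
    · exact .comp q h (key z y hyz).2 (key z y hyz).1
  obtain ⟨c, hcm, hcmin⟩ := Finset.exists_min_image _ rank hne
  obtain ⟨c', hcm', hcmax⟩ := Finset.exists_max_image _ rank hne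
  simp only [Finset.mem_filter, Finset.mem_univ, true_and] at hcm hcm' hcmin hcmax
  rcases le_or_gt (rank c) (rank b) with hcb | hcb
  · -- `c` is minimal among `b` and the faces of `r`: it can be excised at the beginning
    refine finish c false hcm fun e => ?_
    by_cases he : (B.atom c).coeff q false e = 0
    · rw [he]; exact Nat.zero_le _
    have h1 : rank e < rank c := hsource c q e (by rw [hrdim c hcm]; omega) he
    have h2 : (B.atom b).coeff q true e = 0 := by
      by_contra h
      exact absurd (htarget b q e (by omega) h) (by
        exact not_lt.2 (h1.le.trans hcb))
    have h3 : ∀ a, (r a : ℤ) * ((B.atom a).coeff q true e - (B.atom a).coeff q false e) =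
        -((r a : ℤ) * (B.atom a).coeff q false e) := by
      intro a
      by_cases ha : r a = 0
      · simp [ha]
      · have : (B.atom a).coeff q true e = 0 := by
          by_contra h
          exact absurd (htarget a q e (by rw [hrdim a ha]; omega) h)
            (not_lt.2 (h1.le.trans (hcmin a ha)))
        rw [this]; push_cast; ring
    have h4 := hq e
    simp only [h3, Finset.sum_neg_distrib] at h4
    have h5 : (r c : ℤ) * (B.atom c).coeff q false e ≤
        ∑ a, (r a : ℤ) * (B.atom a).coeff q false e :=
      Finset.single_le_sum (f := fun a => (r a : ℤ) * (B.atom a).coeff q false e)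
        (fun a _ => by positivity) (Finset.mem_univ c)
    have h6 : ((B.atom c).coeff q false e : ℤ) ≤ (r c : ℤ) * (B.atom c).coeff q false e := by
      have : (1 : ℤ) ≤ r c := by exact_mod_cast Nat.one_le_iff_ne_zero.2 hcm
      nlinarith [Int.natCast_nonneg ((B.atom c).coeff q false e)]
    rw [h2] at h4
    have h7 := Int.natCast_nonneg ((B.atom b).coeff q false e)
    have h8 := Int.natCast_nonneg (u.coeff q true e)
    have : ((B.atom c).coeff q false e : ℤ) ≤ u.coeff q false e := by push_cast at h4; linarith
    exact_mod_cast this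
  · -- all faces of `r` come after `b`: the last one can be excised at the end
    refine finish c' true hcm' fun e => ?_
    by_cases he : (B.atom c').coeff q true e = 0
    · rw [he]; exact Nat.zero_le _
    have h1 : rank c' < rank e := htarget c' q e (by rw [hrdim c' hcm']; omega) he
    have h2 : (B.atom b).coeff q false e = 0 := by
      by_contra h
      exact absurd (hsource b q e (by omega) h)
        (not_lt.2 ((hcb.le.trans (hcmin c' hcm')).trans h1.le))
    have h3 : ∀ a, (r a : ℤ) * ((B.atom a).coeff q true e - (B.atom a).coeff q false e) =
        (r a : ℤ) * (B.atom a).coeff q true e := by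
      intro a
      by_cases ha : r a = 0
      · simp [ha]
      · have : (B.atom a).coeff q false e = 0 := by
          by_contra h
          exact absurd (hsource a q e (by rw [hrdim a ha]; omega) h)
            (not_lt.2 ((hcmax a ha).trans h1.le))
        rw [this]; push_cast; ring
    have h4 := hq e
    simp only [h3] at h4
    have h5 : (r c' : ℤ) * (B.atom c').coeff q true e ≤
        ∑ a, (r a : ℤ) * (B.atom a).coeff q true e :=
      Finset.single_le_sum (f := fun a => (r a : ℤ) * (B.atom a).coeff q true e)
        (fun a _ => by positivity) (Finset.mem_univ c')
    have h6 : ((B.atom c').coeff q true e : ℤ) ≤ (r c' : ℤ) * (B.atom c').coeff q true e := by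
      have : (1 : ℤ) ≤ r c' := by exact_mod_cast Nat.one_le_iff_ne_zero.2 hcm'
      nlinarith [Int.natCast_nonneg ((B.atom c').coeff q true e)]
    rw [h2] at h4
    have h7 := Int.natCast_nonneg ((B.atom b).coeff q true e)
    have h8 := Int.natCast_nonneg (u.coeff q false e)
    have : ((B.atom c').coeff q true e : ℤ) ≤ u.coeff q true e := by push_cast at h4; linarith
    exact_mod_cast this

end UnitalBasis
end FaceComplex

/-! ### Unital bases of cubes and simplexes -/

namespace Cube

variable {n : ℕ}

theorem AtomMem.zeros_subset {w v : Word n} {i : ℕ} {α : Bool} (h : AtomMem w i α v) :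
    (Finset.univ.filter fun k => v k = 0) ⊆ Finset.univ.filter fun k => w k = 0 := by
  intro k hk
  simp only [Finset.mem_filter, Finset.mem_univ, true_and] at hk ⊢
  by_contra h0
  rw [h.2.1 k h0] at hk
  exact h0 hk

theorem AtomMem.le_zeros {w v : Word n} {i : ℕ} {α : Bool} (h : AtomMem w i α v) :
    i ≤ zeros w := h.1 ▸ Finset.card_le_card h.zeros_subset

theorem AtomMem.eq_of_le {w v : Word n} {i : ℕ} {α : Bool} (h : AtomMem w i α v)
    (hi : zeros w ≤ i) : v = w := by
  have h1 := Finset.eq_of_subset_of_card_le h.zeros_subset (hi.trans h.1.ge)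
  funext k
  by_cases hk : w k = 0
  · have : k ∈ Finset.univ.filter fun k => w k = 0 := by simpa using hk
    rw [← h1] at this
    rw [hk]
    simpa using this
  · exact h.2.1 k hk

theorem atomMem_zeros (w v : Word n) (α : Bool) : AtomMem w (zeros w) α v ↔ v = w := by
  constructor
  · exact fun h => h.eq_of_le le_rfl
  · rintro rfl
    exact ⟨rfl, fun _ _ => rfl, fun k h1 h2 => absurd h1 h2⟩

theorem AtomMem.exists_ne {w v : Word n} {i : ℕ} {α : Bool} (h : AtomMem w i α v)
    (hi : i < zeros w) : ∃ k, w k = 0 ∧ v k ≠ 0 := by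
  by_contra h0
  push Not at h0
  have : v = w := by
    funext k
    by_cases hk : w k = 0
    · rw [hk, h0 k hk]
    · exact h.2.1 k hk
  rw [← h.1, this] at hi
  exact lt_irrefl _ hi

/-- The atoms of the cube form a unital basis. -/
noncomputable def basis (n : ℕ) : (complex n).UnitalBasis where
  atom := atom
  coeff_self w α := by
    classical
    funext v
    simp only [atom, Pi.single_apply]
    exact if_congr (atomMem_zeros w v α) rfl rfl
  coeff_of_lt w i α h := by
    classical
    funext v
    simp only [atom, Pi.zero_apply]
    exact if_neg fun h' => absurd h'.le_zeros (not_le.2 h)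
  disjoint w i v h := by
    classical
    by_contra h0
    simp only [atom, ite_eq_right_iff, one_ne_zero, imp_false, not_or, not_not] at h0
    obtain ⟨k, hk, hvk⟩ := h0.1.exists_ne h
    have h1 := (h0.1.2.2 k hk hvk).symm.trans (h0.2.2.2 k hk hvk)
    simp [sg] at h1

/-- The letters of a word, with the sign of a letter reversed when it is preceded by an odd number
of zeros. In the lexicographic order of these twisted words, the faces of the source of a face
come before it and those of the target come after it. -/
def rank (w : Word n) : Lex (Fin n → ℤ) := toLex fun k => (w k : ℤ) * (-1) ^ zerosBefore w k

theorem AtomMem.exists_first {w v : Word n} {i : ℕ} {α : Bool} (h : AtomMem w i α v)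
    (hi : i < zeros w) : ∃ k, (∀ j < k, ofLex (rank w) j = ofLex (rank v) j) ∧
      ofLex (rank w) k = 0 ∧ ofLex (rank v) k = sg α := by
  obtain ⟨k₀, h1, h2⟩ := h.exists_ne hi
  obtain ⟨k, hk, hmin⟩ := Finset.exists_min_image
    (Finset.univ.filter fun k => w k = 0 ∧ v k ≠ 0) (fun k => k) ⟨k₀, by simp [h1, h2]⟩
  simp only [Finset.mem_filter, Finset.mem_univ, true_and] at hk hmin
  have heq : ∀ j < k, w j = v j := by
    intro j hj
    by_cases hwj : w j = 0
    · by_contra h0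
      exact absurd (hmin j ⟨hwj, fun h3 => h0 (hwj.trans h3.symm)⟩) (not_le.2 hj)
    · exact (h.2.1 j hwj).symm
  refine ⟨k, fun j hj => ?_, ?_, h.2.2 k hk.1 hk.2⟩
  · have hz : zerosBefore w j = zerosBefore v j := by
      rw [zerosBefore, zerosBefore]
      congr 1
      refine Finset.filter_congr fun l _ => and_congr_right fun hl => ?_
      rw [heq l (hl.trans hj)]
    simp only [rank, ofLex_toLex, hz, heq j hj]
  · simp [rank, hk.1]

/-- Every element of the cube is a composite of atoms. -/
theorem generated (u : CubeCat n) : Generated (Set.range (atom (n := n))) u := by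
  classical
  have hmem : ∀ (w v : Word n) i α, ((basis n).atom w).coeff i α v ≠ 0 → AtomMem w i α v := by
    intro w v i α h
    by_contra h0
    exact h (if_neg h0)
  refine (basis n).generated_atom (rank (n := n)) (fun w i v hi h => ?_) (fun w i v hi h => ?_) u
  · obtain ⟨k, h1, h2, h3⟩ := (hmem _ _ _ _ h).exists_first hi
    exact ⟨k, fun j hj => (h1 j hj).symm, by
      change ofLex (rank v) k < ofLex (rank w) k
      rw [h2, h3]; simp [sg]⟩
  · obtain ⟨k, h1, h2, h3⟩ := (hmem _ _ _ _ h).exists_first hi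
    exact ⟨k, h1, by
      change ofLex (rank w) k < ofLex (rank v) k
      rw [h2, h3]; simp [sg]⟩

end Cube

namespace Simplex

variable {n : ℕ}

theorem atomMem_card (σ τ : Face n) (α : Bool) : AtomMem σ (σ.1.card - 1) α τ ↔ τ = σ := by
  have hpos := σ.2.card_pos
  constructor
  · rintro ⟨h1, h2, -⟩
    exact Subtype.ext (Finset.eq_of_subset_of_card_le h2 (by omega))
  · rintro rfl
    refine ⟨by omega, subset_rfl, fun k hk => ?_⟩
    rw [Finset.sdiff_self] at hk
    exact absurd hk (Finset.notMem_empty k)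

/-- The atoms of the simplex form a unital basis. -/
noncomputable def basis (n : ℕ) : (complex n).UnitalBasis where
  atom := atom
  coeff_self σ α := by
    classical
    funext τ
    simp only [atom, Pi.single_apply]
    exact if_congr (atomMem_card σ τ α) rfl rfl
  coeff_of_lt σ i α h := by
    classical
    funext τ
    simp only [atom, Pi.zero_apply]
    refine if_neg fun h' => ?_
    have h1 := Finset.card_le_card h'.2.1
    have h2 := h'.1
    change σ.1.card - 1 < i at h
    omega
  disjoint σ i τ h := by
    classical
    by_contra h0
    simp only [atom, ite_eq_right_iff, one_ne_zero, imp_false, not_or, not_not] at h0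
    obtain ⟨⟨h1, -, h3⟩, ⟨-, -, h4⟩⟩ := h0
    have h5 : (σ.1 \ τ.1).Nonempty := by
      rw [Finset.sdiff_nonempty]
      intro h6
      have := Finset.card_le_card h6
      change i < σ.1.card - 1 at h
      omega
    obtain ⟨k, hk⟩ := h5
    have h1 := (h3 k hk).symm.trans (h4 k hk)
    simp [sg] at h1

end Simplex

/-! ### The link of the initial vertex of a cube -/

namespace Cube

/-- The boundary of a chain of a cube, evaluated at the face `v`. -/
theorem sum_mul_inc {n : ℕ} (x : Word n → ℤ) (v : Word n) :
    ∑ w, x w * inc w v =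
      ∑ j, (v j : ℤ) * (-1) ^ zerosBefore v j * x (Function.update v j 0) := by
  simp only [inc, Finset.mul_sum]
  rw [Finset.sum_comm]
  refine Finset.sum_congr rfl fun j _ => ?_
  rw [Finset.sum_eq_single (Function.update v j 0)]
  · have e : ∀ s, (v = Function.update v j s) ↔ v j = s := by
      intro s
      constructor
      · intro h
        have := congrFun h j
        rwa [Function.update_self] at this
      · rintro rfl
        exact (Function.update_eq_self j v).symm
    have hz : zerosBefore (Function.update v j 0) j = zerosBefore v j := by
      by_cases hj : v j = 0
      · rw [(e 0).2 hj, Function.update_idem]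
      · rw [zerosBefore_update v hj, if_neg (lt_irrefl j), add_zero]
    rw [Function.update_self, if_pos rfl, hz]
    simp only [Function.update_idem, e]
    have hs : ∀ s : SignType, ((if s = 1 then 1 else 0) - (if s = -1 then 1 else 0) : ℤ) = s := by
      decide
    rw [hs]
    ring
  · intro w _ hw
    by_cases hj : w j = 0
    · have h : ∀ s, v ≠ Function.update w j s := by
        rintro s rfl
        apply hw
        rw [Function.update_idem, ← hj, Function.update_eq_self]
      simp [h]
    · simp [hj]
  · simp

/-- The word with letter `0` at the positions in `σ` and letter `-` elsewhere. These are the faces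
of the cube that contain the initial vertex; those with `σ` non-empty form a simplex, the link of
the initial vertex. -/
def linkWord {n : ℕ} (σ : Finset (Fin n)) : Word n := fun k => if k ∈ σ then 0 else -1

variable {n : ℕ}

theorem linkWord_apply_eq_zero {σ : Finset (Fin n)} {k : Fin n} : linkWord σ k = 0 ↔ k ∈ σ := by
  by_cases h : k ∈ σ <;> simp [linkWord, h]

theorem linkWord_injective : Function.Injective (linkWord (n := n)) := by
  intro σ τ h
  ext k
  rw [← linkWord_apply_eq_zero, h, linkWord_apply_eq_zero]

theorem linkWord_empty : linkWord (∅ : Finset (Fin n)) = botWord n := by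
  funext k
  simp [linkWord, botWord]

theorem linkWord_le (σ : Finset (Fin n)) (k : Fin n) : linkWord σ k ≤ 0 := by
  by_cases h : k ∈ σ <;> simp [linkWord, h]

theorem exists_linkWord {w : Word n} (h : ∀ k, w k ≤ 0) : ∃ σ, w = linkWord σ := by
  refine ⟨Finset.univ.filter fun k => w k = 0, funext fun k => ?_⟩
  have := h k
  simp only [linkWord, Finset.mem_filter, Finset.mem_univ, true_and]
  revert this
  generalize w k = a
  revert a
  decide

theorem zeros_linkWord (σ : Finset (Fin n)) : zeros (linkWord σ) = σ.card := by
  rw [zeros]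
  congr 1
  ext k
  simp [linkWord_apply_eq_zero]

theorem zerosBefore_linkWord (σ : Finset (Fin (n + 1))) (j : Fin (n + 1)) :
    zerosBefore (linkWord σ) j = Simplex.before σ j := by
  rw [zerosBefore, Simplex.before]
  congr 1
  ext k
  simp [linkWord_apply_eq_zero, and_comm]

theorem update_linkWord_zero (σ : Finset (Fin n)) (j : Fin n) :
    Function.update (linkWord σ) j 0 = linkWord (insert j σ) := by
  funext k
  by_cases h : k = j
  · subst h; simp [linkWord]
  · simp [linkWord, h]

theorem update_linkWord_neg (σ : Finset (Fin n)) (j : Fin n) :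
    Function.update (linkWord σ) j (-1) = linkWord (σ.erase j) := by
  funext k
  by_cases h : k = j
  · subst h; simp [linkWord]
  · simp [linkWord, h]

/-- The boundary of a chain of a cube, evaluated at a face of the link. -/
theorem sum_mul_inc_linkWord (x : Word (n + 1) → ℤ) (τ : Finset (Fin (n + 1))) :
    ∑ w, x w * inc w (linkWord τ) =
      ∑ j, if j ∉ τ then (-1) ^ (Simplex.before τ j + 1) * x (linkWord (insert j τ)) else 0 := by
  rw [sum_mul_inc]
  refine Finset.sum_congr rfl fun j _ => ?_
  rw [update_linkWord_zero, zerosBefore_linkWord]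
  by_cases h : j ∈ τ
  · simp [linkWord, h]
  · simp [linkWord, h, pow_succ]

end Cube

/-- The boundary of a chain of a simplex, evaluated at the face `τ`. -/
theorem Simplex.sum_mul_inc {n : ℕ} (x : Simplex.Face n → ℤ) (τ : Simplex.Face n) :
    ∑ σ, x σ * Simplex.inc σ τ = ∑ j, if j ∉ τ.1 then
      (-1) ^ (Simplex.before τ.1 j + 1) * x ⟨insert j τ.1, Finset.insert_nonempty _ _⟩ else 0 := by
  have e : ∀ σ : Face n, inc σ τ =
      ∑ j, if j ∈ σ.1 ∧ σ.1.erase j = τ.1 then (-1) ^ (before σ.1 j + 1) else 0 := by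
    intro σ
    rw [inc, ← Finset.sum_filter, ← Finset.sum_filter]
    refine Finset.sum_congr ?_ fun _ _ => rfl
    ext j
    simp
  simp only [e, Finset.mul_sum]
  rw [Finset.sum_comm]
  refine Finset.sum_congr rfl fun j _ => ?_
  by_cases hj : j ∉ τ.1
  · rw [if_pos hj, Finset.sum_eq_single ⟨insert j τ.1, Finset.insert_nonempty _ _⟩]
    · rw [if_pos ⟨Finset.mem_insert_self _ _, Finset.erase_insert hj⟩]
      simp only [before_insert hj, lt_irrefl, if_false, add_zero]
      ring
    · intro σ _ hσ
      rw [if_neg, mul_zero]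
      rintro ⟨h1, h2⟩
      exact hσ (Subtype.ext ((Finset.insert_erase h1).symm.trans (congrArg (insert j) h2)))
    · simp
  · rw [if_neg hj]
    refine Finset.sum_eq_zero fun σ _ => ?_
    rw [if_neg, mul_zero]
    rintro ⟨h1, h2⟩
    apply hj
    rw [← h2]
    simp

theorem Simplex.sum_eq_sum_point {n : ℕ} {M : Type*} [AddCommMonoid M] (f : Simplex.Face n → M)
    (hf : ∀ σ, σ.1.card ≠ 1 → f σ = 0) : ∑ σ, f σ = ∑ a, f (Simplex.point a) := by
  symm
  refine Finset.sum_of_injOn Simplex.point ?_ (fun _ _ => by simp) ?_ fun _ _ => rfl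
  · intro a _ b _ h
    exact Finset.singleton_injective (congrArg Subtype.val h)
  · intro σ _ h
    apply hf
    intro h1
    obtain ⟨a, ha⟩ := Finset.card_eq_one.1 h1
    exact h ⟨a, by simp, Subtype.ext ha.symm⟩

namespace Cube

variable {n : ℕ}

theorem bdry_botWord (u : CubeCat (n + 1)) (α : Bool) :
    (u.coeff 0 false (botWord _) : ℤ) = u.coeff 0 true (botWord _) +
      ∑ j, (u.coeff 1 α (linkWord {j}) : ℤ) := by
  have h := u.bdry 0 α (botWord _)
  rw [← linkWord_empty] at h ⊢
  rw [sum_mul_inc_linkWord] at h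
  simp only [Finset.notMem_empty, not_false_eq_true, if_true, Simplex.before, Finset.filter_empty,
    Finset.card_empty, zero_add, pow_one, insert_empty_eq, neg_mul, one_mul,
    Finset.sum_neg_distrib] at h
  linarith

theorem coeff_zero_comp_succ {u v : CubeCat n} {m : ℕ} (h : d true (m + 1) u = d false (m + 1) v)
    (β : Bool) : (comp (m + 1) u v h).coeff 0 β = u.coeff 0 β := by
  rw [FaceComplex.comp_coeff, if_pos (Nat.succ_pos m)]

theorem coeff_zero_eq {u v : CubeCat n} {m : ℕ} (h : d true (m + 1) u = d false (m + 1) v)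
    (β : Bool) : u.coeff 0 β = v.coeff 0 β := FaceComplex.Cell.d_eq_lt h (Nat.succ_pos m) β

theorem coeff_zero_eq_of_zero {u v : CubeCat n} (h : d true 0 u = d false 0 v) :
    u.coeff 0 true = v.coeff 0 false := FaceComplex.Cell.d_eq_self h

theorem coeff_zero_comp_zero {u v : CubeCat n} (h : d true 0 u = d false 0 v)
    (β : Bool) : (comp 0 u v h).coeff 0 β = if β then v.coeff 0 true else u.coeff 0 false := by
  rw [FaceComplex.comp_coeff, if_neg (lt_irrefl 0), if_pos rfl]

/-- An element of the cube whose `0`-source is not the initial vertex does not meet the link of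
the initial vertex. -/
theorem coeff_linkWord_eq_zero (u : CubeCat (n + 1)) (hu : u.coeff 0 false (botWord _) = 0) :
    ∀ i α σ, u.coeff i α (linkWord σ) = 0 := by
  classical
  induction generated u with
  | base hu' =>
    obtain ⟨w, rfl⟩ := hu'
    have h1 : ∃ k, ¬ w k ≤ 0 := by
      by_contra h0
      push Not at h0
      rw [atom_coeff_zero] at hu
      have key : ∀ a : SignType, a ≤ 0 → (if a = 0 then letter false else a) = -1 := by decide
      have e : (fun k => if w k = 0 then letter false else w k) = botWord (n + 1) :=
        funext fun k => key _ (h0 k)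
      rw [e, Pi.single_eq_same] at hu
      exact one_ne_zero hu
    obtain ⟨k, hk⟩ := h1
    intro i α σ
    refine if_neg fun h => hk ?_
    have hwk : w k ≠ 0 := fun h2 => hk h2.le
    rw [← h.2.1 k hwk]
    exact linkWord_le σ k
  | @comp m x y h _ _ ihx ihy =>
    intro i α σ
    cases m with
    | succ m =>
      rw [coeff_zero_comp_succ] at hu
      have hy := hu
      rw [coeff_zero_eq h] at hy
      have h1 := ihx hu i
      have h2 := ihy hy i
      rw [FaceComplex.comp_coeff]
      split_ifs with h3 h4 h5
      · exact h1 α σ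
      · subst h4; exact h2 _ σ
      · subst h4; exact h1 _ σ
      · rw [Pi.add_apply, h1, h2]
    | zero =>
      rw [coeff_zero_comp_zero] at hu
      have h1 := ihx (by simpa using hu)
      have h2 : y.coeff 0 false (botWord _) = 0 := by
        rw [← coeff_zero_eq_of_zero h, ← linkWord_empty]
        exact h1 0 true ∅
      have h3 := ihy h2
      rw [FaceComplex.comp_coeff]
      split_ifs with h4 h5 h6
      · exact h1 i α σ
      · exact h3 _ _ σ
      · exact h1 _ _ σ
      · rw [Pi.add_apply, h1, h3]

/-- The sum of the letters of the vertices in a chain of degree `0`. -/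
def height (x : Word n → ℕ) : ℤ := ∑ v, (x v : ℤ) * ∑ k, (v k : ℤ)

theorem height_single (v : Word n) : height (Pi.single v 1) = ∑ k, (v k : ℤ) := by
  classical
  rw [height, Finset.sum_eq_single v]
  · simp
  · intro w _ hw
    simp [Pi.single_eq_of_ne hw]
  · simp

/-- The height increases strictly from the `0`-source to the `0`-target of an element of positive
dimension. -/
theorem height_lt_or_dim_eq_zero (u : CubeCat n) :
    height (u.coeff 0 false) < height (u.coeff 0 true) ∨
      height (u.coeff 0 false) = height (u.coeff 0 true) ∧ dim u ≤ 0 := by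
  classical
  induction generated u with
  | base hu =>
    obtain ⟨w, rfl⟩ := hu
    rw [atom_coeff_zero, atom_coeff_zero, height_single, height_single]
    have hle : ∀ a : SignType, (((if a = 0 then letter false else a : SignType)) : ℤ) ≤
        ((if a = 0 then letter true else a : SignType)) := by decide
    by_cases hw : ∃ k, w k = 0
    · obtain ⟨k, hk⟩ := hw
      left
      refine Finset.sum_lt_sum (fun k _ => hle _) ⟨k, Finset.mem_univ k, ?_⟩
      simp [hk, letter]
    · push Not at hw
      right
      refine ⟨by simp [hw], ?_⟩
      have h1 := (basis n).dim_atom w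
      exact (h1.trans (zeros_eq_zero.2 hw)).le
  | @comp m x y h _ _ ihx ihy =>
    cases m with
    | succ m =>
      rw [coeff_zero_comp_succ, coeff_zero_comp_succ]
      rw [← coeff_zero_eq h, ← coeff_zero_eq h] at ihy
      rcases ihx with h1 | h1
      · exact Or.inl h1
      · rcases ihy with h2 | h2
        · exact Or.inl h2
        · exact Or.inr ⟨h1.1, dim_comp_le h h1.2 h2.2⟩
    | zero =>
      rw [coeff_zero_comp_zero, coeff_zero_comp_zero]
      rw [← coeff_zero_eq_of_zero h] at ihy
      simp only [if_true, Bool.false_eq_true, if_false]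
      rcases ihx with h1 | h1 <;> rcases ihy with h2 | h2
      · exact Or.inl (h1.trans h2)
      · exact Or.inl (h1.trans_eq h2.1)
      · exact Or.inl (h1.1.trans_lt h2)
      · exact Or.inr ⟨h1.1.trans h2.1, dim_comp_le h h1.2 h2.2⟩

/-- The elements of positive dimension starting at the initial vertex, characterized by their
`0`-source and `0`-target. -/
def Leaves (u : CubeCat (n + 1)) : Prop :=
  u.coeff 0 false (botWord _) = 1 ∧ u.coeff 0 true (botWord _) = 0

theorem Leaves.d {u : CubeCat (n + 1)} (hu : Leaves u) (α : Bool) (m : ℕ) :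
    Leaves (OmegaCategory.d α (m + 1) u) := by
  constructor <;> rw [FaceComplex.d_coeff, if_pos (Nat.succ_pos m)]
  · exact hu.1
  · exact hu.2

theorem leaves_comp_succ {u v : CubeCat (n + 1)} {m : ℕ}
    (h : d true (m + 1) u = d false (m + 1) v) : Leaves (comp (m + 1) u v h) ↔ Leaves u := by
  rw [Leaves, coeff_zero_comp_succ, coeff_zero_comp_succ, Leaves]

theorem leaves_iff_of_composable {u v : CubeCat (n + 1)} {m : ℕ}
    (h : d true (m + 1) u = d false (m + 1) v) : Leaves u ↔ Leaves v := by
  rw [Leaves, coeff_zero_eq h, coeff_zero_eq h, Leaves]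

theorem coeff_zero_le_one {N : ℕ} (u : CubeCat N) (α : Bool) (v : Word N) : u.coeff 0 α v ≤ 1 := by
  rw [← u.aug α]
  exact Finset.single_le_sum (f := u.coeff 0 α) (fun _ _ => Nat.zero_le _) (Finset.mem_univ v)

theorem coeff_zero_eq_single {N : ℕ} {u : CubeCat N} {α : Bool} {v : Word N}
    (h : u.coeff 0 α v = 1) : u.coeff 0 α = Pi.single v 1 := by
  classical
  have h1 := u.aug α
  rw [← Finset.add_sum_erase _ _ (Finset.mem_univ v), h] at h1
  have h2 : ∑ w ∈ Finset.univ.erase v, u.coeff 0 α w = 0 := by omega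
  funext w
  by_cases hw : w = v
  · rw [hw, h, Pi.single_eq_same]
  · rw [Pi.single_eq_of_ne hw]
    exact Finset.sum_eq_zero_iff.1 h2 w (by simp [hw])

theorem Leaves.d_zero {u : CubeCat (n + 1)} (hu : Leaves u) :
    OmegaCategory.d false 0 u = atom (botWord _) := by
  apply cell_ext_of_vertex (Nat.le_zero.1 (dim_d_le _ _ _)) (dim_atom_botWord _)
  rw [FaceComplex.d_coeff, if_neg (lt_irrefl 0), if_pos rfl, coeff_zero_eq_single hu.1,
    atom_coeff_zero]
  congr 1

theorem Leaves.dim_d_one {u : CubeCat (n + 1)} (hu : Leaves u) :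
    dim (OmegaCategory.d false 1 u) = 1 := by
  refine le_antisymm (dim_d_le _ _ _) ?_
  by_contra h
  have h0 : dim (OmegaCategory.d false 1 u) ≤ 0 := by omega
  have h1 := hu.d false 0
  have h2 : (OmegaCategory.d false 1 u).coeff 0 true = (OmegaCategory.d false 1 u).coeff 0 false :=
    FaceComplex.Cell.coeff_eq_of_succ_eq_zero _
      (((FaceComplex.Cell.dim_le_iff_coeff _ 0).1 h0) 1 Nat.zero_lt_one true)
  have h3 := h1.1
  rw [zero_add, ← h2] at h3
  exact absurd (h3.symm.trans h1.2) one_ne_zero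

theorem leaves_atom (σ : Simplex.Face n) : Leaves (atom (linkWord σ.1)) := by
  rw [Leaves, atom_coeff_zero, atom_coeff_zero]
  constructor
  · have e : (fun k => if linkWord σ.1 k = 0 then letter false else linkWord σ.1 k) =
        botWord (n + 1) := by
      have key : ∀ a : SignType, a ≤ 0 → (if a = 0 then letter false else a) = -1 := by decide
      exact funext fun k => key _ (linkWord_le _ k)
    rw [e, Pi.single_eq_same]
  · rw [Pi.single_eq_of_ne]
    intro e
    obtain ⟨k, hk⟩ := σ.2
    have := congrFun e k
    simp [linkWord, hk, botWord, letter] at this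

theorem exists_of_leaves_atom {w : Word (n + 1)} (h : Leaves (atom w)) :
    ∃ σ : Simplex.Face n, w = linkWord σ.1 := by
  have hle : ∀ k, w k ≤ 0 := by
    intro k
    have h1 := h.1
    rw [atom_coeff_zero] at h1
    have e : botWord (n + 1) = fun k => if w k = 0 then letter false else w k := by
      by_contra h0
      rw [Pi.single_eq_of_ne h0] at h1
      exact zero_ne_one h1
    have h2 := congrFun e k
    have key : ∀ a : SignType, -1 = (if a = 0 then letter false else a) → a ≤ 0 := by decide
    exact key _ h2
  obtain ⟨σ, rfl⟩ := exists_linkWord hle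
  refine ⟨⟨σ, ?_⟩, rfl⟩
  by_contra h0
  rw [Finset.not_nonempty_iff_eq_empty] at h0
  subst h0
  have h2 := h.2
  rw [linkWord_empty, atom_coeff_zero] at h2
  have e : (fun k => if botWord (n + 1) k = 0 then letter true else botWord (n + 1) k) =
      botWord (n + 1) := by
    funext k; simp [botWord]
  rw [e, Pi.single_eq_same] at h2
  exact one_ne_zero h2

/-- Induction on the elements of positive dimension starting at the initial vertex: they are
obtained from the atoms of the faces of the link by composition in directions other than `0` among
themselves, and by composition with arbitrary elements on the right in direction `0`. -/
theorem Leaves.induction {P : ∀ u : CubeCat (n + 1), Leaves u → Prop}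
    (atom : ∀ σ : Simplex.Face n, P (atom (linkWord σ.1)) (leaves_atom σ))
    (comp_zero : ∀ (v w : CubeCat (n + 1))
      (h : OmegaCategory.d true 0 v = OmegaCategory.d false 0 w)
      (hv : Leaves v) (hc : Leaves (comp 0 v w h)), P v hv → P (comp 0 v w h) hc)
    (comp_succ : ∀ (m : ℕ) (v w : CubeCat (n + 1))
      (h : OmegaCategory.d true (m + 1) v = OmegaCategory.d false (m + 1) w)
      (hv : Leaves v) (hw : Leaves w) (hc : Leaves (comp (m + 1) v w h)),
      P v hv → P w hw → P (comp (m + 1) v w h) hc)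
    (u : CubeCat (n + 1)) (hu : Leaves u) : P u hu := by
  induction generated u with
  | base hu' =>
    obtain ⟨w, rfl⟩ := hu'
    obtain ⟨σ, rfl⟩ := exists_of_leaves_atom hu
    exact atom σ
  | @comp m x y h _ _ ihx ihy =>
    cases m with
    | succ m =>
      have hx := (leaves_comp_succ h).1 hu
      have hy := (leaves_iff_of_composable h).1 hx
      exact comp_succ m x y h hx hy hu (ihx hx) (ihy hy)
    | zero =>
      have h1 : x.coeff 0 false (botWord _) = 1 := by
        have := hu.1
        rwa [coeff_zero_comp_zero, if_neg Bool.false_ne_true] at this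
      by_cases h2 : x.coeff 0 true (botWord _) = 0
      · exact comp_zero x y h ⟨h1, h2⟩ hu (ihx ⟨h1, h2⟩)
      · -- `x` is a loop at the initial vertex, hence an identity
        have h3 : x.coeff 0 true = x.coeff 0 false := by
          rw [coeff_zero_eq_single h1, coeff_zero_eq_single (v := botWord _)]
          have := coeff_zero_le_one x true (botWord _)
          omega
        have h4 : dim x ≤ 0 := by
          rcases height_lt_or_dim_eq_zero x with h5 | h5
          · rw [h3] at h5; exact absurd h5 (lt_irrefl _)
          · exact h5.2
        have h5 : OmegaCategory.d false 0 y = x := by rw [← h, d_of_dim_le _ h4]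
        have e : comp 0 x y h = y := by rw [comp_congr h5.symm rfl, source_comp]
        revert hu
        rw [e]
        exact ihy

/-- The trace of an element of the cube on the link of the initial vertex: the faces through the
initial vertex, with dimensions lowered by one. -/
def link (u : CubeCat (n + 1)) (hu : Leaves u) : SimplexCat n where
  coeff i α σ := u.coeff (i + 1) α (linkWord σ.1)
  supp i α σ h := by
    have := u.supp _ _ _ h
    change zeros _ = _ at this
    rw [zeros_linkWord] at this
    change σ.1.card - 1 = i
    omega
  bdry i α τ := by
    rw [← u.bdry (i + 1) α (linkWord τ.1)]
    exact (Simplex.sum_mul_inc (fun σ => (u.coeff (i + 1 + 1) α (linkWord σ.1) : ℤ)) τ).trans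
      (sum_mul_inc_linkWord (fun w => (u.coeff (i + 1 + 1) α w : ℤ)) τ.1).symm
  aug α := by
    rw [Simplex.sum_eq_sum_point]
    · have := bdry_botWord u α
      rw [hu.1, hu.2] at this
      simp only [Simplex.point]
      push_cast at this
      rw [zero_add] at this
      exact_mod_cast this.symm
    · intro σ hσ
      apply u.coeff_eq_zero_of_dim_ne
      change zeros _ ≠ _
      rw [zeros_linkWord]
      exact hσ

theorem link_coeff (u : CubeCat (n + 1)) (hu : Leaves u) (i : ℕ) (α : Bool) (σ : Simplex.Face n) :
    (link u hu).coeff i α σ = u.coeff (i + 1) α (linkWord σ.1) := rfl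

theorem link_d (u : CubeCat (n + 1)) (hu : Leaves u) (α : Bool) (m : ℕ) :
    link (d α (m + 1) u) (hu.d α m) = d α m (link u hu) := by
  apply FaceComplex.Cell.ext
  funext i β σ
  rw [link_coeff, FaceComplex.d_coeff, FaceComplex.d_coeff]
  simp only [Nat.add_lt_add_iff_right, Nat.add_right_cancel_iff]
  split_ifs <;> rfl

theorem link_composable {u v : CubeCat (n + 1)} {m : ℕ} (h : d true (m + 1) u = d false (m + 1) v)
    (hu : Leaves u) (hv : Leaves v) : d true m (link u hu) = d false m (link v hv) := by
  rw [← link_d, ← link_d]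
  congr 1

theorem link_comp_succ {u v : CubeCat (n + 1)} {m : ℕ} (h : d true (m + 1) u = d false (m + 1) v)
    (hu : Leaves u) (hv : Leaves v) (hc : Leaves (comp (m + 1) u v h)) :
    link (comp (m + 1) u v h) hc =
      comp m (link u hu) (link v hv) (link_composable h hu hv) := by
  apply FaceComplex.Cell.ext
  funext i β σ
  rw [link_coeff, FaceComplex.comp_coeff, FaceComplex.comp_coeff]
  simp only [Nat.add_lt_add_iff_right, Nat.add_right_cancel_iff]
  split_ifs <;> rfl

/-- Composition on the right in direction `0` does not change the link: the second factor does not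
start at the initial vertex, so it does not meet the link. -/
theorem link_comp_zero {u v : CubeCat (n + 1)} (h : d true 0 u = d false 0 v)
    (hu : Leaves u) (hc : Leaves (comp 0 u v h)) : link (comp 0 u v h) hc = link u hu := by
  apply FaceComplex.Cell.ext
  funext i β σ
  rw [link_coeff, FaceComplex.comp_coeff, if_neg (by omega), if_neg (by omega), Pi.add_apply,
    coeff_linkWord_eq_zero v (by rw [← coeff_zero_eq_of_zero h]; exact hu.2), add_zero, link_coeff]

theorem atomMem_linkWord (σ τ : Simplex.Face n) (i : ℕ) (α : Bool) :
    AtomMem (linkWord σ.1) (i + 1) α (linkWord τ.1) ↔ Simplex.AtomMem σ i α τ := by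
  rw [AtomMem, Simplex.AtomMem, zeros_linkWord]
  refine and_congr_right fun _ => and_congr ?_ ?_
  · constructor
    · intro h k hk
      by_contra h0
      have := h k (fun h1 => h0 (linkWord_apply_eq_zero.1 h1))
      simp [linkWord, hk, h0] at this
    · intro h k hk
      have h1 : k ∉ σ.1 := fun h0 => hk (linkWord_apply_eq_zero.2 h0)
      have h2 : k ∉ τ.1 := fun h0 => h1 (h h0)
      simp [linkWord, h1, h2]
  · simp only [Finset.mem_sdiff, Ne, linkWord_apply_eq_zero, and_imp, zerosBefore_linkWord]
    refine forall_congr' fun k => imp_congr_right fun _ => ?_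
    by_cases h : k ∈ τ.1
    · simp [h]
    · simp [linkWord, h, pow_succ]

theorem link_atom (σ : Simplex.Face n) :
    link (atom (linkWord σ.1)) (leaves_atom σ) = Simplex.atom σ := by
  classical
  apply FaceComplex.Cell.ext
  funext i β τ
  exact if_congr (atomMem_linkWord σ τ i β) rfl rfl

/-! ### Naturality of the link -/

theorem pushWord_linkWord {m n : ℕ} (θ : Fin m →o Fin n) (σ : Finset (Fin m)) :
    pushWord θ (linkWord σ) = linkWord (σ.image θ) := by
  funext j
  by_cases h : j ∈ σ.image θ
  · obtain ⟨i, hi, rfl⟩ := Finset.mem_image.1 h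
    rw [linkWord_apply_eq_zero.2 h]
    refine le_antisymm (pushWord_le _ _ fun k _ => linkWord_le _ k) ?_
    rw [← linkWord_apply_eq_zero.2 hi]
    exact le_pushWord θ _ i
  · have h0 : linkWord (σ.image θ) j = -1 := by simp only [linkWord, if_neg h]
    rw [h0]
    refine le_antisymm (pushWord_le _ _ fun k hk => ?_) ?_
    swap
    · generalize pushWord θ (linkWord σ) j = a
      revert a
      decide
    have : k ∉ σ := fun h1 => h (Finset.mem_image.2 ⟨k, h1, hk⟩)
    simp [linkWord, this]

theorem exists_of_pushWord_eq {m n : ℕ} {θ : Fin m →o Fin n} {v : Word m} {ρ : Finset (Fin n)}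
    (h : pushWord θ v = linkWord ρ) : ∃ σ, v = linkWord σ := by
  refine exists_linkWord fun k => (le_pushWord θ v k).trans ?_
  rw [h]
  exact linkWord_le _ _

theorem Leaves.map {m n : ℕ} {u : CubeCat (m + 1)} (hu : Leaves u)
    (θ : Fin (m + 1) →o Fin (n + 1)) : Leaves (mapFunctor θ u) := by
  classical
  have key : ∀ α, (mapFunctor θ u).coeff 0 α (botWord _) = u.coeff 0 α (botWord _) := by
    intro α
    change ∑ b, (if pushWord θ b = botWord _ ∧ zeros (botWord _) = 0 then u.coeff 0 α b else 0) = _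
    rw [Finset.sum_eq_single (botWord _)]
    · rw [if_pos]
      refine ⟨pushWord_botWord θ, ?_⟩
      rw [← linkWord_empty, zeros_linkWord, Finset.card_empty]
    · intro b _ hb
      rw [if_neg]
      rintro ⟨h, -⟩
      apply hb
      funext k
      have := le_pushWord θ b k
      rw [h] at this
      exact le_bot_iff.1 this
    · simp
  exact ⟨(key _).trans hu.1, (key _).trans hu.2⟩

theorem link_map {m n : ℕ} (u : CubeCat (m + 1)) (hu : Leaves u)
    (θ : Fin (m + 1) →o Fin (n + 1)) :
    link (mapFunctor θ u) (hu.map θ) = Simplex.mapFunctor θ (link u hu) := by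
  classical
  apply FaceComplex.Cell.ext
  funext i α ρ
  change ∑ v, (if pushWord θ v = linkWord ρ.1 ∧ zeros (linkWord ρ.1) = i + 1 then
    u.coeff (i + 1) α v else 0) = ∑ σ, if Simplex.imageFace θ σ = ρ ∧ ρ.1.card - 1 = i then
      u.coeff (i + 1) α (linkWord σ.1) else 0
  symm
  refine Finset.sum_of_injOn (fun σ : Simplex.Face m => linkWord σ.1) ?_ (fun _ _ => by simp) ?_ ?_
  · intro σ _ τ _ h
    exact Subtype.ext (linkWord_injective h)
  · intro v _ hv
    rw [if_neg]
    rintro ⟨h, -⟩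
    obtain ⟨σ, rfl⟩ := exists_of_pushWord_eq h
    refine hv ⟨⟨σ, ?_⟩, by simp, rfl⟩
    rw [pushWord_linkWord] at h
    exact Finset.image_nonempty.1 (linkWord_injective h ▸ ρ.2)
  · intro σ _
    refine if_congr ?_ rfl rfl
    rw [pushWord_linkWord, linkWord_injective.eq_iff, zeros_linkWord, Subtype.ext_iff]
    have := ρ.2.card_pos
    exact and_congr_right fun _ => by omega

end Cube

/-! ### A chain-level section of the link -/

namespace Cube

/-- The word `w` followed by the letter `a`. -/
def snoc {n : ℕ} (w : Word n) (a : SignType) : Word (n + 1) :=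
  Fin.snoc (α := fun _ => SignType) w a

section Snoc

variable {n : ℕ} (w : Word n) (a : SignType)

theorem snoc_castSucc (j : Fin n) : snoc w a j.castSucc = w j := Fin.snoc_castSucc _ _ _

theorem snoc_last : snoc w a (Fin.last n) = a := Fin.snoc_last _ _

theorem init_snoc : Fin.init (snoc w a) = w := Fin.init_snoc _ _

theorem exists_eq_snoc (w : Word (n + 1)) : ∃ w' a, w = snoc w' a :=
  ⟨Fin.init w, w (Fin.last n), (Fin.snoc_init_self w).symm⟩

theorem snoc_inj {w v : Word n} {a b : SignType} : snoc w a = snoc v b ↔ w = v ∧ a = b :=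
  Fin.snoc_inj

theorem snoc_const (a : SignType) : snoc (fun _ : Fin n => a) a = fun _ => a := by
  funext j
  refine Fin.lastCases ?_ (fun k => ?_) j
  · rw [snoc_last]
  · rw [snoc_castSucc]

theorem update_snoc_castSucc (j : Fin n) (s : SignType) :
    Function.update (snoc w a) j.castSucc s = snoc (Function.update w j s) a :=
  (Fin.snoc_update (α := fun _ => SignType) a w j s).symm

theorem update_snoc_last (s : SignType) : Function.update (snoc w a) (Fin.last n) s = snoc w s :=
  Fin.update_snoc_last (α := fun _ => SignType) a w s

theorem zeros_eq_sum {n : ℕ} (w : Word n) : zeros w = ∑ j, if w j = 0 then 1 else 0 := by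
  rw [zeros, Finset.card_filter]

theorem zeros_snoc : zeros (snoc w a) = zeros w + if a = 0 then 1 else 0 := by
  rw [zeros_eq_sum, zeros_eq_sum, Fin.sum_univ_castSucc]
  simp only [snoc_castSucc, snoc_last]

theorem zerosBefore_eq_sum {n : ℕ} (w : Word n) (i : Fin n) :
    zerosBefore w i = ∑ j, if j < i ∧ w j = 0 then 1 else 0 := by
  rw [zerosBefore, Finset.card_filter]

theorem zerosBefore_snoc_castSucc (i : Fin n) :
    zerosBefore (snoc w a) i.castSucc = zerosBefore w i := by
  rw [zerosBefore_eq_sum, zerosBefore_eq_sum, Fin.sum_univ_castSucc]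
  simp only [snoc_castSucc, Fin.castSucc_lt_castSucc_iff, snoc_last]
  rw [if_neg, add_zero]
  rintro ⟨h, -⟩
  exact absurd h (not_lt.2 (Fin.le_last _))

theorem zerosBefore_snoc_last : zerosBefore (snoc w a) (Fin.last n) = zeros w := by
  rw [zerosBefore_eq_sum, zeros_eq_sum, Fin.sum_univ_castSucc]
  simp [snoc_castSucc, Fin.castSucc_lt_last]

end Snoc

/-- The coefficients of a section of the map that restricts the chains of a cube to the link of the
initial vertex. For a word `w` in `{-, 0}` with at least one zero, the word `v` occurs in the chain
with coefficient `sectionCoeff w v`; besides `w` itself this chain consists of words with a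
letter `+`. For a vertex of the link it is a path from the initial to the final vertex of the
cube. In terms of the last letters, the chains are given by
`s(w -) = s(w) - `, plus `(+ ⋯ +) 0` if `w` has exactly one zero, and
`s(w 0) = s(w) 0`, plus `s(w') +` if the last letter of `w` is not zero and `w'` is obtained from
`w` by replacing it by `0`. -/
def sectionCoeff : (n : ℕ) → Word n → Word n → ℕ
  | 0, _, _ => 1
  | n + 1, w, v =>
    if w (Fin.last n) = 0 then
      if v (Fin.last n) = 0 then sectionCoeff n (Fin.init w) (Fin.init v)
      else if v (Fin.last n) = 1 then
        ∑ j : Fin n, if j.1 + 1 = n ∧ Fin.init w j ≠ 0 then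
          sectionCoeff n (Function.update (Fin.init w) j 0) (Fin.init v) else 0
      else 0
    else
      if v (Fin.last n) = -1 then sectionCoeff n (Fin.init w) (Fin.init v)
      else if v (Fin.last n) = 0 then
        if zeros (Fin.init w) = 1 ∧ Fin.init v = (fun _ => 1) then 1 else 0
      else 0

section

variable {n : ℕ} (w v : Word n)

theorem sectionCoeff_neg_neg :
    sectionCoeff (n + 1) (snoc w (-1)) (snoc v (-1)) = sectionCoeff n w v := by
  simp [sectionCoeff, snoc_last, init_snoc]

theorem sectionCoeff_neg_zero :
    sectionCoeff (n + 1) (snoc w (-1)) (snoc v 0) =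
      if zeros w = 1 ∧ v = (fun _ => 1) then 1 else 0 := by
  simp [sectionCoeff, snoc_last, init_snoc]

theorem sectionCoeff_neg_pos : sectionCoeff (n + 1) (snoc w (-1)) (snoc v 1) = 0 := by
  simp [sectionCoeff, snoc_last]

theorem sectionCoeff_zero_neg : sectionCoeff (n + 1) (snoc w 0) (snoc v (-1)) = 0 := by
  simp [sectionCoeff, snoc_last]

theorem sectionCoeff_zero_zero :
    sectionCoeff (n + 1) (snoc w 0) (snoc v 0) = sectionCoeff n w v := by
  simp [sectionCoeff, snoc_last, init_snoc]

theorem sectionCoeff_zero_pos (w v : Word 0) :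
    sectionCoeff (0 + 1) (snoc w 0) (snoc v 1) = 0 := by
  rw [sectionCoeff, if_pos (snoc_last _ _), snoc_last, if_neg one_ne_zero, if_pos rfl]
  exact Finset.sum_of_isEmpty _

theorem sectionCoeff_neg_zero_pos (v : Word (n + 1)) :
    sectionCoeff (n + 1 + 1) (snoc (snoc w (-1)) 0) (snoc v 1) =
      sectionCoeff (n + 1) (snoc w 0) v := by
  rw [sectionCoeff]
  simp only [snoc_last, init_snoc, if_true, one_ne_zero, if_false]
  rw [Fin.sum_univ_castSucc, Finset.sum_eq_zero, zero_add, update_snoc_last, if_pos]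
  · simp [snoc_last]
  · intro j _
    rw [if_neg]
    rintro ⟨h, -⟩
    have := j.2
    simp only [Fin.val_castSucc] at h
    omega

theorem sectionCoeff_zero_zero_pos (v : Word (n + 1)) :
    sectionCoeff (n + 1 + 1) (snoc (snoc w 0) 0) (snoc v 1) = 0 := by
  rw [sectionCoeff]
  simp only [snoc_last, init_snoc, if_true, one_ne_zero, if_false]
  refine Finset.sum_eq_zero fun j _ => ?_
  rw [if_neg]
  rintro ⟨h, h'⟩
  obtain rfl : j = Fin.last n := Fin.ext (by simp only [Fin.val_last]; omega)
  exact h' (snoc_last _ _)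

end

theorem eq_neg_or_zero {a : SignType} (h : a ≤ 0) : a = -1 ∨ a = 0 := by
  revert a; decide

theorem eq_neg_or_zero_or_pos (a : SignType) : a = -1 ∨ a = 0 ∨ a = 1 := by
  revert a; decide

theorem snoc_le_iff {n : ℕ} {w : Word n} {a : SignType} :
    (∀ k, snoc w a k ≤ 0) ↔ (∀ k, w k ≤ 0) ∧ a ≤ 0 := by
  rw [Fin.forall_fin_succ']
  simp only [snoc_castSucc, snoc_last]

/-- The section preserves dimensions. -/
theorem zeros_eq_of_sectionCoeff_ne_zero {n : ℕ} {w v : Word n} (hw : ∀ k, w k ≤ 0)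
    (h : sectionCoeff n w v ≠ 0) : zeros v = zeros w := by
  induction n with
  | zero => rw [zeros_eq_sum, zeros_eq_sum]; simp
  | succ n ih =>
    obtain ⟨w, a, rfl⟩ := exists_eq_snoc w
    obtain ⟨v, b, rfl⟩ := exists_eq_snoc v
    obtain ⟨hw', ha⟩ := snoc_le_iff.1 hw
    rw [zeros_snoc, zeros_snoc]
    rcases eq_neg_or_zero ha with rfl | rfl <;>
      rcases eq_neg_or_zero_or_pos b with rfl | rfl | rfl
    · rw [sectionCoeff_neg_neg] at h
      rw [ih hw' h]
    · rw [sectionCoeff_neg_zero] at h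
      have h1 : zeros w = 1 ∧ v = fun _ => 1 := by
        by_contra h0
        exact h (if_neg h0)
      have h2 : zeros v = 0 := zeros_eq_zero.2 fun k => by rw [h1.2]; exact one_ne_zero
      rw [h1.1, h2]
      simp
    · exact absurd (sectionCoeff_neg_pos w v) h
    · exact absurd (sectionCoeff_zero_neg w v) h
    · rw [sectionCoeff_zero_zero] at h
      rw [ih hw' h]
    · cases n with
      | zero => exact absurd (sectionCoeff_zero_pos w v) h
      | succ n =>
        obtain ⟨w, a, rfl⟩ := exists_eq_snoc w
        obtain ⟨hw'', ha'⟩ := snoc_le_iff.1 hw'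
        rcases eq_neg_or_zero ha' with rfl | rfl
        · rw [sectionCoeff_neg_zero_pos] at h
          rw [ih (snoc_le_iff.2 ⟨hw'', le_rfl⟩) h, zeros_snoc, zeros_snoc]
          simp
        · exact absurd (sectionCoeff_zero_zero_pos w v) h

/-- The only face of the link in the chain of `w` is `w` itself. -/
theorem sectionCoeff_of_le {n : ℕ} {w v : Word n} (hw : ∀ k, w k ≤ 0) (hv : ∀ k, v k ≤ 0) :
    sectionCoeff n w v = if v = w then 1 else 0 := by
  induction n with
  | zero => rw [if_pos (Subsingleton.elim _ _)]; rfl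
  | succ n ih =>
    obtain ⟨w, a, rfl⟩ := exists_eq_snoc w
    obtain ⟨v, b, rfl⟩ := exists_eq_snoc v
    obtain ⟨hw', ha⟩ := snoc_le_iff.1 hw
    obtain ⟨hv', hb⟩ := snoc_le_iff.1 hv
    simp only [snoc_inj]
    rcases eq_neg_or_zero ha with rfl | rfl <;> rcases eq_neg_or_zero hb with rfl | rfl
    · rw [sectionCoeff_neg_neg, ih hw' hv']
      simp
    · rw [sectionCoeff_neg_zero, if_neg, if_neg (fun h => absurd h.2 (by decide))]
      rintro ⟨h1, rfl⟩
      obtain ⟨k, -⟩ := Finset.card_pos.1 (h1.symm ▸ Nat.one_pos : 0 < zeros w)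
      exact (show ¬ (1 : SignType) ≤ 0 by decide) (hv' k)
    · rw [sectionCoeff_zero_neg, if_neg (fun h => absurd h.2 (by decide))]
    · rw [sectionCoeff_zero_zero, ih hw' hv']
      simp

theorem snoc_botWord (n : ℕ) : snoc (botWord n) (-1) = botWord (n + 1) := snoc_const (-1)

theorem zeros_botWord (n : ℕ) : zeros (botWord n) = 0 := by
  rw [← linkWord_empty, zeros_linkWord, Finset.card_empty]

theorem sectionCoeff_botWord {n : ℕ} (v : Word n) :
    sectionCoeff n (botWord n) v = if v = botWord n then 1 else 0 := by
  induction n with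
  | zero => rw [if_pos (Subsingleton.elim _ _)]; rfl
  | succ n ih =>
    obtain ⟨v, b, rfl⟩ := exists_eq_snoc v
    simp only [← snoc_botWord, snoc_inj]
    rcases eq_neg_or_zero_or_pos b with rfl | rfl | rfl
    · rw [sectionCoeff_neg_neg, ih]
      simp
    · rw [sectionCoeff_neg_zero, if_neg, if_neg (fun h => absurd h.2 (by decide))]
      rw [zeros_botWord]
      exact fun h => zero_ne_one h.1
    · rw [sectionCoeff_neg_pos, if_neg (fun h => absurd h.2 (by decide))]

theorem sum_zeros_sign {n : ℕ} (w : Word n) :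
    ∑ j, (if w j = 0 then (-1 : ℤ) ^ (zerosBefore w j + 1) else 0) =
      if Even (zeros w) then 0 else -1 := by
  induction n with
  | zero => simp [zeros_eq_sum]
  | succ n ih =>
    obtain ⟨w, a, rfl⟩ := exists_eq_snoc w
    rw [Fin.sum_univ_castSucc]
    simp only [snoc_castSucc, snoc_last, zerosBefore_snoc_castSucc, zerosBefore_snoc_last, ih,
      zeros_snoc]
    by_cases ha : a = 0
    · rw [if_pos ha, if_pos ha]
      simp only [Nat.even_add_one, pow_succ]
      rcases Nat.even_or_odd (zeros w) with h | h
      · simp [h, h.neg_one_pow]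
      · simp [h.neg_one_pow, Nat.not_even_iff_odd.2 h]
    · simp [ha]

/-- The section is compatible with boundaries, where the boundary of a vertex of the link is minus
the initial vertex of the cube, up to the final vertex of the cube for the vertices of the link. -/
theorem sectionCoeff_bdry {n : ℕ} (w v : Word n) (hw : ∀ k, w k ≤ 0) :
    ∑ j, (v j : ℤ) * (-1) ^ zerosBefore v j * sectionCoeff n w (Function.update v j 0) =
      ∑ j, (if w j = 0 then
        (-1) ^ (zerosBefore w j + 1) * (sectionCoeff n (Function.update w j (-1)) v : ℤ) else 0) +
      if zeros w = 1 ∧ v = (fun _ => 1) then 1 else 0 := by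
  induction n with
  | zero => simp [zeros_eq_sum]
  | succ n ih =>
    obtain ⟨w, a, rfl⟩ := exists_eq_snoc w
    obtain ⟨v, b, rfl⟩ := exists_eq_snoc v
    obtain ⟨hw', ha⟩ := snoc_le_iff.1 hw
    rw [Fin.sum_univ_castSucc, Fin.sum_univ_castSucc]
    simp only [snoc_castSucc, snoc_last, zerosBefore_snoc_castSucc, zerosBefore_snoc_last,
      update_snoc_castSucc, update_snoc_last, zeros_snoc, ← snoc_const (n := n) 1, snoc_inj]
    have htop : zeros (fun _ : Fin n => (1 : SignType)) = 0 := zeros_eq_zero.2 fun _ => by decide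
    rcases eq_neg_or_zero ha with rfl | rfl <;>
      rcases eq_neg_or_zero_or_pos b with rfl | rfl | rfl
    · simp only [sectionCoeff_neg_neg, sectionCoeff_neg_zero, ih w v hw']
      by_cases h : zeros w = 1 ∧ v = fun _ => 1
      · obtain ⟨h1, rfl⟩ := h
        simp [h1, htop]
      · simp [h]
    · simp only [sectionCoeff_neg_zero]
      have h1 : ∀ j, (v j : ℤ) * (-1) ^ zerosBefore v j *
          ((if zeros w = 1 ∧ Function.update v j 0 = (fun _ => 1) then 1 else 0 : ℕ) : ℤ) = 0 := by
        intro j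
        rw [if_neg]
        · simp
        · rintro ⟨-, h⟩
          have := congrFun h j
          rw [Function.update_self] at this
          exact absurd this (by decide)
      have h2 : ∀ j, (if w j = 0 then (-1) ^ (zerosBefore w j + 1) *
          ((if zeros (Function.update w j (-1)) = 1 ∧ v = (fun _ => 1) then 1 else 0 : ℕ) : ℤ)
          else 0) = (if zeros w = 2 ∧ v = (fun _ => 1) then 1 else 0) *
            if w j = 0 then (-1 : ℤ) ^ (zerosBefore w j + 1) else 0 := by
        intro j
        by_cases hj : w j = 0
        · have h3 := zeros_update w hj (s := -1) (by decide)
          have h4 : zeros (Function.update w j (-1)) = 1 ↔ zeros w = 2 := by omega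
          simp only [hj, if_true, h4]
          split_ifs <;> simp
        · simp [hj]
      rw [Finset.sum_eq_zero fun j _ => h1 j, Finset.sum_congr rfl fun j _ => h2 j,
        ← Finset.mul_sum, sum_zeros_sign]
      by_cases h : zeros w = 2
      · simp [h]
      · simp [h]
    · simp only [sectionCoeff_neg_zero, sectionCoeff_neg_pos]
      by_cases h : zeros w = 1 ∧ v = fun _ => 1
      · rw [if_pos h, h.2, htop]
        simp [h.1]
      · simp [h]
    · simp only [sectionCoeff_zero_neg, sectionCoeff_zero_zero, sectionCoeff_neg_neg]
      by_cases h : sectionCoeff n w v = 0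
      · simp [h]
      · rw [zeros_eq_of_sectionCoeff_ne_zero hw' h]
        simp [pow_succ]
    · simp only [sectionCoeff_zero_zero, ih w v hw', sectionCoeff_neg_zero]
      by_cases h : zeros w = 1 ∧ v = fun _ => 1
      · simp [h]
      · simp [h]
    · simp only [sectionCoeff_zero_zero, sectionCoeff_neg_pos]
      cases n with
      | zero =>
        have e : ∀ x y : Word 0, sectionCoeff 0 x y = 1 := fun _ _ => rfl
        simp [zeros_eq_sum, e, Subsingleton.elim v fun _ => 1]
      | succ n =>
        obtain ⟨w, a, rfl⟩ := exists_eq_snoc w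
        obtain ⟨hw'', ha'⟩ := snoc_le_iff.1 hw'
        rcases eq_neg_or_zero ha' with rfl | rfl
        · simp only [sectionCoeff_neg_zero_pos,
            ih (snoc w 0) v (snoc_le_iff.2 ⟨hw'', le_rfl⟩)]
          simp only [Fin.sum_univ_castSucc, snoc_castSucc, snoc_last, zerosBefore_snoc_castSucc,
            zerosBefore_snoc_last, update_snoc_castSucc, update_snoc_last,
            sectionCoeff_neg_zero_pos, zeros_snoc]
          by_cases h : sectionCoeff (n + 1) (snoc w (-1)) v = 0
          · simp [h]
          · rw [zeros_eq_of_sectionCoeff_ne_zero hw' h, zeros_snoc]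
            simp [pow_succ]
            ring
        · simp only [sectionCoeff_zero_zero_pos]
          simp only [Fin.sum_univ_castSucc, snoc_castSucc, snoc_last, zerosBefore_snoc_castSucc,
            zerosBefore_snoc_last, update_snoc_castSucc, update_snoc_last,
            sectionCoeff_neg_zero_pos, zeros_snoc, sectionCoeff_zero_zero_pos]
          by_cases h : sectionCoeff (n + 1) (snoc w 0) v = 0
          · simp [h]
          · rw [zeros_eq_of_sectionCoeff_ne_zero hw' h, zeros_snoc]
            simp [pow_succ]

end Cube

theorem Simplex.sum_inc_mul {n : ℕ} (σ : Simplex.Face n) (hσ : 2 ≤ σ.1.card)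
    (f : Finset (Fin (n + 1)) → ℤ) : ∑ τ : Simplex.Face n, Simplex.inc σ τ * f τ.1 =
      ∑ j ∈ σ.1, (-1) ^ (Simplex.before σ.1 j + 1) * f (σ.1.erase j) := by
  simp only [inc, Finset.sum_mul]
  rw [Finset.sum_comm]
  refine Finset.sum_congr rfl fun j hj => ?_
  have h : (σ.1.erase j).Nonempty := by
    rw [← Finset.card_pos, Finset.card_erase_of_mem hj]
    omega
  rw [Finset.sum_eq_single ⟨σ.1.erase j, h⟩]
  · rw [if_pos rfl]
  · intro τ _ hτ
    rw [if_neg, zero_mul]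
    intro e
    exact hτ (Subtype.ext e.symm)
  · simp

namespace Cube

variable {n : ℕ}

/-- The boundary formula for the section, in terms of subsets. -/
theorem sectionCoeff_linkWord_bdry (σ : Finset (Fin (n + 1))) (v : Word (n + 1)) :
    ∑ j, (v j : ℤ) * (-1) ^ zerosBefore v j *
        sectionCoeff (n + 1) (linkWord σ) (Function.update v j 0) =
      ∑ j ∈ σ, (-1) ^ (Simplex.before σ j + 1) *
        (sectionCoeff (n + 1) (linkWord (σ.erase j)) v : ℤ) +
      if σ.card = 1 ∧ v = (fun _ => 1) then 1 else 0 := by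
  rw [sectionCoeff_bdry _ _ (linkWord_le σ), zeros_linkWord]
  simp only [linkWord_apply_eq_zero, update_linkWord_neg, zerosBefore_linkWord]
  rw [← Finset.sum_filter, Finset.filter_mem_eq_inter, Finset.univ_inter]

/-- The chains of the element of the cube obtained from an element of the simplex. -/
def sectionChain (y : SimplexCat n) : ℕ → Bool → Word (n + 1) → ℕ
  | 0, β => Pi.single (if β then fun _ => 1 else botWord _) 1
  | i + 1, β => fun v => ∑ σ, y.coeff i β σ * sectionCoeff (n + 1) (linkWord σ.1) v

theorem sectionChain_bdry_aux (y : SimplexCat n) (i : ℕ) (β : Bool) (v : Word (n + 1)) :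
    ∑ w, (sectionChain y (i + 1) β w : ℤ) * inc w v =
      ∑ σ : Simplex.Face n, (y.coeff i β σ : ℤ) *
        (∑ j ∈ σ.1, (-1) ^ (Simplex.before σ.1 j + 1) *
          (sectionCoeff (n + 1) (linkWord (σ.1.erase j)) v : ℤ) +
        if σ.1.card = 1 ∧ v = (fun _ => 1) then 1 else 0) := by
  rw [sum_mul_inc]
  simp only [← sectionCoeff_linkWord_bdry, sectionChain, Nat.cast_sum, Nat.cast_mul,
    Finset.mul_sum]
  rw [Finset.sum_comm]
  refine Finset.sum_congr rfl fun σ _ => Finset.sum_congr rfl fun j _ => ?_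
  ring

/-- The element of the cube obtained from an element of the simplex by the chain-level section. It
runs from the initial vertex to the final vertex. -/
def sectionCell (y : SimplexCat n) : CubeCat (n + 1) where
  coeff := sectionChain y
  supp i α v h := by
    cases i with
    | zero =>
      have h1 : v = if α then fun _ => 1 else botWord _ := by
        by_contra h0
        exact h (Pi.single_eq_of_ne h0 1)
      refine zeros_eq_zero.2 fun k => ?_
      rw [h1]
      cases α
      · exact (by decide : (-1 : SignType) ≠ 0)
      · exact one_ne_zero
    | succ i =>
      obtain ⟨σ, -, hσ⟩ := Finset.exists_ne_zero_of_sum_ne_zero h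
      have h1 := y.supp i α σ (left_ne_zero_of_mul hσ)
      have h2 := zeros_eq_of_sectionCoeff_ne_zero (linkWord_le _) (right_ne_zero_of_mul hσ)
      have h3 := σ.2.card_pos
      rw [zeros_linkWord] at h2
      change zeros v = i + 1
      change σ.1.card - 1 = i at h1
      omega
  bdry i β v := by
    refine (sectionChain_bdry_aux y i β v).trans ?_
    cases i with
    | zero =>
      have key : ∀ σ : Simplex.Face n, (y.coeff 0 β σ : ℤ) *
          (∑ j ∈ σ.1, (-1) ^ (Simplex.before σ.1 j + 1) *
            (sectionCoeff (n + 1) (linkWord (σ.1.erase j)) v : ℤ) +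
          if σ.1.card = 1 ∧ v = (fun _ => 1) then 1 else 0) = (y.coeff 0 β σ : ℤ) *
            ((sectionChain y 0 true v : ℤ) - sectionChain y 0 false v) := by
        intro σ
        by_cases h : y.coeff 0 β σ = 0
        · simp [h]
        have h1 := y.supp 0 β σ h
        change σ.1.card - 1 = 0 at h1
        have h2 := σ.2.card_pos
        have h3 : σ.1.card = 1 := by omega
        obtain ⟨a, ha⟩ := Finset.card_eq_one.1 h3
        have hb : Simplex.before {a} a = 0 := by simp [Simplex.before_singleton]
        congr 1
        rw [ha, Finset.sum_singleton, hb, Finset.erase_singleton, linkWord_empty,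
          sectionCoeff_botWord]
        simp only [sectionChain, Pi.single_apply, Finset.card_singleton, true_and, if_true,
          Bool.false_eq_true, if_false]
        push_cast
        ring
      rw [Finset.sum_congr rfl fun σ _ => key σ, ← Finset.sum_mul]
      have h1 : ∑ σ, (y.coeff 0 β σ : ℤ) = 1 := by exact_mod_cast y.aug β
      rw [h1, one_mul]
    | succ i =>
      have key : ∀ σ : Simplex.Face n, (y.coeff (i + 1) β σ : ℤ) *
          (∑ j ∈ σ.1, (-1) ^ (Simplex.before σ.1 j + 1) *
            (sectionCoeff (n + 1) (linkWord (σ.1.erase j)) v : ℤ) +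
          if σ.1.card = 1 ∧ v = (fun _ => 1) then 1 else 0) =
          ∑ τ : Simplex.Face n, (y.coeff (i + 1) β σ : ℤ) * Simplex.inc σ τ *
            sectionCoeff (n + 1) (linkWord τ.1) v := by
        intro σ
        by_cases h : y.coeff (i + 1) β σ = 0
        · simp [h]
        have h1 := y.supp (i + 1) β σ h
        change σ.1.card - 1 = i + 1 at h1
        rw [if_neg (by omega), add_zero, ← Simplex.sum_inc_mul σ (by omega)
          fun τ => (sectionCoeff (n + 1) (linkWord τ) v : ℤ), Finset.mul_sum]
        exact Finset.sum_congr rfl fun τ _ => (mul_assoc _ _ _).symm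
      rw [Finset.sum_congr rfl fun σ _ => key σ, Finset.sum_comm]
      simp only [← Finset.sum_mul]
      simp only [sectionChain, Nat.cast_sum, Nat.cast_mul]
      rw [← Finset.sum_sub_distrib]
      refine Finset.sum_congr rfl fun τ _ => ?_
      rw [← sub_mul, ← y.bdry i β τ]
  aug α := by
    simp [sectionChain]

theorem sectionCell_coeff_zero (y : SimplexCat n) (β : Bool) :
    (sectionCell y).coeff 0 β = Pi.single (if β then fun _ => 1 else botWord _) 1 := rfl

theorem sectionCell_coeff_succ (y : SimplexCat n) (i : ℕ) (β : Bool) (v : Word (n + 1)) :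
    (sectionCell y).coeff (i + 1) β v =
      ∑ σ, y.coeff i β σ * sectionCoeff (n + 1) (linkWord σ.1) v := rfl

theorem leaves_sectionCell (y : SimplexCat n) : Leaves (sectionCell y) := by
  rw [Leaves, sectionCell_coeff_zero, sectionCell_coeff_zero]
  refine ⟨Pi.single_eq_same _ _, Pi.single_eq_of_ne ?_ _⟩
  intro h
  have h1 : (-1 : SignType) = 1 := congrFun h 0
  exact absurd h1 (by decide)

theorem sectionCell_d (y : SimplexCat n) (α : Bool) (m : ℕ) :
    sectionCell (d α m y) = d α (m + 1) (sectionCell y) := by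
  apply FaceComplex.Cell.ext
  funext i β
  rw [FaceComplex.d_coeff]
  cases i with
  | zero => rw [if_pos (Nat.succ_pos m)]; rfl
  | succ i =>
    funext v
    rw [sectionCell_coeff_succ, FaceComplex.d_coeff]
    simp only [Nat.add_lt_add_iff_right, Nat.add_right_cancel_iff]
    split_ifs
    · rfl
    · rfl
    · simp

theorem sectionCell_composable {x y : SimplexCat n} {m : ℕ} (h : d true m x = d false m y) :
    d true (m + 1) (sectionCell x) = d false (m + 1) (sectionCell y) := by
  rw [← sectionCell_d, ← sectionCell_d, h]

theorem sectionCell_comp {x y : SimplexCat n} {m : ℕ} (h : d true m x = d false m y) :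
    sectionCell (comp m x y h) =
      comp (m + 1) (sectionCell x) (sectionCell y) (sectionCell_composable h) := by
  apply FaceComplex.Cell.ext
  funext i β
  rw [FaceComplex.comp_coeff]
  cases i with
  | zero => rw [if_pos (Nat.succ_pos m)]; rfl
  | succ i =>
    funext v
    rw [sectionCell_coeff_succ, FaceComplex.comp_coeff]
    simp only [Nat.add_lt_add_iff_right, Nat.add_right_cancel_iff]
    split_ifs
    · rfl
    · rfl
    · rfl
    · simp only [Pi.add_apply, add_mul, Finset.sum_add_distrib, sectionCell_coeff_succ]

theorem link_sectionCell (y : SimplexCat n) : link (sectionCell y) (leaves_sectionCell y) = y := by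
  apply FaceComplex.Cell.ext
  funext i β τ
  rw [link_coeff, sectionCell_coeff_succ]
  simp only [sectionCoeff_of_le (linkWord_le _) (linkWord_le _), linkWord_injective.eq_iff]
  rw [Finset.sum_eq_single τ]
  · simp
  · intro σ _ hσ
    rw [if_neg, mul_zero]
    intro e
    exact hσ (Subtype.ext e.symm)
  · simp

end Cube

/-! ### The simplex of a negative cube -/

theorem comp_eq_left {A : Type u} [OmegaCategory A] {n : ℕ} {x y : A}
    (h : d true n x = d false n y)
    (hy : dim y ≤ n) : comp n x y h = x := by
  have e : y = d true n x := by rw [h, d_of_dim_le _ hy]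
  rw [comp_congr rfl e, comp_target]

theorem comp_eq_right {A : Type u} [OmegaCategory A] {n : ℕ} {x y : A}
    (h : d true n x = d false n y)
    (hx : dim x ≤ n) : comp n x y h = y := by
  have e : x = d false n y := by rw [← h, d_of_dim_le _ hx]
  rw [comp_congr e rfl, source_comp]

namespace Cube

variable {n : ℕ} {C : NCOmegaCat.{u}} {x : OmegaFunctor (CubeCat (n + 1)) C}

theorem IsNegative.one_le_dim_of_leaves (hx : IsNegative x) {u : CubeCat (n + 1)} (hu : Leaves u) :
    1 ≤ dim (x u) := by
  apply NCOmegaCat.one_le_dim_of_d_one (α := false)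
  rw [← x.map_d]
  refine hx _ ?_ hu.dim_d_one
  rw [d_d_of_lt _ _ _ Nat.zero_lt_one, hu.d_zero]

/-- The image in `ℙC` of an element leaving the initial vertex, under a negative cube of `C`. -/
def pathValue (hx : IsNegative x) (u : CubeCat (n + 1)) (hu : Leaves u) : C.Path :=
  ⟨x u, hx.one_le_dim_of_leaves hu⟩

/-- The image in `ℙ⁻C` of an element leaving the initial vertex, under a negative cube of `C`. -/
noncomputable def semiPathValue (hx : IsNegative x) (u : CubeCat (n + 1)) (hu : Leaves u) :
    C.semiPath :=
  C.hMinus.toFun (pathValue hx u hu)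

variable (hx : IsNegative x)

theorem semiPathValue_congr {u v : CubeCat (n + 1)} (e : u = v) (hu : Leaves u) :
    semiPathValue hx u hu = semiPathValue hx v (e ▸ hu) := by
  subst e; rfl

theorem semiPathValue_d {u : CubeCat (n + 1)} (hu : Leaves u) (α : Bool) (m : ℕ) :
    semiPathValue hx (d α (m + 1) u) (hu.d α m) = d α m (semiPathValue hx u hu) := by
  have e : pathValue hx _ (hu.d α m) = d α m (pathValue hx u hu) := Subtype.ext (x.map_d _ _ _)
  exact (congrArg C.hMinus.toFun e).trans (C.hMinus.map_d _ _ _)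

theorem semiPathValue_composable {u v : CubeCat (n + 1)} {m : ℕ}
    (h : d true (m + 1) u = d false (m + 1) v) (hu : Leaves u) (hv : Leaves v) :
    d true m (semiPathValue hx u hu) = d false m (semiPathValue hx v hv) := by
  rw [← semiPathValue_d, ← semiPathValue_d]
  exact semiPathValue_congr hx h _

theorem semiPathValue_comp_succ {u v : CubeCat (n + 1)} {m : ℕ}
    (h : d true (m + 1) u = d false (m + 1) v) (hu : Leaves u) (hv : Leaves v)
    (hc : Leaves (comp (m + 1) u v h)) :
    semiPathValue hx (comp (m + 1) u v h) hc =
      comp m (semiPathValue hx u hu) (semiPathValue hx v hv)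
        (semiPathValue_composable hx h hu hv) := by
  have h' : d true m (pathValue hx u hu) = d false m (pathValue hx v hv) :=
    Subtype.ext (x.map_composable h)
  have e : pathValue hx _ hc = comp m (pathValue hx u hu) (pathValue hx v hv) h' :=
    Subtype.ext (x.map_comp _ _ _ h _)
  exact (congrArg C.hMinus.toFun e).trans (C.hMinus.map_comp m _ _ h' _)

/-- Composition on the right in direction `0` is invisible in `ℙ⁻C`: this is the relation `ℛ⁻`. -/
theorem semiPathValue_comp_zero {u v : CubeCat (n + 1)} (h : d true 0 u = d false 0 v)
    (hu : Leaves u) (hc : Leaves (comp 0 u v h)) :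
    semiPathValue hx (comp 0 u v h) hc = semiPathValue hx u hu := by
  have e := x.map_comp 0 u v h (x.map_composable h)
  by_cases hv : 1 ≤ dim (x v)
  · exact (NCOmegaCat.hMinus_eq_of_rMinus (.rel _ _ ⟨⟨x v, hv⟩, x.map_composable h, e⟩)).symm
  · -- here `x v` is `0`-dimensional, hence an identity for `*_0`
    refine congrArg C.hMinus.toFun (Subtype.ext ?_)
    exact e.trans (comp_eq_left _ (by omega))

theorem dim_semiPathValue_le (u : CubeCat (n + 1)) (hu : Leaves u) {k : ℕ}
    (hk : dim (link u hu) ≤ k) : dim (semiPathValue hx u hu) ≤ k := by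
  induction u, hu using Leaves.induction with
  | atom σ =>
    refine (OmegaFunctor.dim_le (A := C.Path) C.hMinus _).trans ?_
    refine (NCOmegaCat.dim_path_le_iff (pathValue hx _ _) k).2 ((x.dim_le _).trans ?_)
    rw [link_atom] at hk
    have h1 := (Simplex.basis n).dim_atom σ
    have h2 := (basis (n + 1)).dim_atom (linkWord σ.1)
    change dim (Simplex.atom σ) = σ.1.card - 1 at h1
    change dim (atom (linkWord σ.1)) = zeros (linkWord σ.1) at h2
    rw [zeros_linkWord] at h2
    omega
  | comp_zero v w h hv hc ih =>
    rw [link_comp_zero h hv] at hk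
    rw [semiPathValue_comp_zero hx h hv]
    exact ih hk
  | comp_succ m v w h hv hw hc ihv ihw =>
    rw [link_comp_succ h hv hw] at hk
    rw [semiPathValue_comp_succ hx h hv hw]
    have := FaceComplex.Cell.dim_le_of_dim_comp_le _ hk
    exact dim_comp_le _ (ihv this.1) (ihw this.2)

/-- An element whose link is an atom has the same value as this atom. -/
theorem semiPathValue_eq_of_link_eq_atom (u : CubeCat (n + 1)) (hu : Leaves u) {σ : Simplex.Face n}
    (hσ : link u hu = Simplex.atom σ) :
    semiPathValue hx u hu = semiPathValue hx (atom (linkWord σ.1)) (leaves_atom σ) := by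
  induction u, hu using Leaves.induction with
  | atom τ =>
    rw [link_atom] at hσ
    obtain rfl : τ = σ := (Simplex.basis n).atom_injective hσ
    rfl
  | comp_zero v w h hv hc ih =>
    rw [link_comp_zero h hv] at hσ
    rw [semiPathValue_comp_zero hx h hv, ih hσ]
  | comp_succ m v w h hv hw hc ihv ihw =>
    rw [link_comp_succ h hv hw] at hσ
    rw [semiPathValue_comp_succ hx h hv hw]
    rcases (Simplex.basis n).dim_le_of_comp_eq_atom _ hσ with hd | hd
    · rw [comp_eq_right _ (dim_semiPathValue_le hx v hv hd)]
      rw [comp_eq_right _ hd] at hσ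
      exact ihw hσ
    · rw [comp_eq_left _ (dim_semiPathValue_le hx w hw hd)]
      rw [comp_eq_left _ hd] at hσ
      exact ihv hσ

/-- The simplex of `ℙ⁻C` associated with a negative cube of `C`: the restriction of
`semiPathValue` along the section of the link. -/
noncomputable def toSimplex : OmegaFunctor (SimplexCat n) C.semiPath where
  toFun y := semiPathValue hx (sectionCell y) (leaves_sectionCell y)
  map_d α m y := by
    rw [← semiPathValue_d]
    exact semiPathValue_congr hx (sectionCell_d y α m) _
  map_comp m y z h h' := by
    refine (semiPathValue_congr hx (sectionCell_comp h) _).trans ?_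
    exact semiPathValue_comp_succ hx _ _ _ _

/-- The value of an element leaving the initial vertex depends only on its link. -/
theorem semiPathValue_eq (u : CubeCat (n + 1)) (hu : Leaves u) :
    semiPathValue hx u hu = toSimplex hx (link u hu) := by
  induction u, hu using Leaves.induction with
  | atom σ =>
    rw [link_atom]
    exact (semiPathValue_eq_of_link_eq_atom hx _ _ (link_sectionCell _)).symm
  | comp_zero v w h hv hc ih =>
    rw [semiPathValue_comp_zero hx h hv, ih, link_comp_zero h hv]
  | comp_succ m v w h hv hw hc ihv ihw =>
    rw [semiPathValue_comp_succ hx h hv hw, link_comp_succ h hv hw,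
      (toSimplex hx).map_comp _ _ _ _ ((toSimplex hx).map_composable (link_composable h hv hw))]
    exact comp_congr ihv ihw _

theorem top_eq : top (n + 1) = atom (linkWord (Finset.univ : Finset (Fin (n + 1)))) := by
  rw [top]
  congr 1
  funext k
  simp [linkWord, topWord]

theorem leaves_top (n : ℕ) : Leaves (top (n + 1)) := by
  rw [top_eq]
  exact leaves_atom (n := n) ⟨Finset.univ, Finset.univ_nonempty⟩

theorem link_top (n : ℕ) : link (top (n + 1)) (leaves_top n) = Simplex.top n := by
  rw [Simplex.top, ← link_atom]
  congr 1
  exact top_eq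

theorem toSimplex_top : toSimplex hx (Simplex.top n) =
    C.hMinus.toFun (⟨x (top (n + 1)), hx.one_le_dim⟩ : C.Path) := by
  rw [← link_top, ← semiPathValue_eq]
  rfl

/-- Compatibility with simplicial operators. Although `mapFunctor θ (sectionCell y)` need not be of
the form `sectionCell z`, its value is determined by its link. -/
theorem toSimplex_precomp {m : ℕ} (θ : Fin (m + 1) →o Fin (n + 1)) :
    toSimplex (hx.precomp θ) = (Simplex.mapFunctor θ).comp (toSimplex hx) := by
  apply OmegaFunctor.ext
  funext y
  refine (semiPathValue_eq hx _ ((leaves_sectionCell y).map θ)).trans ?_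
  rw [link_map _ (leaves_sectionCell y), link_sectionCell]
  rfl

theorem toSimplex_postcomp {D : NCOmegaCat.{u}} (f : C ⟶ D) :
    toSimplex (hx.postcomp f) = (toSimplex hx).comp (NCOmegaCat.semiPathMap f) := by
  apply OmegaFunctor.ext
  funext y
  exact (congrFun (congrArg OmegaFunctor.toFun (NCOmegaCat.hMinus_semiPathMap f))
    (⟨x (sectionCell y), _⟩ : C.Path)).symm

end Cube

/-! ### Functors on simplexes -/

namespace Simplex

variable {n : ℕ}

/-- An `ω`-functor on a simplex is determined by its values on atoms: every element of the simplex
is a link, and links are composites of atoms. -/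
theorem functor_ext {D : Type v} [OmegaCategory D] {F G : OmegaFunctor (SimplexCat n) D}
    (h : ∀ σ, F (atom σ) = G (atom σ)) : F = G := by
  have key : ∀ u hu, F (Cube.link u hu) = G (Cube.link u hu) := by
    intro u hu
    induction u, hu using Cube.Leaves.induction with
    | atom σ => rw [Cube.link_atom, h]
    | comp_zero v w h hv hc ih => rw [Cube.link_comp_zero h hv, ih]
    | comp_succ m v w h hv hw hc ihv ihw =>
      have h' := Cube.link_composable h hv hw
      rw [Cube.link_comp_succ h hv hw, F.map_comp _ _ _ h' (F.map_composable h'),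
        G.map_comp _ _ _ h' (G.map_composable h')]
      exact comp_congr ihv ihw _
  apply OmegaFunctor.ext
  funext y
  rw [← Cube.link_sectionCell y]
  exact key _ _

theorem before_image {m : ℕ} {θ : Fin (m + 1) →o Fin (n + 1)} (hθ : StrictMono θ)
    (ρ : Finset (Fin (m + 1))) (k : Fin (m + 1)) : before (ρ.image θ) (θ k) = before ρ k := by
  rw [before, Finset.filter_image, Finset.card_image_of_injective _ hθ.injective, before]
  simp only [hθ.lt_iff_lt]

theorem atomMem_imageFace {m : ℕ} {θ : Fin (m + 1) →o Fin (n + 1)} (hθ : StrictMono θ)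
    (σ ρ : Face m) (i : ℕ) (α : Bool) :
    AtomMem (imageFace θ σ) i α (imageFace θ ρ) ↔ AtomMem σ i α ρ := by
  simp only [AtomMem, imageFace, Finset.card_image_of_injective _ hθ.injective,
    Finset.image_subset_image_iff hθ.injective, ← Finset.image_sdiff _ _ hθ.injective,
    Finset.forall_mem_image, before_image hθ]

theorem imageFace_injective {m : ℕ} {θ : Fin (m + 1) →o Fin (n + 1)} (hθ : StrictMono θ) :
    Function.Injective (imageFace θ) := fun _ _ h =>
  Subtype.ext (Finset.image_injective hθ.injective (congrArg Subtype.val h))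

theorem mapFunctor_atom {m : ℕ} {θ : Fin (m + 1) →o Fin (n + 1)} (hθ : StrictMono θ)
    (σ : Face m) : mapFunctor θ (atom σ) = atom (imageFace θ σ) := by
  classical
  apply FaceComplex.Cell.ext
  funext i α τ
  change ∑ ρ, (if imageFace θ ρ = τ ∧ τ.1.card - 1 = i then
    (if AtomMem σ i α ρ then 1 else 0) else 0) = if AtomMem (imageFace θ σ) i α τ then 1 else 0
  by_cases hτ : ∃ ρ, imageFace θ ρ = τ
  · obtain ⟨ρ, rfl⟩ := hτ
    rw [Finset.sum_eq_single ρ, atomMem_imageFace hθ]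
    · split_ifs with h1 h2 h2
      · rfl
      · rfl
      · refine absurd ⟨rfl, ?_⟩ h1
        rw [((atomMem_imageFace hθ σ ρ i α).2 h2).1]
        rfl
      · rfl
    · intro ρ' _ hne
      rw [if_neg fun h => hne (imageFace_injective hθ h.1)]
    · simp
  · rw [if_neg, Finset.sum_eq_zero fun ρ _ => if_neg fun h => hτ ⟨ρ, h.1⟩]
    intro h
    obtain ⟨ρ, -, hρ⟩ := Finset.subset_image_iff.1 (h.2.1 : τ.1 ⊆ σ.1.image θ)
    exact hτ ⟨⟨ρ, Finset.image_nonempty.1 (hρ ▸ τ.2)⟩, Subtype.ext hρ⟩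

/-- Every atom is the image of the top cell of a simplex. -/
theorem exists_mapFunctor_top (σ : Face n) :
    ∃ (k : ℕ) (θ : Fin (k + 1) →o Fin (n + 1)), mapFunctor θ (top k) = atom σ := by
  obtain ⟨k, hk⟩ := Nat.exists_eq_succ_of_ne_zero σ.2.card_pos.ne'
  let θ := σ.1.orderEmbOfFin hk
  refine ⟨k, θ.toOrderHom, ?_⟩
  rw [top, mapFunctor_atom θ.strictMono]
  exact congrArg atom (Subtype.ext (Finset.image_orderEmbOfFin_univ _ hk))

end Simplex

/-! ### Existence of the morphism of cuts -/

theorem NCOmegaCat.semiPathSource_hMinus {C : NCOmegaCat.{u}} (p : C.Path) :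
    (C.semiPathSource.toFun (C.hMinus.toFun p)).as =
      ⟨d false 0 p.1, Nat.le_zero.1 (dim_d_le _ _ _)⟩ :=
  congrArg Disc.as (congrFun (congrArg OmegaFunctor.toFun
    (NCOmegaCat.hMinus_semiPathDesc C.pathSource fun _ _ h => C.pathSource_eq h)) p)

/-- All elements of the simplex of a negative cube have as source the image of the initial vertex of
the cube. -/
theorem Cube.semiPathSource_toSimplex {n : ℕ} {C : NCOmegaCat.{u}}
    {x : OmegaFunctor (CubeCat (n + 1)) C} (hx : IsNegative x) (y : SimplexCat n) :
    (C.semiPathSource.toFun (toSimplex hx y)).as =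
      ⟨d false 0 (x (top (n + 1))), Nat.le_zero.1 (dim_d_le _ _ _)⟩ := by
  refine (NCOmegaCat.semiPathSource_hMinus _).trans (Subtype.ext ?_)
  change d false 0 (x (sectionCell y)) = d false 0 (x (top (n + 1)))
  rw [← x.map_d, ← x.map_d, (leaves_sectionCell y).d_zero, d_zero_top]

/-- The morphism from the simplicial set of negative cubes of `C` to the simplicial nerve of
`ℙ⁻C`. -/
noncomputable def cubicalToGlobular (C : NCOmegaCat.{u}) :
    cubicalNerveObj C ⟶ globularNerveObj C where
  left :=
    { app := fun _ => TypeCat.ofHom fun x => Cube.toSimplex x.2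
      naturality := fun _ _ g => by
        ext x
        exact Cube.toSimplex_precomp x.2 g.unop.toOrderHom }
  right := 𝟙 (zeroCells.obj C)
  w := by
    ext m x
    let θ := (SimplexCategory.const (SimplexCategory.mk 0) m.unop 0).toOrderHom
    refine (Cube.semiPathSource_toSimplex x.2
      (Simplex.mapFunctor θ (Simplex.top 0))).trans (Subtype.ext ?_)
    change d false 0 (x.1 (Cube.top _)) = d false 0 (x.1 (Cube.mapFunctor θ (Cube.top 1)))
    rw [← x.1.map_d, ← x.1.map_d, ← OmegaFunctor.map_d, Cube.d_zero_top, Cube.d_zero_top,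
      Cube.mapFunctor_atom_botWord]

/-- The morphism of cuts `(φ, h⁻)`, where `φ` sends a negative cube to the associated simplex. -/
noncomputable def branchingHom :
    Cut.Hom branchingSemiCubicalCut.{u} branchingSemiGlobularCut.{u} where
  φ :=
    { app := cubicalToGlobular
      naturality := fun C D f => by
        refine SimplicialObject.Augmented.hom_ext _ _ ?_ rfl
        apply NatTrans.ext
        funext m
        ext x
        exact Cube.toSimplex_postcomp x.2 f }
  ψ := hMinusNat
  comm n := by
    ext C x
    exact Subtype.ext (Cube.toSimplex_top x.2)

/-! ### Uniqueness of the morphism of cuts -/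

/-- The one-point `ω`-category. -/
def point : NCOmegaCat.{u} where
  carrier := Disc PUnit
  nonContracting x hx := by
    have : dim x ≤ 0 := (dim_le_iff x 0 false).2 rfl
    omega

/-- The `ω`-functor from the one-point `ω`-category with value a `0`-dimensional element. -/
def pointTo {C : NCOmegaCat.{u}} (c : zeroCells.obj C) : point.{u} ⟶ C :=
  NCOmegaCat.Hom.mk (C := point) (D := C)
    { toFun := fun _ => c.1
      map_d := fun α n _ => (d_of_dim_le α (c.2.le.trans (Nat.zero_le n))).symm
      map_comp := fun n _ _ _ h =>
        (comp_eq_left h (c.2.le.trans (Nat.zero_le n))).symm }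
    (fun x hx => by
      have : dim x ≤ 0 := (dim_le_iff x 0 false).2 rfl
      omega)

/-- A natural endomorphism of `C ↦ C_0` fixes the element of the one-point `ω`-category, hence all
elements. -/
theorem zeroCells_endo (η : zeroCells.{u} ⟶ zeroCells.{u}) : η = 𝟙 _ := by
  apply NatTrans.ext
  funext C
  ext c
  have h := η.naturality (pointTo c)
  let p : zeroCells.obj point.{u} := ⟨⟨PUnit.unit⟩, Nat.le_zero.1 ((dim_le_iff _ 0 false).2 rfl)⟩
  have h1 := ConcreteCategory.congr_hom h p
  have e : zeroCells.map (pointTo c) p = c := rfl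
  refine (congrArg (η.app C) e).symm.trans (h1.trans ?_)
  exact Subtype.ext rfl

namespace Cut.Hom

variable (f : Cut.Hom branchingSemiCubicalCut.{u} branchingSemiGlobularCut.{u})
  (C : NCOmegaCat.{u})

/-- The simplex associated with a negative cube by a morphism of cuts. -/
def simplex (n : ℕ) (x : {x : OmegaFunctor (CubeCat (n + 1)) C // Cube.IsNegative x}) :
    OmegaFunctor (SimplexCat n) C.semiPath :=
  (f.φ.app C).left.app (Opposite.op (SimplexCategory.mk n)) x

theorem simplex_top (hf : f.ψ = hMinusNat) {n : ℕ}
    (x : {x : OmegaFunctor (CubeCat (n + 1)) C // Cube.IsNegative x}) :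
    f.simplex C n x (Simplex.top n) =
      C.hMinus.toFun (⟨x.1 (Cube.top (n + 1)), x.2.one_le_dim⟩ : C.Path) := by
  have h := f.comm n
  rw [hf] at h
  have h1 := ConcreteCategory.congr_hom (NatTrans.congr_app h C) x
  exact congrArg Subtype.val h1

theorem simplex_precomp {m n : ℕ} (θ : Fin (m + 1) →o Fin (n + 1))
    (x : {x : OmegaFunctor (CubeCat (n + 1)) C // Cube.IsNegative x}) :
    (Simplex.mapFunctor θ).comp (f.simplex C n x) =
      f.simplex C m ⟨(Cube.mapFunctor θ).comp x.1, x.2.precomp θ⟩ :=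
  (ConcreteCategory.congr_hom
    ((f.φ.app C).left.naturality (SimplexCategory.mkHom θ).op) x).symm

theorem simplex_eq (hf : f.ψ = hMinusNat) {n : ℕ}
    (x : {x : OmegaFunctor (CubeCat (n + 1)) C // Cube.IsNegative x}) :
    f.simplex C n x = Cube.toSimplex x.2 := by
  refine Simplex.functor_ext fun σ => ?_
  obtain ⟨k, θ, hθ⟩ := Simplex.exists_mapFunctor_top σ
  rw [← hθ]
  refine (congrFun (congrArg OmegaFunctor.toFun (f.simplex_precomp C θ x)) (Simplex.top k)).trans ?_
  rw [f.simplex_top C hf, ← Cube.toSimplex_top (x.2.precomp θ), Cube.toSimplex_precomp]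
  rfl

theorem eq_branchingHom (hf : f.ψ = hMinusNat) : f = branchingHom := by
  refine Cut.Hom.ext (NatTrans.ext (funext fun C => ?_)) hf
  refine SimplicialObject.Augmented.hom_ext _ _ ?_ ?_
  · apply NatTrans.ext
    funext m
    ext x
    exact f.simplex_eq C hf x
  · exact congrArg (fun t => t.app C) (zeroCells_endo
      (Functor.whiskerRight f.φ SimplicialObject.Augmented.point))

end Cut.Hom

end Omega

theorem mainTheorem2 :
    ∃! f : Omega.Cut.Hom.{u} Omega.branchingSemiCubicalCut.{u} Omega.branchingSemiGlobularCut.{u},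
      f.ψ = Omega.hMinusNat.{u} :=
  ⟨Omega.branchingHom, rfl, fun f hf => f.eq_branchingHom hf⟩
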